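/- **Definitions.** A subset of a topological space is *exhaustive* if it meets every path component of the space. Let $f:X\to Y$ be a surjective continuous map, $\widetilde Y\subset Y$ an exhaustive subset, and write $F_y=f^{-1}(y)$. Then $f$ is a *$c$-quasifibration with respect to $\widetilde Y$* if for all $y\in\widetilde Y$ and $x\in F_y$ there are maps $\partial:\pi_{q+1}(Y,y)\to\pi_q(F_y,x)$, $q\ge 0$ (group homomorphisms for $q\geq 1$, a map of pointed sets for $q=0$), such that 1. the sequence $$\cdots\to\pi_q(F_y,x)\xrightarrow{i_*}\pi_q(X,x)\xrightarrow{f_*}\pi_q(Y,y)\xrightarrow{\partial}\pi_{q-1}(F_y,x)\to\cdots\to\pi_1(Y,y)\xrightarrow{\partial}\pi_0(F_y,x)\xrightarrow{i_*}\pi_0(X,x)\xrightarrow{f_*}\pi_0(Y,y)\to 1$$ is exact, where exactness at $\pi_1(Y,y)$ means that two elements have the same image under $\partial$ in the set $\pi_0(F_y,x)$ if and only if they differ by an element of $f_*\pi_1(X,x)$; that is, $\partial\gamma=\partial\gamma'$ if and only if $\gamma'=(f_*\alpha)\cdot\gamma$ for some $\alpha\in\pi_1(X,x)$, where $(f_*\alpha)\cdot\gamma$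 is the class of $f\circ\alpha$ followed by $\gamma$; 2. $\partial\circ f_*=\partial_*$ on $\pi_{q+1}(X,F_y,x)$ for all $q\ge 0$, where $f_*:\pi_{q+1}(X,F_y,x)\to\pi_{q+1}(Y,y)$ is induced by $f$ and $\partial_*:\pi_{q+1}(X,F_y,x)\to\pi_q(F_y,x)$ is the boundary map of the pair $(X,F_y)$ (for $q=0$ it sends the class of a path in $X$ from $x$ to a point of $F_y$ to the path component in $F_y$ of its end point). A subset $U\subset Y$ is *$c$-distinguished with respect to* an exhaustive subset $\widetilde U\subset U$ if $f|_{f^{-1}(U)}:f^{-1}(U)\to U$ is a $c$-quasifibration with respect to $\widetilde U$. **Theorem.** Let $f:X\to Y$ be a surjective continuous map of topological spaces, and let $\{U_\alpha\}_{\alpha\in J}$ be an open covering of $Y$ which is closed under taking finite (nonempty-indexed) intersections. Assume that for every $\alpha\in J$ there is an exhaustive subset $\widetilde U_\alpha\subset U_\alpha$ such that $\widetilde U_\beta\subset\widetilde U_\gamma$ whenever $U_\beta\subset U_\gamma$, for $\beta,\gamma\in J$. Assume furthermore that $U_\alpha$ is $c$-distinguished with respect to $\widetilde U_\alpha$ for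 every $\alpha\in J$. Then $f$ is a $c$-quasifibration with respect to some exhaustive subset of $Y$. -/

import Mathlib

open scoped Topology unitInterval

noncomputable section

namespace CQuasi

universe u v

/-- A subset of a space is exhaustive if it meets every path component of the space. -/
def IsExhaustive {Y : Type u} [TopologicalSpace Y] (S : Set Y) : Prop :=
  ∀ y : Y, (S ∩ pathComponent y).Nonempty

/-! ### Induced maps on absolute homotopy groups

`π_ n X x` is Mathlib's homotopy group; `π_ 0 X x` is the set of path components. -/

/-- The distinguished element of `π_ n X x`: the class of the constant map
(the unit of the group structure if `1 ≤ n`). -/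
def piBase (n : ℕ) {X : Type u} [TopologicalSpace X] (x : X) : π_ n X x :=
  Quotient.mk _ (GenLoop.const : GenLoop (Fin n) X x)

/-- Postcomposition of an `n`-dimensional loop with a continuous map. -/
def loopMap (n : ℕ) {X : Type u} {Y : Type v} [TopologicalSpace X] [TopologicalSpace Y]
    (f : C(X, Y)) (x : X) (p : GenLoop (Fin n) X x) : GenLoop (Fin n) Y (f x) :=
  ⟨f.comp p.1, fun t ht => congrArg f (p.2 t ht)⟩

/-- The map `f_* : π_n(X, x) → π_n(Y, f x)`. -/
def piMap (n : ℕ) {X : Type u} {Y : Type v} [TopologicalSpace X] [TopologicalSpace Y]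
    (f : C(X, Y)) (x : X) : π_ n X x → π_ n Y (f x) :=
  Quotient.map (loopMap n f x) fun _ _ h => h.comp_continuousMap f

/-! ### Relative homotopy sets -/

/-- Maps of triples `(I^{n+1}, ∂I^{n+1}, J) → (X, A, x)`, where `J` is the closure of the
complement in `∂I^{n+1}` of the face `{t 0 = 1}`. -/
def IsRelLoop (n : ℕ) {X : Type u} [TopologicalSpace X] (A : Set X) (x : X)
    (p : C(Fin (n + 1) → I, X)) : Prop :=
  (∀ t ∈ Cube.boundary (Fin (n + 1)), p t ∈ A) ∧
    ∀ t : Fin (n + 1) → I, (t 0 = 0 ∨ ∃ i : Fin n, t i.succ = 0 ∨ t i.succ = 1) → p t = x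

/-- The space of maps of triples `(I^{n+1}, ∂I^{n+1}, J) → (X, A, x)`. -/
abbrev RelLoop (n : ℕ) {X : Type u} [TopologicalSpace X] (A : Set X) (x : X) : Type u :=
  {p : C(Fin (n + 1) → I, X) // IsRelLoop n A x p}

/-- Homotopy through maps of triples. -/
instance relSetoid (n : ℕ) {X : Type u} [TopologicalSpace X] (A : Set X) (x : X) :
    Setoid (RelLoop n A x) where
  r p q := ContinuousMap.HomotopicWith p.1 q.1 (IsRelLoop n A x)
  iseqv :=
    { refl := fun p => ContinuousMap.HomotopicWith.refl p.1 p.2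
      symm := fun h => h.symm
      trans := fun h h' => h.trans h' }

/-- The relative homotopy set `π_{n+1}(X, A, x)`. -/
def RelPi (n : ℕ) {X : Type u} [TopologicalSpace X] (A : Set X) (x : X) : Type u :=
  Quotient (relSetoid n A x)

/-- The map `I^n → I^{n+1}` onto the face `{t 0 = 1}`. -/
def faceMap (n : ℕ) : C(Fin n → I, Fin (n + 1) → I) :=
  ⟨fun t => Fin.cons (1 : I) t, by
    refine continuous_pi fun i => ?_
    refine Fin.cases ?_ (fun j => ?_) i
    · simpa using continuous_const
    · simpa using continuous_apply j⟩

theorem faceMap_mem_boundary (n : ℕ) (t : Fin n → I) :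
    faceMap n t ∈ Cube.boundary (Fin (n + 1)) :=
  ⟨0, Or.inr rfl⟩

/-- Restriction of a relative loop to the face `{t 0 = 1}`, as an `n`-dimensional loop in `A`. -/
def relBoundaryLoop (n : ℕ) {X : Type u} [TopologicalSpace X] (A : Set X) (x : A)
    (p : RelLoop n A (x : X)) : GenLoop (Fin n) A x :=
  ⟨⟨fun t => ⟨p.1 (faceMap n t), p.2.1 _ (faceMap_mem_boundary n t)⟩, by fun_prop⟩, by
    rintro t ⟨i, hi⟩
    exact Subtype.ext (p.2.2 _ (Or.inr ⟨i, hi⟩))⟩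

/-- The boundary map `∂_* : π_{n+1}(X, A, x) → π_n(A, x)` of the pair `(X, A)`. -/
def relBoundary (n : ℕ) {X : Type u} [TopologicalSpace X] (A : Set X) (x : A) :
    RelPi n A (x : X) → π_ n A x :=
  Quotient.map (relBoundaryLoop n A x) (by
    rintro p q ⟨H⟩
    refine ⟨⟨⟨⟨fun s => ⟨H (s.1, faceMap n s.2),
      (H.prop s.1).1 _ (faceMap_mem_boundary n s.2)⟩, by fun_prop⟩, ?_, ?_⟩, ?_⟩⟩
    · intro t
      exact Subtype.ext (H.apply_zero _)
    · intro t
      exact Subtype.ext (H.apply_one _)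
    · rintro s t ⟨i, hi⟩
      refine Subtype.ext ?_
      exact ((H.prop s).2 _ (Or.inr ⟨i, hi⟩)).trans (p.2.2 _ (Or.inr ⟨i, hi⟩)).symm)

/-! ### The homotopy sequence of a map along a fibre -/

section Fibre

variable {X : Type u} {Y : Type v} [TopologicalSpace X] [TopologicalSpace Y]

/-- The fibre `F_y` of `f` over `y = f x`. -/
abbrev Fibre (f : C(X, Y)) (x : X) : Set X := f ⁻¹' {f x}

/-- The point `x` of the fibre over `f x`. -/
def fibrePt (f : C(X, Y)) (x : X) : Fibre f x := ⟨x, rfl⟩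

/-- The inclusion `i : F_y → X`. -/
def fibreIncl (f : C(X, Y)) (x : X) : C(Fibre f x, X) := ⟨Subtype.val, continuous_subtype_val⟩

/-- `i_* : π_n(F_y, x) → π_n(X, x)`. -/
def inclStar (f : C(X, Y)) (x : X) (n : ℕ) : π_ n (Fibre f x) (fibrePt f x) → π_ n X x :=
  piMap n (fibreIncl f x) (fibrePt f x)

/-- Composing a relative loop of `(X, F_y, x)` with `f` gives a loop of `(Y, y)`. -/
def relMapLoop (f : C(X, Y)) (x : X) (n : ℕ) (p : RelLoop n (Fibre f x) x) :
    GenLoop (Fin (n + 1)) Y (f x) :=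
  ⟨f.comp p.1, fun t ht => p.2.1 t ht⟩

/-- `f_* : π_{n+1}(X, F_y, x) → π_{n+1}(Y, y)`. -/
def relMap (f : C(X, Y)) (x : X) (n : ℕ) : RelPi n (Fibre f x) x → π_ (n + 1) Y (f x) :=
  Quotient.map (relMapLoop f x n) (by
    rintro p q ⟨H⟩
    refine ⟨⟨⟨⟨fun s => f (H s), by fun_prop⟩, ?_, ?_⟩, ?_⟩⟩
    · intro t
      exact congrArg f (H.apply_zero t)
    · intro t
      exact congrArg f (H.apply_one t)
    · intro s t ht
      exact ((H.prop s).1 t ht).trans (p.2.1 t ht).symm)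

/-- `∂_* : π_{n+1}(X, F_y, x) → π_n(F_y, x)`. -/
def relBdry (f : C(X, Y)) (x : X) (n : ℕ) :
    RelPi n (Fibre f x) x → π_ n (Fibre f x) (fibrePt f x) :=
  relBoundary n (Fibre f x) (fibrePt f x)

/-- Exactness at `B` of maps `A → B → C` of sets, the last one with base point `c`. -/
def ExactPt {A : Type*} {B : Type*} {C : Type*} (g : A → B) (h : B → C) (c : C) : Prop :=
  ∀ b : B, h b = c ↔ b ∈ Set.range g

/-- `∂_n : π_{n+1}(Y, y) → π_n(F_y, x)`, `n ≥ 0`, are homomorphisms (a map of pointed sets for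
`n = 0`) for which the unbounded sequence
`⋯ → π_n(F_y, x) → π_n(X, x) → π_n(Y, y) → π_{n-1}(F_y, x) → ⋯ → π_0(X, x) → π_0(Y, y) → 1`
is exact. At the last group `π_1(Y, y)` exactness is that of a sequence ending in pointed sets:
two elements have the same image in `π_0(F_y, x)` iff they lie in the same coset of the image of
`π_1(X, x)`. In Mathlib's convention `γ * α` is the class of the loop `α` followed by `γ`. -/
structure IsConnecting (f : C(X, Y)) (x : X)
    (d : ∀ n : ℕ, π_ (n + 1) Y (f x) → π_ n (Fibre f x) (fibrePt f x)) : Prop where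
  map_base : d 0 1 = piBase 0 (fibrePt f x)
  map_mul : ∀ (n : ℕ) (a b : π_ (n + 2) Y (f x)), d (n + 1) (a * b) = d (n + 1) a * d (n + 1) b
  exact_total : ∀ n : ℕ, ExactPt (inclStar f x n) (piMap n f x) (piBase n (f x))
  exact_base : ∀ n : ℕ, ExactPt (piMap (n + 1) f x) (d n) (piBase n (fibrePt f x))
  exact_fibre : ∀ n : ℕ, ExactPt (d n) (inclStar f x n) (piBase n x)
  surj_zero : Function.Surjective (piMap 0 f x)
  coset_one : ∀ γ γ' : π_ 1 Y (f x), d 0 γ = d 0 γ' ↔ ∃ α : π_ 1 X x, γ' = γ * piMap 1 f x α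

/-- `f` is a `c`-quasifibration with respect to the exhaustive subset `S` of `Y`: for all `x` with
`y = f x` in `S` there are connecting homomorphisms `∂_n : π_{n+1}(Y, y) → π_n(F_y, x)` which
make the homotopy sequence exact and satisfy `∂_n ∘ f_* = ∂_*` on `π_{n+1}(X, F_y, x)`. -/
def IsCQuasifibration (f : C(X, Y)) (S : Set Y) : Prop :=
  IsExhaustive S ∧ ∀ x : X, f x ∈ S →
    ∃ d : ∀ n : ℕ, π_ (n + 1) Y (f x) → π_ n (Fibre f x) (fibrePt f x),
      IsConnecting f x d ∧
      ∀ (n : ℕ) (p : RelPi n (Fibre f x) x), d n (relMap f x n p) = relBdry f x n p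

/-- `U ⊆ Y` is `c`-distinguished with respect to the exhaustive subset `S ⊆ U`: the restriction
`f⁻¹(U) → U` is a `c`-quasifibration with respect to `S`. -/
def IsCDistinguished (f : C(X, Y)) (U S : Set Y) : Prop :=
  S ⊆ U ∧ IsCQuasifibration (f.restrictPreimage U) ((Subtype.val : U → Y) ⁻¹' S)

end Fibre

end CQuasi

end

noncomputable section

namespace CQuasi

open Set

universe u v

set_option linter.unusedSectionVars false

/-! ### Gluing along closed sets, and concatenation of homotopies. -/

section Gluing

variable {P Z : Type*} [TopologicalSpace P] [TopologicalSpace Z]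

/-! Long exact sequences are hard to glue, so the proof trades them for a lifting property.
`PairLifting ι f W B` concerns maps of a half ball into `W` which send the flat part of the boundary
to `B` and whose restriction to the hemisphere is already lifted to `X`. The lift must extend over
the half ball up to a homotopy in `W` that is fixed on the hemisphere and keeps the flat part in
`B`. Taken in all dimensions, this says in essence that `(f⁻¹ W, f⁻¹ B) → (W, B)` is a weak
equivalence of pairs, and that property can be checked locally.

Connecting maps over `y₀` imply the lifting property for the pair (base, `y₀`), by
`HasConnecting.pairLifting`. By a diagram chase, `f_*` is onto on relative classes, and a relative
class with trivial image comes from a loop in the fibre. In degree one there is no group structure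
on relative classes; there the coset form of exactness at `π_1` takes over the role of the
homomorphism property. Conversely, by `PairLifting.exists_isConnecting`, the lifting property for
`(Y, f x)` makes `f_*` onto and `∂_*` constant on its fibres. Then `∂ = ∂_* ∘ f_*⁻¹` is well
defined, and its exactness comes from the sequence of the pair `(X, F)`.

Between these two translations stand three geometric facts. `PairLifting.of_points`: lifting for
`(W, y₀)` and `(V, y₀)`, with enough points `y₀` in `V ⊆ W`, gives lifting for `(W, V)`. The
monotonicity of the exhaustive subsets is used here: a point chosen for `U γ ⊆ U β` serves for both.
`PairLifting.of_cover`: lifting for all pairs `(U β, U γ)` gives lifting for `(Y, U α)`. The half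
ball is subdivided until each small cube goes into a member of the cover, and the lift is built cell
by cell; closure under intersections turns each cell into a problem for one pair `(U β, U γ)`.
`PairLifting.trans`: lifting for `(Y, U α)` and `(U α, y₀)` gives lifting for `(Y, y₀)`. -/

theorem exists_continuousOn_glue {A B : Set P} (hA : IsClosed A) (hB : IsClosed B) {f g : P → Z}
    (hf : ContinuousOn f A) (hg : ContinuousOn g B) (h : EqOn f g (A ∩ B)) :
    ∃ k : P → Z, ContinuousOn k (A ∪ B) ∧ EqOn k f A ∧ EqOn k g B := by
  classical
  have h1 : EqOn (A.piecewise f g) f A := fun z hz => piecewise_eq_of_mem _ _ _ hz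
  have h2 : EqOn (A.piecewise f g) g B := fun z hz => by
    by_cases hzA : z ∈ A
    · rw [h1 hzA, h ⟨hzA, hz⟩]
    · exact piecewise_eq_of_notMem _ _ _ hzA
  exact ⟨A.piecewise f g, (hf.congr h1).union_of_isClosed (hg.congr h2) hA hB, h1, h2⟩

/-- The first half of the unit interval, stretched. -/
def stretchLeft : C(I, I) := ⟨fun s => projIcc 0 1 zero_le_one (2 * (s : ℝ)), by fun_prop⟩

/-- The second half of the unit interval, stretched. -/
def stretchRight : C(I, I) := ⟨fun s => projIcc 0 1 zero_le_one (2 * (s : ℝ) - 1), by fun_prop⟩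

theorem stretchLeft_zero : stretchLeft 0 = 0 := by
  simp [stretchLeft]

theorem stretchRight_one : stretchRight 1 = 1 := by
  apply Subtype.ext; norm_num [stretchRight, coe_projIcc]

theorem stretchLeft_of_half_le {s : I} (h : 1 / 2 ≤ (s : ℝ)) : stretchLeft s = 1 := by
  apply Subtype.ext
  simp only [stretchLeft, ContinuousMap.coe_mk, coe_projIcc, Icc.coe_one]
  rw [min_eq_left (by linarith), max_eq_right zero_le_one]

theorem stretchRight_of_le_half {s : I} (h : (s : ℝ) ≤ 1 / 2) : stretchRight s = 0 := by
  apply Subtype.ext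
  simp only [stretchRight, ContinuousMap.coe_mk, coe_projIcc, Icc.coe_zero]
  exact max_eq_left ((min_le_right _ _).trans (by linarith))

/-- Concatenation of two homotopies. -/
theorem exists_concat {K : Set P} (hK : IsClosed K) {h₁ h₂ : P × I → Z}
    (c₁ : ContinuousOn h₁ (K ×ˢ univ)) (c₂ : ContinuousOn h₂ (K ×ˢ univ))
    (h : ∀ z ∈ K, h₁ (z, 1) = h₂ (z, 0)) :
    ∃ k : P × I → Z, ContinuousOn k (K ×ˢ univ) ∧
      ∀ z ∈ K, ∀ s : I, ((s : ℝ) ≤ 1 / 2 → k (z, s) = h₁ (z, stretchLeft s)) ∧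
        (1 / 2 ≤ (s : ℝ) → k (z, s) = h₂ (z, stretchRight s)) := by
  have hA : IsClosed (K ×ˢ {s : I | (s : ℝ) ≤ 1 / 2}) :=
    hK.prod (isClosed_le continuous_subtype_val continuous_const)
  have hB : IsClosed (K ×ˢ {s : I | 1 / 2 ≤ (s : ℝ)}) :=
    hK.prod (isClosed_le continuous_const continuous_subtype_val)
  obtain ⟨k, kc, kA, kB⟩ := exists_continuousOn_glue hA hB
    (f := fun q => h₁ (q.1, stretchLeft q.2)) (g := fun q => h₂ (q.1, stretchRight q.2))
    (c₁.comp (by fun_prop) fun q hq => ⟨hq.1, mem_univ _⟩)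
    (c₂.comp (by fun_prop) fun q hq => ⟨hq.1, mem_univ _⟩) (by
      rintro ⟨z, s⟩ ⟨⟨hz, hs⟩, -, hs'⟩
      simp only [mem_ofPred_eq] at hs hs'
      simp only [stretchLeft_of_half_le hs', stretchRight_of_le_half hs]
      exact h z hz)
  refine ⟨k, kc.mono ?_, fun z hz s => ⟨fun hs => kA ⟨hz, hs⟩, fun hs => kB ⟨hz, hs⟩⟩⟩
  rintro ⟨z, s⟩ ⟨hz, -⟩
  rcases le_total (s : ℝ) (1 / 2) with hs | hs
  · exact Or.inl ⟨hz, hs⟩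
  · exact Or.inr ⟨hz, hs⟩

end Gluing

/-! ### Extension of partial lifts that come with a homotopy. -/

section LiftExt

variable {X Y P Q : Type*} [TopologicalSpace X] [TopologicalSpace Y] [TopologicalSpace P]
  [TopologicalSpace Q]

/-- Partial lifts of maps `K → Y` subject to the pointwise constraint `C`, given on `L` together
with a constrained homotopy, extend to `K`; the homotopy is extended up to reparametrization. -/
def LiftExt (f : C(X, Y)) (C : P → Set Y) (L K : Set P) : Prop :=
  ∀ (x : P → X) (y : P → Y) (h : P × I → Y), ContinuousOn x L → ContinuousOn y K →
    ContinuousOn h (L ×ˢ univ) → (∀ z ∈ L, h (z, 0) = f (x z)) → (∀ z ∈ L, h (z, 1) = y z) →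
    (∀ z ∈ L, ∀ s, h (z, s) ∈ C z) → (∀ z ∈ K, y z ∈ C z) →
    ∃ (x' : P → X) (h' : P × I → Y) (d : C(I, I)), ContinuousOn x' K ∧ EqOn x' x L ∧
      ContinuousOn h' (K ×ˢ univ) ∧ (∀ z ∈ K, h' (z, 0) = f (x' z)) ∧
      (∀ z ∈ K, h' (z, 1) = y z) ∧ (∀ z ∈ K, ∀ s, h' (z, s) ∈ C z) ∧ d 0 = 0 ∧ d 1 = 1 ∧
      ∀ z ∈ L, ∀ s, h' (z, s) = h (z, d s)

variable {f : C(X, Y)} {C : P → Set Y} {L M K : Set P}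

/-- Reparametrizations compose. Allowing one, common to all points of `L`, is the price for
concatenating homotopies at each extension step. -/
theorem LiftExt.trans (hLM : L ⊆ M) (hMK : M ⊆ K) (h₁ : LiftExt f C L M) (h₂ : LiftExt f C M K) :
    LiftExt f C L K := by
  intro x y h xc yc hc h0 h1 hC yC
  obtain ⟨x₁, k₁, d₁, a1, a2, a3, a4, a5, a6, a7, a8, a9⟩ :=
    h₁ x y h xc (yc.mono hMK) hc h0 h1 hC fun z hz => yC z (hMK hz)
  obtain ⟨x₂, k₂, d₂, b1, b2, b3, b4, b5, b6, b7, b8, b9⟩ :=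
    h₂ x₁ y k₁ a1 yc a3 a4 a5 a6 yC
  refine ⟨x₂, k₂, d₁.comp d₂, b1, fun z hz => (b2 (hLM hz)).trans (a2 hz), b3, b4, b5, b6,
    by simp [b7, a7], by simp [b8, a8], fun z hz s => ?_⟩
  rw [b9 z (hLM hz), a9 z hz]; rfl

theorem LiftExt.refl : LiftExt f C L L := fun x _ h xc _ hc h0 h1 hC _ =>
  ⟨x, h, ContinuousMap.id I, xc, fun _ _ => rfl, hc, h0, h1, hC, rfl, rfl, fun _ _ _ => rfl⟩

/-- Attaching a piece along a chart. -/
theorem LiftExt.of_chart {L₀ K₀ : Set Q} (φ : Q → P) (ψ : P → Q) (hφ : ContinuousOn φ K₀)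
    (hψ : ContinuousOn ψ (φ '' K₀)) (hψφ : ∀ z ∈ K₀, ψ (φ z) = z) (hL : IsClosed L)
    (hcl : IsClosed (φ '' K₀)) (hL₀ : ∀ z ∈ K₀, φ z ∈ L ↔ z ∈ L₀) (hLK : L₀ ⊆ K₀)
    (H : LiftExt f (fun z => C (φ z)) L₀ K₀) : LiftExt f C L (L ∪ φ '' K₀) := by
  intro x y h xc yc hc h0 h1 hC yC
  have mL : MapsTo φ L₀ L := fun z hz => (hL₀ z (hLK hz)).2 hz
  have mψ : MapsTo ψ (φ '' K₀) K₀ := by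
    rintro _ ⟨z, hz, rfl⟩; rwa [hψφ z hz]
  have hφψ : ∀ p ∈ φ '' K₀, φ (ψ p) = p := by
    rintro _ ⟨z, hz, rfl⟩; rw [hψφ z hz]
  have hψL : ∀ p ∈ φ '' K₀, p ∈ L → ψ p ∈ L₀ := fun p hp hpL =>
    (hL₀ _ (mψ hp)).1 (by rwa [hφψ p hp])
  obtain ⟨x₁, k₁, d, a1, a2, a3, a4, a5, a6, a7, a8, a9⟩ :=
    H (x ∘ φ) (y ∘ φ) (fun q => h (φ q.1, q.2)) (xc.comp (hφ.mono hLK) mL)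
      (yc.comp hφ fun z hz => Or.inr ⟨z, hz, rfl⟩)
      (hc.comp (((hφ.mono hLK).comp continuousOn_fst fun q hq => hq.1).prodMk continuousOn_snd)
        fun q hq => ⟨mL hq.1, mem_univ _⟩)
      (fun z hz => h0 _ (mL hz)) (fun z hz => h1 _ (mL hz)) (fun z hz => hC _ (mL hz))
      (fun z hz => yC _ (Or.inr ⟨z, hz, rfl⟩))
  obtain ⟨x', xc', xL, xK⟩ := exists_continuousOn_glue hL hcl xc (a1.comp hψ mψ) (by
    rintro p ⟨hpL, hpK⟩
    simp only [Function.comp]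
    rw [a2 (hψL p hpK hpL)]; simp only [Function.comp]; rw [hφψ p hpK])
  -- The old homotopy must be run with the parameter `d` of the new piece in order to agree with it
  -- on the overlap.
  obtain ⟨h', hc', hL', hK'⟩ := exists_continuousOn_glue (hL.prod isClosed_univ)
    (hcl.prod isClosed_univ) (f := fun q : P × I => h (q.1, d q.2))
    (g := fun q => k₁ (ψ q.1, q.2)) (hc.comp (by fun_prop) fun q hq => ⟨hq.1, mem_univ _⟩)
    (a3.comp ((hψ.comp continuousOn_fst fun q hq => hq.1).prodMk continuousOn_snd)
      fun q hq => ⟨mψ hq.1, mem_univ _⟩) (by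
    rintro ⟨p, s⟩ ⟨⟨hpL, -⟩, hpK, -⟩
    simp only
    rw [a9 _ (hψL p hpK hpL), hφψ p hpK])
  have eL : ∀ p ∈ L, ∀ s, h' (p, s) = h (p, d s) := fun p hp s => hL' ⟨hp, mem_univ s⟩
  have eK : ∀ p ∈ φ '' K₀, ∀ s, h' (p, s) = k₁ (ψ p, s) := fun p hp s => hK' ⟨hp, mem_univ s⟩
  refine ⟨x', h', d, xc', xL, by rwa [union_prod], ?_, ?_, ?_, a7, a8, eL⟩
  · rintro p (hp | hp)
    · rw [eL p hp, a7, h0 p hp, xL hp]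
    · rw [eK p hp, a4 _ (mψ hp), xK hp]; rfl
  · rintro p (hp | hp)
    · rw [eL p hp, a8, h1 p hp]
    · rw [eK p hp, a5 _ (mψ hp)]; simp only [Function.comp]; rw [hφψ p hp]
  · rintro p (hp | hp) s
    · rw [eL p hp]; exact hC p hp _
    · rw [eK p hp]; have := a6 _ (mψ hp) s; simp only at this; rwa [hφψ p hp] at this

/-- Excision: a lift over `M` relative to `L ∩ M` extends a lift over `L`. -/
theorem LiftExt.excision {L₀ : Set P} (hL : IsClosed L) (hM : IsClosed M)
    (hL₀ : ∀ z ∈ M, z ∈ L ↔ z ∈ L₀) (hLM : L₀ ⊆ M) (H : LiftExt f C L₀ M) :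
    LiftExt f C L (L ∪ M) := by
  have := LiftExt.of_chart (f := f) (C := C) (L := L) (K₀ := M) id id continuousOn_id
    continuousOn_id (fun _ _ => rfl) hL (by rwa [image_id]) hL₀ hLM H
  rwa [image_id] at this

end LiftExt

/-! ### Half balls and the lifting property for pairs. -/

section HalfBall

variable (ι : Type*) [Fintype ι]

/-- The upper half of the unit ball of `ℝ^ι × ℝ` (for the sup norm). -/
def halfBall : Set ((ι → ℝ) × ℝ) := {z | ‖z‖ ≤ 1 ∧ 0 ≤ z.2}

/-- The part of the boundary of the half ball which lies on the unit sphere. -/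
def hemisphere : Set ((ι → ℝ) × ℝ) := {z | ‖z‖ = 1 ∧ 0 ≤ z.2}

theorem isClosed_halfBall : IsClosed (halfBall ι) :=
  (isClosed_le continuous_norm continuous_const).inter
    (isClosed_le continuous_const continuous_snd)

theorem isClosed_hemisphere : IsClosed (hemisphere ι) :=
  (isClosed_eq continuous_norm continuous_const).inter
    (isClosed_le continuous_const continuous_snd)

variable {ι}

theorem hemisphere_subset : hemisphere ι ⊆ halfBall ι := fun _ hz => ⟨hz.1.le, hz.2⟩

/-- For the sup norm the half ball is a box and the hemisphere consists of all its faces but `z.2 =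
0`. Cells of a cubical subdivision can therefore serve as half balls. -/
theorem mem_halfBall_iff {z : (ι → ℝ) × ℝ} :
    z ∈ halfBall ι ↔ ‖z.1‖ ≤ 1 ∧ 0 ≤ z.2 ∧ z.2 ≤ 1 := by
  simp only [halfBall, mem_ofPred_eq, Prod.norm_def, max_le_iff, Real.norm_eq_abs, abs_le]
  constructor
  · rintro ⟨⟨a, b⟩, c⟩; exact ⟨a, c, b.2⟩
  · rintro ⟨a, b, c⟩; exact ⟨⟨a, by linarith, c⟩, b⟩

theorem mem_hemisphere_iff {z : (ι → ℝ) × ℝ} (hz : z ∈ halfBall ι) :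
    z ∈ hemisphere ι ↔ ‖z.1‖ = 1 ∨ z.2 = 1 := by
  rw [mem_halfBall_iff] at hz
  simp only [hemisphere, mem_ofPred_eq, Prod.norm_def, Real.norm_eq_abs, abs_of_nonneg hz.2.1,
    hz.2.1, and_true]
  constructor
  · intro h
    rcases max_choice ‖z.1‖ z.2 with h' | h' <;> rw [h'] at h <;> simp [h]
  · rintro (h | h)
    · rw [h]; exact max_eq_left hz.2.2
    · rw [h]; exact max_eq_right hz.1

variable {X Y : Type*} [TopologicalSpace X] [TopologicalSpace Y]

/-- The lifting property characterizing weak equivalences of pairs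
`(f⁻¹ W, f⁻¹ B) → (W, B)` in dimension `ι`. -/
def PairLifting (ι : Type*) [Fintype ι] (f : C(X, Y)) (W B : Set Y) : Prop :=
  ∀ (x : (ι → ℝ) × ℝ → X) (y : (ι → ℝ) × ℝ → Y), ContinuousOn x (hemisphere ι) →
    ContinuousOn y (halfBall ι) → (∀ z ∈ hemisphere ι, f (x z) = y z) →
    (∀ z ∈ halfBall ι, y z ∈ W) → (∀ z ∈ halfBall ι, z.2 = 0 → y z ∈ B) →
    ∃ (x' : (ι → ℝ) × ℝ → X) (h : ((ι → ℝ) × ℝ) × I → Y), ContinuousOn x' (halfBall ι) ∧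
      EqOn x' x (hemisphere ι) ∧ ContinuousOn h (halfBall ι ×ˢ univ) ∧
      (∀ z ∈ halfBall ι, h (z, 0) = f (x' z)) ∧ (∀ z ∈ halfBall ι, h (z, 1) = y z) ∧
      (∀ z ∈ halfBall ι, ∀ s, h (z, s) ∈ W) ∧
      (∀ z ∈ halfBall ι, z.2 = 0 → ∀ s, h (z, s) ∈ B) ∧
      ∀ z ∈ hemisphere ι, ∀ s, h (z, s) = y z

/-- Homotopy extension for the half ball relative to the hemisphere; the flat part of the boundary
is preserved. -/
theorem exists_homotopy_extension {y : (ι → ℝ) × ℝ → Y} {h : ((ι → ℝ) × ℝ) × I → Y}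
    (yc : ContinuousOn y (halfBall ι)) (hc : ContinuousOn h (hemisphere ι ×ˢ univ))
    (h1 : ∀ z ∈ hemisphere ι, h (z, 1) = y z) :
    ∃ k : ((ι → ℝ) × ℝ) × I → Y, ContinuousOn k (halfBall ι ×ˢ univ) ∧
      (∀ z ∈ halfBall ι, k (z, 1) = y z) ∧ (∀ z ∈ hemisphere ι, ∀ s, k (z, s) = h (z, s)) ∧
      ∀ z ∈ halfBall ι, ∀ s, (∃ u ∈ hemisphere ι, (z.2 = 0 → u.2 = 0) ∧ ∃ r, k (z, s) = h (u, r)) ∨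
        ∃ u ∈ halfBall ι, (z.2 = 0 → u.2 = 0) ∧ k (z, s) = y u := by
  -- The extension is the radial projection of `halfBall × I` from the point `(0, -1)` onto
  -- `hemisphere × I ∪ halfBall × {1}`. Rays meeting the first part give `a` on `A`, those meeting
  -- the second give `b` on `B`. Since `z` is only rescaled, the condition `z.2 = 0` is preserved.
  let A : Set (((ι → ℝ) × ℝ) × I) := {q | q.1 ∈ halfBall ι ∧ (1 + (q.2 : ℝ)) / 2 ≤ ‖q.1‖}
  let B : Set (((ι → ℝ) × ℝ) × I) := {q | q.1 ∈ halfBall ι ∧ ‖q.1‖ ≤ (1 + (q.2 : ℝ)) / 2}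
  have hA : IsClosed A := ((isClosed_halfBall ι).preimage continuous_fst).inter
    (isClosed_le (f := fun q : ((ι → ℝ) × ℝ) × I => (1 + (q.2 : ℝ)) / 2)
      (g := fun q => ‖q.1‖) (by fun_prop) (by fun_prop))
  have hB : IsClosed B := ((isClosed_halfBall ι).preimage continuous_fst).inter
    (isClosed_le (f := fun q : ((ι → ℝ) × ℝ) × I => ‖q.1‖)
      (g := fun q => (1 + (q.2 : ℝ)) / 2) (by fun_prop) (by fun_prop))
  have posA : ∀ q ∈ A, 0 < ‖q.1‖ := fun q hq => by
    have := hq.2; have := q.2.2.1; linarith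
  let a : ((ι → ℝ) × ℝ) × I → ((ι → ℝ) × ℝ) × I := fun q =>
    (‖q.1‖⁻¹ • q.1, projIcc 0 1 zero_le_one (‖q.1‖⁻¹ * (1 + (q.2 : ℝ)) - 1))
  let b : ((ι → ℝ) × ℝ) × I → (ι → ℝ) × ℝ := fun q => (2 * (1 + (q.2 : ℝ))⁻¹) • q.1
  have ac : ContinuousOn a A := by
    have h0 : ContinuousOn (fun q : ((ι → ℝ) × ℝ) × I => ‖q.1‖⁻¹) A :=
      ContinuousOn.inv₀ (by fun_prop) fun q hq => (posA q hq).ne'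
    exact (h0.smul (by fun_prop)).prodMk
      (continuous_projIcc.comp_continuousOn ((h0.mul (by fun_prop)).sub continuousOn_const))
  have aA : ∀ q ∈ A, (a q).1 ∈ hemisphere ι := fun q hq => by
    refine ⟨?_, ?_⟩
    · simp [a, norm_smul, (posA q hq).ne']
    · exact mul_nonneg (inv_nonneg.2 (norm_nonneg _)) hq.1.2
  have bc : ContinuousOn b B := by
    have h0 : Continuous fun q : ((ι → ℝ) × ℝ) × I => (1 + (q.2 : ℝ))⁻¹ :=
      Continuous.inv₀ (by fun_prop) fun q => by have := q.2.2.1; positivity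
    exact ((continuous_const.mul h0).smul continuous_fst).continuousOn
  have bB : ∀ q ∈ B, b q ∈ halfBall ι := fun q hq => by
    have h0 := q.2.2.1
    have h2 := hq.2
    refine ⟨?_, mul_nonneg (by positivity) hq.1.2⟩
    have : ‖b q‖ = 2 * (1 + (q.2 : ℝ))⁻¹ * ‖q.1‖ := by
      simp only [b, norm_smul, Real.norm_eq_abs]
      rw [abs_of_nonneg (by positivity)]
    rw [this, mul_assoc, ← div_eq_inv_mul, ← mul_div_assoc, div_le_one (by positivity)]
    linarith
  obtain ⟨k, kc, kA, kB⟩ := exists_continuousOn_glue hA hB (f := h ∘ a) (g := y ∘ b)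
    (hc.comp ac fun q hq => ⟨aA q hq, mem_univ _⟩) (yc.comp bc bB) (by
      rintro q ⟨qA, qB⟩
      have e : ‖q.1‖ = (1 + (q.2 : ℝ)) / 2 := le_antisymm qB.2 qA.2
      have h0 := q.2.2.1
      have e2 : (a q).2 = 1 := by
        apply Subtype.ext
        have : ‖q.1‖⁻¹ * (1 + (q.2 : ℝ)) - 1 = 1 := by rw [e]; field_simp; norm_num
        simp only [a, this]; simp
      have e1 : (a q).1 = b q := by
        simp only [a, b, e]; congr 1; field_simp
      simp only [Function.comp]
      rw [← e1, ← h1 _ (aA q qA), ← e2])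
  refine ⟨k, kc.mono ?_, ?_, ?_, ?_⟩
  · rintro q ⟨hq, -⟩
    rcases le_total (‖q.1‖) ((1 + (q.2 : ℝ)) / 2) with h' | h'
    exacts [Or.inr ⟨hq, h'⟩, Or.inl ⟨hq, h'⟩]
  · intro z hz
    rw [kB (show (z, (1 : I)) ∈ B from ⟨hz, by simpa using hz.1⟩)]
    simp only [Function.comp, b]
    norm_num
  · intro z hz s
    have hs := s.2.2
    rw [kA (show (z, s) ∈ A from ⟨hemisphere_subset hz, by rw [hz.1]; linarith⟩)]
    simp [a, hz.1]
  · intro z hz s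
    rcases le_total (‖z‖) ((1 + (s : ℝ)) / 2) with h' | h'
    · exact Or.inr ⟨b (z, s), bB _ ⟨hz, h'⟩, fun h0 => by simp [b, h0], kB ⟨hz, h'⟩⟩
    · exact Or.inl ⟨(a (z, s)).1, aA _ ⟨hz, h'⟩, fun h0 => by simp [a, h0], (a (z, s)).2,
        kA ⟨hz, h'⟩⟩

/-- Homotopy extension turns a lift up to homotopy on the hemisphere into a strict one, to which the
lifting property applies. The last two inclusions are needed only off the hemisphere, where the new
homotopy is not prescribed. -/
theorem PairLifting.liftExt {f : C(X, Y)} {W B : Set Y} (H : PairLifting ι f W B)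
    {C : (ι → ℝ) × ℝ → Set Y} (hW : ∀ z ∈ halfBall ι, C z ⊆ W)
    (hB : ∀ z ∈ halfBall ι, z.2 = 0 → C z ⊆ B)
    (hW' : ∀ z ∈ halfBall ι, z ∉ hemisphere ι → z.2 ≠ 0 → W ⊆ C z)
    (hB' : ∀ z ∈ halfBall ι, z ∉ hemisphere ι → z.2 = 0 → B ⊆ C z) :
    LiftExt f C (hemisphere ι) (halfBall ι) := by
  intro x y h xc yc hc h0 h1 hC yC
  obtain ⟨k, kc, k1, kh, kC⟩ := exists_homotopy_extension yc hc h1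
  have kW : ∀ z ∈ halfBall ι, ∀ s, k (z, s) ∈ W := fun z hz s => by
    rcases kC z hz s with ⟨u, hu, -, r, e⟩ | ⟨u, hu, -, e⟩
    · rw [e]; exact hW u (hemisphere_subset hu) (hC u hu r)
    · rw [e]; exact hW u hu (yC u hu)
  have kB : ∀ z ∈ halfBall ι, z.2 = 0 → ∀ s, k (z, s) ∈ B := fun z hz z0 s => by
    rcases kC z hz s with ⟨u, hu, u0, r, e⟩ | ⟨u, hu, u0, e⟩
    · rw [e]; exact hB u (hemisphere_subset hu) (u0 z0) (hC u hu r)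
    · rw [e]; exact hB u hu (u0 z0) (yC u hu)
  obtain ⟨x', g, a1, a2, a3, a4, a5, a6, a7, a8⟩ := H x (fun z => k (z, 0)) xc
    (kc.comp (by fun_prop) fun z hz => ⟨hz, mem_univ _⟩)
    (fun z hz => by rw [kh z hz, h0 z hz]) (fun z hz => kW z hz 0) (fun z hz z0 => kB z hz z0 0)
  -- First the homotopy of the strict problem, then the extension `k`. On the hemisphere the former
  -- is constant, so there the result is `h` run in the second half of the time.
  obtain ⟨m, mc, hm⟩ := exists_concat (isClosed_halfBall ι) a3 kc fun z hz => a5 z hz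
  have mh : ∀ z ∈ hemisphere ι, ∀ s, m (z, s) = h (z, stretchRight s) := by
    intro z hz s
    rcases le_total (s : ℝ) (1 / 2) with hs | hs
    · rw [(hm z (hemisphere_subset hz) s).1 hs, a8 z hz, stretchRight_of_le_half hs, kh z hz]
    · rw [(hm z (hemisphere_subset hz) s).2 hs, kh z hz]
  refine ⟨x', m, stretchRight, a1, a2, mc, fun z hz => ?_, fun z hz => ?_, fun z hz s => ?_,
    stretchRight_of_le_half (by simp), stretchRight_one, mh⟩
  · rw [(hm z hz 0).1 (by simp), stretchLeft_zero, a4 z hz]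
  · rw [(hm z hz 1).2 (by norm_num), stretchRight_one, k1 z hz]
  · by_cases hz' : z ∈ hemisphere ι
    · rw [mh z hz']; exact hC z hz' _
    · have key : m (z, s) ∈ W ∧ (z.2 = 0 → m (z, s) ∈ B) := by
        rcases le_total (s : ℝ) (1 / 2) with hs | hs
        · rw [(hm z hz s).1 hs]; exact ⟨a6 z hz _, fun z0 => a7 z hz z0 _⟩
        · rw [(hm z hz s).2 hs]; exact ⟨kW z hz _, fun z0 => kB z hz z0 _⟩
      by_cases z0 : z.2 = 0
      · exact hB' z hz hz' z0 (key.2 z0)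
      · exact hW' z hz hz' z0 key.1

end HalfBall

/-! ### Cubical cells of `ℝ^κ` and lifting over finite complexes. -/

section Lattice

variable {κ : Type*}

/-- The cell of the integral cubical subdivision of `ℝ^κ` with lower corner `e.1` which extends in
the directions `e.2`. -/
def latticeCell (e : (κ → ℤ) × Finset κ) : Set (κ → ℝ) :=
  {p | ∀ i, (e.1 i : ℝ) ≤ p i ∧ (i ∈ e.2 → p i ≤ e.1 i + 1) ∧ (i ∉ e.2 → p i ≤ e.1 i)}

variable [Fintype κ]

open Classical in
/-- The smallest cell of the integral cubical subdivision which contains a point. -/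
def carrierCell (p : κ → ℝ) : (κ → ℤ) × Finset κ :=
  (fun i => ⌊p i⌋, Finset.univ.filter fun i => (⌊p i⌋ : ℝ) ≠ p i)

theorem mem_carrierCell_snd {p : κ → ℝ} {i : κ} :
    i ∈ (carrierCell p).2 ↔ (⌊p i⌋ : ℝ) ≠ p i := by
  simp [carrierCell]

theorem mem_latticeCell_carrierCell (p : κ → ℝ) : p ∈ latticeCell (carrierCell p) := fun i =>
  ⟨Int.floor_le _, fun _ => (Int.lt_floor_add_one _).le, fun h => by
    rw [mem_carrierCell_snd, not_not] at h; exact h.ge⟩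

theorem carrierCell_eq_iff {p : κ → ℝ} {e : (κ → ℤ) × Finset κ} :
    carrierCell p = e ↔ ∀ i, (i ∈ e.2 → (e.1 i : ℝ) < p i ∧ p i < e.1 i + 1) ∧
      (i ∉ e.2 → p i = e.1 i) := by
  constructor
  · rintro rfl i
    rw [mem_carrierCell_snd]
    exact ⟨fun h => ⟨lt_of_le_of_ne (Int.floor_le _) h, Int.lt_floor_add_one _⟩,
      fun h => (not_not.1 h).symm⟩
  · intro h
    have hf : ∀ i, ⌊p i⌋ = e.1 i := fun i => by
      rw [Int.floor_eq_iff]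
      by_cases hi : i ∈ e.2
      · exact ⟨((h i).1 hi).1.le, ((h i).1 hi).2⟩
      · rw [(h i).2 hi]; simp
    refine Prod.ext (funext hf) (Finset.ext fun i => ?_)
    rw [mem_carrierCell_snd, hf]
    by_cases hi : i ∈ e.2
    · exact ⟨fun _ => hi, fun _ => ((h i).1 hi).1.ne⟩
    · exact ⟨fun h' => absurd ((h i).2 hi).symm h', fun h' => absurd h' hi⟩

theorem carrierCell_of_mem {p : κ → ℝ} {τ : (κ → ℤ) × Finset κ} (hp : p ∈ latticeCell τ) {i : κ}
    (hi : i ∈ (carrierCell p).2) : i ∈ τ.2 ∧ τ.1 i = (carrierCell p).1 i := by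
  rw [mem_carrierCell_snd] at hi
  obtain ⟨h1, h2, h3⟩ := hp i
  have hlt : (⌊p i⌋ : ℝ) < p i := lt_of_le_of_ne (Int.floor_le _) hi
  have hiτ : i ∈ τ.2 := by
    by_contra hn
    have : p i = τ.1 i := le_antisymm (h3 hn) h1
    exact hi (by rw [this]; simp)
  refine ⟨hiτ, ?_⟩
  have h2' := h2 hiτ
  refine le_antisymm (Int.le_floor.2 h1) ?_
  have : (⌊p i⌋ : ℝ) < τ.1 i + 1 := hlt.trans_le h2'
  exact Int.lt_add_one_iff.1 (by exact_mod_cast this)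

/-- A nonintegral coordinate forces `τ` to extend in that direction from the same lower corner, and
an integral coordinate is shared by all points of the carrier. So the carrier of a point is a face
of each cell through it. -/
theorem latticeCell_carrierCell_subset {p : κ → ℝ} {τ : (κ → ℤ) × Finset κ}
    (hp : p ∈ latticeCell τ) : latticeCell (carrierCell p) ⊆ latticeCell τ := by
  intro q hq i
  by_cases hi : i ∈ (carrierCell p).2
  · obtain ⟨h1, h2⟩ := carrierCell_of_mem hp hi
    obtain ⟨h3, h4, -⟩ := hq i
    rw [h2]
    exact ⟨h3, fun _ => h4 hi, fun h => absurd h1 h⟩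
  · have hqi : q i = p i := by
      obtain ⟨h3, -, h4⟩ := hq i
      rw [le_antisymm (h4 hi) h3]
      rw [mem_carrierCell_snd, not_not] at hi
      exact hi
    rw [hqi]; exact hp i

/-- A proper face has smaller dimension, so deleting a cell of maximal dimension from a complex
leaves a complex. -/
theorem carrierCell_eq_of_card_le {p : κ → ℝ} {τ : (κ → ℤ) × Finset κ}
    (hp : p ∈ latticeCell τ) (h : τ.2.card ≤ (carrierCell p).2.card) : carrierCell p = τ := by
  have hO : (carrierCell p).2 = τ.2 :=
    Finset.eq_of_subset_of_card_le (fun i hi => (carrierCell_of_mem hp hi).1) h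
  refine Prod.ext (funext fun i => ?_) hO
  by_cases hi : i ∈ (carrierCell p).2
  · exact (carrierCell_of_mem hp hi).2.symm
  · obtain ⟨h1, -, h2⟩ := hp i
    have hpi : p i = τ.1 i := le_antisymm (h2 (hO ▸ hi)) h1
    simp [carrierCell, hpi]

open Classical in
theorem isClosed_latticeCell (e : (κ → ℤ) × Finset κ) : IsClosed (latticeCell e) := by
  have : latticeCell e = ⋂ i, {p : κ → ℝ | (e.1 i : ℝ) ≤ p i} ∩
      {p | p i ≤ e.1 i + if i ∈ e.2 then 1 else 0} := by
    ext p
    simp only [latticeCell, mem_ofPred_eq, mem_iInter, mem_inter_iff]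
    refine forall_congr' fun i => and_congr_right fun _ => ?_
    by_cases hi : i ∈ e.2 <;> simp [hi]
  rw [this]
  exact isClosed_iInter fun i => (isClosed_le continuous_const (continuous_apply i)).inter
    (isClosed_le (continuous_apply i) continuous_const)

/-- The union of a finite set of cells. -/
def cellUnion (T : Finset ((κ → ℤ) × Finset κ)) : Set (κ → ℝ) := ⋃ e ∈ T, latticeCell e

theorem isClosed_cellUnion (T : Finset ((κ → ℤ) × Finset κ)) : IsClosed (cellUnion T) :=
  T.finite_toSet.isClosed_biUnion fun e _ => isClosed_latticeCell e

/-- A finite set of cells is a complex if it contains all faces of its cells. -/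
def IsCellComplex (T : Finset ((κ → ℤ) × Finset κ)) : Prop :=
  ∀ e ∈ T, ∀ p ∈ latticeCell e, carrierCell p ∈ T

theorem mem_cellUnion {T : Finset ((κ → ℤ) × Finset κ)} {p : κ → ℝ} :
    p ∈ cellUnion T ↔ ∃ e ∈ T, p ∈ latticeCell e := by
  simp [cellUnion]

theorem IsCellComplex.mem_cellUnion_iff {T : Finset ((κ → ℤ) × Finset κ)} (hT : IsCellComplex T)
    {p : κ → ℝ} : p ∈ cellUnion T ↔ carrierCell p ∈ T := by
  rw [mem_cellUnion]
  exact ⟨fun ⟨e, he, hp⟩ => hT e he p hp, fun h => ⟨_, h, mem_latticeCell_carrierCell p⟩⟩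

open Classical in
/-- The chart of the product of a cell with `[c, c + 1]`, which maps the flat part of the boundary
of the half ball to the end `c + 1`. -/
def cellChart (e : (κ → ℤ) × Finset κ) (c : ℝ) (z : (e.2 → ℝ) × ℝ) : (κ → ℝ) × ℝ :=
  (fun i => if h : i ∈ e.2 then e.1 i + (1 + z.1 ⟨i, h⟩) / 2 else e.1 i, c + 1 - z.2)

/-- The inverse of `cellChart`. -/
def cellChartInv (e : (κ → ℤ) × Finset κ) (c : ℝ) (q : (κ → ℝ) × ℝ) : (e.2 → ℝ) × ℝ :=
  (fun i => 2 * (q.1 i - e.1 i) - 1, c + 1 - q.2)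

theorem continuous_cellChart (e : (κ → ℤ) × Finset κ) (c : ℝ) : Continuous (cellChart e c) := by
  refine Continuous.prodMk (continuous_pi fun i => ?_) (by fun_prop)
  by_cases h : i ∈ e.2
  · simp only [h, dite_true]; fun_prop
  · simp only [h, dite_false]; fun_prop

theorem continuous_cellChartInv (e : (κ → ℤ) × Finset κ) (c : ℝ) :
    Continuous (cellChartInv e c) := by
  unfold cellChartInv; fun_prop

theorem cellChartInv_cellChart (e : (κ → ℤ) × Finset κ) (c : ℝ) (z : (e.2 → ℝ) × ℝ) :
    cellChartInv e c (cellChart e c z) = z := by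
  refine Prod.ext (funext fun i => ?_) ?_
  · simp only [cellChartInv, cellChart, i.2, dite_true]; ring
  · simp [cellChartInv, cellChart]

theorem cellChart_mem {e : (κ → ℤ) × Finset κ} {c : ℝ} {z : (e.2 → ℝ) × ℝ}
    (hz : z ∈ halfBall e.2) : cellChart e c z ∈ latticeCell e ×ˢ Icc c (c + 1) := by
  rw [mem_halfBall_iff] at hz
  refine ⟨fun i => ?_, ?_, ?_⟩
  · by_cases hi : i ∈ e.2
    · have := abs_le.1 ((norm_le_pi_norm z.1 ⟨i, hi⟩).trans hz.1)
      simp only [cellChart, hi, dite_true, not_true, false_implies, and_true, true_implies]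
      constructor <;> linarith [this.1, this.2]
    · simp [cellChart, hi]
  · simp only [cellChart]; linarith
  · simp only [cellChart]; linarith

theorem cellChart_image (e : (κ → ℤ) × Finset κ) (c : ℝ) :
    cellChart e c '' halfBall e.2 = latticeCell e ×ˢ Icc c (c + 1) := by
  refine Subset.antisymm (by rintro _ ⟨z, hz, rfl⟩; exact cellChart_mem hz) ?_
  rintro ⟨p, t⟩ ⟨hp, ht⟩
  refine ⟨cellChartInv e c (p, t), ?_, ?_⟩
  · rw [mem_halfBall_iff]
    simp only [cellChartInv, mem_Icc] at ht ⊢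
    refine ⟨(pi_norm_le_iff_of_nonneg zero_le_one).2 fun i => ?_, by linarith, by linarith⟩
    obtain ⟨h1, h2, -⟩ := hp i
    have := h2 i.2
    rw [Real.norm_eq_abs, abs_le]
    constructor <;> linarith
  · refine Prod.ext (funext fun i => ?_) ?_
    · by_cases hi : i ∈ e.2
      · simp [cellChart, cellChartInv, hi]
      · obtain ⟨h1, -, h3⟩ := hp i
        simp only [cellChart, hi, dite_false]
        exact le_antisymm h1 (h3 hi)
    · simp [cellChart, cellChartInv]

theorem carrierCell_cellChart {e : (κ → ℤ) × Finset κ} {c : ℝ} {z : (e.2 → ℝ) × ℝ}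
    (hz : z ∈ halfBall e.2) : carrierCell (cellChart e c z).1 = e ↔ ‖z.1‖ ≠ 1 := by
  have hz1 := (mem_halfBall_iff.1 hz).1
  rw [← hz1.lt_iff_ne, pi_norm_lt_iff zero_lt_one, carrierCell_eq_iff]
  constructor
  · intro h i
    have := (h i).1 i.2
    simp only [cellChart, i.2, dite_true] at this
    rw [Real.norm_eq_abs, abs_lt]
    constructor <;> linarith [this.1, this.2]
  · intro h i
    by_cases hi : i ∈ e.2
    · have := h ⟨i, hi⟩
      rw [Real.norm_eq_abs, abs_lt] at this
      simp only [cellChart, hi, dite_true, not_true, false_implies, and_true, true_implies]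
      constructor <;> linarith [this.1, this.2]
    · simp [cellChart, hi]

variable {X Y : Type*} [TopologicalSpace X] [TopologicalSpace Y]

open Classical in
/-- Lifting over `|T| × [c, c + 1]` relative to `|T| × {c} ∪ |T₀| × [c, c + 1]`. -/
theorem liftExt_cellUnion {f : C(X, Y)} {C : (κ → ℝ) × ℝ → Set Y}
    {T₀ T : Finset ((κ → ℤ) × Finset κ)} (hsub : T₀ ⊆ T) (hT₀ : IsCellComplex T₀)
    (hT : IsCellComplex T) (c : ℝ)
    (H : ∀ e ∈ T, e ∉ T₀ →
      LiftExt f (fun z => C (cellChart e c z)) (hemisphere e.2) (halfBall e.2)) :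
    LiftExt f C (cellUnion T ×ˢ {c} ∪ cellUnion T₀ ×ˢ Icc c (c + 1))
      (cellUnion T ×ˢ Icc c (c + 1)) := by
  set L := cellUnion T ×ˢ {c} ∪ cellUnion T₀ ×ˢ Icc c (c + 1) with hL
  have Lc : IsClosed L := ((isClosed_cellUnion T).prod isClosed_singleton).union
    ((isClosed_cellUnion T₀).prod isClosed_Icc)
  have mono : ∀ {T₁ T₂ : Finset ((κ → ℤ) × Finset κ)}, T₁ ⊆ T₂ →
      cellUnion T₁ ⊆ cellUnion T₂ := fun h => biUnion_subset_biUnion_left h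
  have LK : L ⊆ cellUnion T ×ˢ Icc c (c + 1) :=
    union_subset (prod_mono_right (by simp)) (prod_mono_left (mono hsub))
  suffices key : ∀ n : ℕ, ∀ T' : Finset ((κ → ℤ) × Finset κ), T'.card = n → T₀ ⊆ T' → T' ⊆ T →
      IsCellComplex T' → LiftExt f C L (L ∪ cellUnion T' ×ˢ Icc c (c + 1)) by
    have := key _ T rfl hsub subset_rfl hT
    rwa [union_eq_self_of_subset_left LK] at this
  intro n
  induction n with
  | zero =>
    intro T' hn _ _ _
    rw [Finset.card_eq_zero.1 hn]
    simpa [cellUnion] using LiftExt.refl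
  | succ n ih =>
    intro T' hn h0 hT'T hT'
    by_cases hne : (T' \ T₀).Nonempty
    · obtain ⟨e, he, hmax⟩ := Finset.exists_max_image (T' \ T₀) (fun τ => τ.2.card) hne
      rw [Finset.mem_sdiff] at he
      have hT'' : IsCellComplex (T'.erase e) := by
        intro τ hτ p hp
        rw [Finset.mem_erase] at hτ
        refine Finset.mem_erase.2 ⟨fun hc => ?_, hT' τ hτ.2 p hp⟩
        have hτ0 : τ ∉ T₀ := fun h => he.2 (hc ▸ hT₀ τ h p hp)
        have := hmax τ (Finset.mem_sdiff.2 ⟨hτ.2, hτ0⟩)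
        exact hτ.1 ((carrierCell_eq_of_card_le hp (by rw [hc]; exact this)).symm.trans hc)
      have h0' : T₀ ⊆ T'.erase e := Finset.subset_erase.2 ⟨h0, he.2⟩
      have step := ih (T'.erase e) (by rw [Finset.card_erase_of_mem he.1, hn]; rfl) h0'
        ((Finset.erase_subset _ _).trans hT'T) hT''
      set L' := L ∪ cellUnion (T'.erase e) ×ˢ Icc c (c + 1) with hL'
      -- Over `e × [c, c + 1]` the bottom and the sides are already lifted. They form the image of
      -- the hemisphere; only the interior and the top are new.
      have att := LiftExt.of_chart (f := f) (C := C) (L := L') (L₀ := hemisphere e.2)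
        (K₀ := halfBall e.2) (cellChart e c) (cellChartInv e c)
        (continuous_cellChart e c).continuousOn (continuous_cellChartInv e c).continuousOn
        (fun z _ => cellChartInv_cellChart e c z)
        (Lc.union ((isClosed_cellUnion _).prod isClosed_Icc))
        (by rw [cellChart_image]; exact (isClosed_latticeCell e).prod isClosed_Icc)
        (fun z hz => by
          have hc := cellChart_mem (c := c) hz
          have hcar := carrierCell_cellChart (c := c) hz
          rw [mem_hemisphere_iff hz]
          have he2 : (cellChart e c z).2 = c + 1 - z.2 := rfl
          constructor
          · rintro ((h | h) | h)
            · right; have := h.2; rw [mem_singleton_iff] at this; linarith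
            · left
              by_contra hn
              have := (hT₀.mem_cellUnion_iff).1 h.1
              rw [hcar.2 hn] at this
              exact he.2 this
            · left
              by_contra hn
              have := (hT''.mem_cellUnion_iff).1 h.1
              rw [hcar.2 hn] at this
              exact (Finset.mem_erase.1 this).1 rfl
          · rintro (h | h)
            · right
              refine ⟨hT''.mem_cellUnion_iff.2 (Finset.mem_erase.2 ⟨fun h' => ?_, ?_⟩), hc.2⟩
              · exact hcar.1 h' h
              · exact hT' e he.1 _ hc.1
            · left; left
              exact ⟨mem_cellUnion.2 ⟨e, hT'T he.1, hc.1⟩, by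
                rw [mem_singleton_iff, he2, h]; ring⟩)
        hemisphere_subset (H e (hT'T he.1) he.2)
      have hu : L ∪ cellUnion T' ×ˢ Icc c (c + 1) = L' ∪ cellChart e c '' halfBall e.2 := by
        rw [cellChart_image, hL', union_assoc L, ← union_prod]
        suffices cellUnion T' = cellUnion (T'.erase e) ∪ latticeCell e by rw [this]
        ext p
        simp only [mem_cellUnion, mem_union, Finset.mem_erase]
        constructor
        · rintro ⟨τ, hτ, hp⟩
          by_cases h : τ = e
          · right; rwa [← h]
          · left; exact ⟨τ, ⟨h, hτ⟩, hp⟩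
        · rintro (⟨τ, hτ, hp⟩ | hp)
          exacts [⟨τ, hτ.2, hp⟩, ⟨e, he.1, hp⟩]
      rw [hu]
      exact step.trans subset_union_left subset_union_left att
    · have : T' = T₀ :=
        Finset.Subset.antisymm (Finset.sdiff_eq_empty_iff_subset.1 (Finset.not_nonempty_iff_eq_empty.1 hne)) h0
      rw [this, union_eq_self_of_subset_right subset_union_right]
      exact LiftExt.refl

end Lattice

/-! ### The cube `[0, N]^κ` and its boundary as complexes. -/

section CubeComplex

variable {κ : Type*} [Fintype κ]

open Classical in
/-- The cells of the cube `[0, N]^κ`. -/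
def cubeCells (κ : Type*) [Fintype κ] (N : ℕ) : Finset ((κ → ℤ) × Finset κ) :=
  ((Fintype.piFinset fun _ : κ => Finset.Icc (0 : ℤ) N) ×ˢ Finset.univ).filter
    fun e => ∀ i ∈ e.2, e.1 i < N

open Classical in
/-- The cells of the boundary of the cube `[0, N]^κ`. -/
def cubeBoundaryCells (κ : Type*) [Fintype κ] (N : ℕ) : Finset ((κ → ℤ) × Finset κ) :=
  (cubeCells κ N).filter fun e => ∃ i, i ∉ e.2 ∧ (e.1 i = 0 ∨ e.1 i = N)

theorem mem_cubeCells {N : ℕ} {e : (κ → ℤ) × Finset κ} :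
    e ∈ cubeCells κ N ↔ ∀ i, (0 ≤ e.1 i ∧ e.1 i ≤ N) ∧ (i ∈ e.2 → e.1 i < N) := by
  simp only [cubeCells, Finset.mem_filter, Finset.mem_product, Fintype.mem_piFinset,
    Finset.mem_Icc, Finset.mem_univ, and_true, forall_and]

open Classical in
theorem mem_cubeBoundaryCells {N : ℕ} {e : (κ → ℤ) × Finset κ} :
    e ∈ cubeBoundaryCells κ N ↔
      e ∈ cubeCells κ N ∧ ∃ i, i ∉ e.2 ∧ (e.1 i = 0 ∨ e.1 i = N) := by
  simp only [cubeBoundaryCells, Finset.mem_filter]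

open Classical in
theorem cubeBoundaryCells_subset (N : ℕ) : cubeBoundaryCells κ N ⊆ cubeCells κ N :=
  Finset.filter_subset _ _

theorem bounds_of_mem_cubeCells {N : ℕ} {e : (κ → ℤ) × Finset κ} (he : e ∈ cubeCells κ N)
    {p : κ → ℝ} (hp : p ∈ latticeCell e) (i : κ) : 0 ≤ p i ∧ p i ≤ N := by
  obtain ⟨⟨h1, h2⟩, h3⟩ := mem_cubeCells.1 he i
  obtain ⟨k1, k2, k3⟩ := hp i
  have h1' : (0 : ℝ) ≤ e.1 i := by exact_mod_cast h1
  refine ⟨h1'.trans k1, ?_⟩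
  by_cases hi : i ∈ e.2
  · have : (e.1 i : ℝ) + 1 ≤ N := by exact_mod_cast h3 hi
    exact (k2 hi).trans this
  · have : (e.1 i : ℝ) ≤ N := by exact_mod_cast h2
    exact (k3 hi).trans this

theorem carrierCell_mem_cubeCells {N : ℕ} {p : κ → ℝ} :
    carrierCell p ∈ cubeCells κ N ↔ ∀ i, 0 ≤ p i ∧ p i ≤ N := by
  constructor
  · intro h
    exact bounds_of_mem_cubeCells h (mem_latticeCell_carrierCell p)
  · intro h
    refine mem_cubeCells.2 fun i => ⟨⟨Int.floor_nonneg.2 (h i).1, ?_⟩, fun hi => ?_⟩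
    · have : ((⌊p i⌋ : ℤ) : ℝ) ≤ (N : ℤ) := (Int.floor_le _).trans (by exact_mod_cast (h i).2)
      exact_mod_cast this
    · rw [mem_carrierCell_snd] at hi
      have : ((⌊p i⌋ : ℤ) : ℝ) < (N : ℤ) :=
        (lt_of_le_of_ne (Int.floor_le _) hi).trans_le (by exact_mod_cast (h i).2)
      exact_mod_cast this

theorem carrierCell_mem_cubeBoundaryCells {N : ℕ} {p : κ → ℝ} :
    carrierCell p ∈ cubeBoundaryCells κ N ↔
      (∀ i, 0 ≤ p i ∧ p i ≤ N) ∧ ∃ i, p i = 0 ∨ p i = N := by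
  rw [mem_cubeBoundaryCells, carrierCell_mem_cubeCells]
  refine and_congr_right fun h => exists_congr fun i => ?_
  rw [mem_carrierCell_snd, not_not]
  simp only [carrierCell]
  constructor
  · rintro ⟨h1, h2⟩
    rw [← h1]; exact_mod_cast h2
  · rintro (h | h) <;> simp [h]

theorem isCellComplex_cubeCells (N : ℕ) : IsCellComplex (cubeCells κ N) := fun _ he _ hp =>
  carrierCell_mem_cubeCells.2 (bounds_of_mem_cubeCells he hp)

theorem isCellComplex_cubeBoundaryCells (N : ℕ) : IsCellComplex (cubeBoundaryCells κ N) := by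
  intro e he p hp
  obtain ⟨h1, i, hi, h2⟩ := mem_cubeBoundaryCells.1 he
  refine carrierCell_mem_cubeBoundaryCells.2 ⟨bounds_of_mem_cubeCells h1 hp, i, ?_⟩
  obtain ⟨k1, -, k3⟩ := hp i
  rw [le_antisymm (k3 hi) k1]
  exact_mod_cast h2

theorem mem_cellUnion_cubeCells {N : ℕ} {p : κ → ℝ} :
    p ∈ cellUnion (cubeCells κ N) ↔ ∀ i, 0 ≤ p i ∧ p i ≤ N := by
  rw [(isCellComplex_cubeCells N).mem_cellUnion_iff, carrierCell_mem_cubeCells]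

theorem mem_cellUnion_cubeBoundaryCells {N : ℕ} {p : κ → ℝ} :
    p ∈ cellUnion (cubeBoundaryCells κ N) ↔
      (∀ i, 0 ≤ p i ∧ p i ≤ N) ∧ ∃ i, p i = 0 ∨ p i = N := by
  rw [(isCellComplex_cubeBoundaryCells N).mem_cellUnion_iff, carrierCell_mem_cubeBoundaryCells]

theorem norm_eq_one_iff {v : κ → ℝ} (hv : ‖v‖ ≤ 1) : ‖v‖ = 1 ↔ ∃ i, |v i| = 1 := by
  rw [← not_iff_not, ← ne_eq, ← hv.lt_iff_ne, pi_norm_lt_iff zero_lt_one, not_exists]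
  exact forall_congr' fun i => ((norm_le_pi_norm v i).trans hv).lt_iff_ne

end CubeComplex

/-! ### Enlarging the half ball to a ball. -/

section Ball

variable {X Y : Type*} [TopologicalSpace X] [TopologicalSpace Y] {ι : Type*} [Fintype ι]

theorem norm_prod_le_one_iff {z : (ι → ℝ) × ℝ} :
    ‖z‖ ≤ 1 ↔ ‖z.1‖ ≤ 1 ∧ -1 ≤ z.2 ∧ z.2 ≤ 1 := by
  rw [Prod.norm_def, max_le_iff, Real.norm_eq_abs, abs_le]

/-- The parametrization of the upper hemisphere by the unit ball of `ℝ^ι`. -/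
def domeMap (p : ι → ℝ) : (ι → ℝ) × ℝ := ((max (1 / 2) ‖p‖)⁻¹ • p, min 1 (2 - 2 * ‖p‖))

theorem continuous_domeMap : Continuous (domeMap (ι := ι)) := by
  have h : Continuous fun p : ι → ℝ => (max (1 / 2) ‖p‖)⁻¹ :=
    Continuous.inv₀ (by fun_prop) fun p => (lt_max_of_lt_left (by norm_num)).ne'
  exact (h.smul continuous_id).prodMk (by fun_prop)

theorem norm_domeMap_fst_le (p : ι → ℝ) : ‖(domeMap p).1‖ ≤ 1 := by
  have h : 0 < max (1 / 2) ‖p‖ := lt_max_of_lt_left (by norm_num)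
  simp only [domeMap, norm_smul, norm_inv, Real.norm_eq_abs, abs_of_pos h]
  rw [inv_mul_le_iff₀ h, mul_one]
  exact le_max_right _ _

theorem domeMap_of_norm_eq_one {p : ι → ℝ} (hp : ‖p‖ = 1) : domeMap p = (p, 0) := by
  simp only [domeMap, hp]; norm_num

theorem domeMap_snd_mem {p : ι → ℝ} (hp : ‖p‖ ≤ 1) :
    0 ≤ (domeMap p).2 ∧ (domeMap p).2 ≤ 1 :=
  ⟨le_min zero_le_one (by linarith), min_le_left _ _⟩

theorem domeMap_cases (p : ι → ℝ) : ‖(domeMap p).1‖ = 1 ∨ (domeMap p).2 = 1 := by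
  rcases le_total ‖p‖ (1 / 2) with h | h
  · right; exact min_eq_left (by linarith)
  · left
    have h0 : 0 < ‖p‖ := by linarith
    simp only [domeMap, max_eq_right h, norm_smul, norm_inv, norm_norm]
    exact inv_mul_cancel₀ h0.ne'

theorem domeMap_mem_hemisphere {p : ι → ℝ} (hp : ‖p‖ ≤ 1) : domeMap p ∈ hemisphere ι := by
  have h := domeMap_snd_mem hp
  exact (mem_hemisphere_iff (mem_halfBall_iff.2 ⟨norm_domeMap_fst_le p, h⟩)).2 (domeMap_cases p)

/-- A lifting problem over the half ball can be solved if it can be solved after enlarging the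
half ball to a ball, along whose lower half the problem takes place in the free part. -/
theorem PairLifting.of_ball {f : C(X, Y)} {W B : Set Y}
    (H : ∀ y : (ι → ℝ) × ℝ → Y, ContinuousOn y (halfBall ι) → (∀ z ∈ halfBall ι, y z ∈ W) →
      (∀ z ∈ halfBall ι, z.2 = 0 → y z ∈ B) →
      ∃ (y' : (ι → ℝ) × ℝ → Y) (C : (ι → ℝ) × ℝ → Set Y),
        ContinuousOn y' {z | ‖z‖ ≤ 1} ∧ EqOn y' y (halfBall ι) ∧
        (∀ z, ‖z‖ ≤ 1 → y' z ∈ C z) ∧ (∀ z, ‖z‖ ≤ 1 → z.2 ≤ 0 → y' z ∈ B) ∧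
        (∀ z, ‖z‖ ≤ 1 → C z ⊆ W) ∧
        (∀ z, ‖z‖ ≤ 1 → z.2 ≤ 0 → (‖z.1‖ = 1 ∨ z.2 = -1) → C z ⊆ B) ∧
        LiftExt f C (hemisphere ι) {z | ‖z‖ ≤ 1}) :
    PairLifting ι f W B := by
  intro x y xc yc hxy yW yB
  obtain ⟨y', C, yc', hyy, yC, yB', CW, CB, hL⟩ := H y yc yW yB
  obtain ⟨x₁, h₁, d, a1, a2, a3, a4, a5, a6, a7, a8, a9⟩ := hL x y' (fun q => y q.1) xc yc'
    ((yc.mono hemisphere_subset).comp continuousOn_fst fun q hq => hq.1)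
    (fun z hz => (hxy z hz).symm) (fun z hz => (hyy (hemisphere_subset hz)).symm)
    (fun z hz s => by
      have := yC z hz.1.le
      rwa [hyy (hemisphere_subset hz)] at this) (fun z hz => yC z hz)
  -- `Ψ` stretches the half ball over the ball: it interpolates linearly between the identity on the
  -- top `z.2 = 1` and the reflected dome on `z.2 = 0`. It fixes the hemisphere and sends the flat
  -- part to the lower half of the sphere, where the constraint `C` lies in `B`.
  let Ψ : (ι → ℝ) × ℝ → (ι → ℝ) × ℝ := fun z =>
    (z.2 • z.1 + (1 - z.2) • (domeMap z.1).1, z.2 - (1 - z.2) * (domeMap z.1).2)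
  have Ψc : Continuous Ψ := by
    have h1 : Continuous fun z : (ι → ℝ) × ℝ => domeMap z.1 := continuous_domeMap.comp continuous_fst
    exact ((continuous_snd.smul continuous_fst).add
      ((continuous_const.sub continuous_snd).smul h1.fst)).prodMk
      (continuous_snd.sub ((continuous_const.sub continuous_snd).mul h1.snd))
  have Ψball : ∀ z ∈ halfBall ι, ‖Ψ z‖ ≤ 1 := by
    intro z hz
    obtain ⟨h1, h2, h3⟩ := mem_halfBall_iff.1 hz
    obtain ⟨h4, h5⟩ := domeMap_snd_mem h1
    refine norm_prod_le_one_iff.2 ⟨?_, ?_, ?_⟩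
    · refine (norm_add_le _ _).trans ?_
      rw [norm_smul, norm_smul, Real.norm_eq_abs, Real.norm_eq_abs, abs_of_nonneg h2,
        abs_of_nonneg (sub_nonneg.2 h3)]
      have := norm_domeMap_fst_le z.1
      nlinarith
    · simp only [Ψ]; nlinarith
    · simp only [Ψ]; nlinarith
  have ΨJ : ∀ z ∈ hemisphere ι, Ψ z = z := by
    intro z hz
    rcases (mem_hemisphere_iff (hemisphere_subset hz)).1 hz with h | h
    · simp only [Ψ, domeMap_of_norm_eq_one h]
      refine Prod.ext ?_ (by simp)
      simp only [← add_smul]; simp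
    · simp [Ψ, h]
      exact Prod.ext rfl h.symm
  have Ψflat : ∀ z ∈ halfBall ι, z.2 = 0 → (Ψ z).2 ≤ 0 ∧ (‖(Ψ z).1‖ = 1 ∨ (Ψ z).2 = -1) := by
    intro z hz h0
    have h1 := (mem_halfBall_iff.1 hz).1
    simp only [Ψ, h0, zero_smul, zero_add, sub_zero, one_smul, one_mul, zero_sub, neg_inj]
    exact ⟨by linarith [(domeMap_snd_mem h1).1], domeMap_cases z.1⟩
  have hst : ∀ z ∈ halfBall ι, ∀ s : I,
      ‖(1 - (s : ℝ)) • Ψ z + (s : ℝ) • z‖ ≤ 1 := by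
    intro z hz s
    have h1 := s.2.1
    have h2 := s.2.2
    refine (norm_add_le _ _).trans ?_
    rw [norm_smul, norm_smul, Real.norm_eq_abs, Real.norm_eq_abs, abs_of_nonneg h1,
      abs_of_nonneg (sub_nonneg.2 h2)]
    have := Ψball z hz
    have := hz.1
    nlinarith
  -- The solution on the ball is pulled back by `Ψ`, and the straight line from `Ψ z` to `z` then
  -- leads back to `y`. For `z.2 = 0` this line stays in the lower half ball, which `y'` sends to
  -- `B`.
  obtain ⟨m, mc, hm⟩ := exists_concat (isClosed_halfBall ι)
    (h₁ := fun q : ((ι → ℝ) × ℝ) × I => h₁ (Ψ q.1, q.2))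
    (h₂ := fun q => y' ((1 - (q.2 : ℝ)) • Ψ q.1 + (q.2 : ℝ) • q.1))
    (a3.comp (by fun_prop) fun q hq => ⟨Ψball _ hq.1, mem_univ _⟩)
    (yc'.comp (by fun_prop) fun q hq => hst q.1 hq.1 q.2)
    (fun z hz => by simpa using a5 _ (Ψball z hz))
  have mP : ∀ (z : (ι → ℝ) × ℝ) (D : Set Y), z ∈ halfBall ι → (∀ s, h₁ (Ψ z, s) ∈ D) →
      (∀ s : I, y' ((1 - (s : ℝ)) • Ψ z + (s : ℝ) • z) ∈ D) → ∀ s, m (z, s) ∈ D := by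
    intro z D hz k1 k2 s
    rcases le_total (s : ℝ) (1 / 2) with hs | hs
    · rw [(hm z hz s).1 hs]; exact k1 _
    · rw [(hm z hz s).2 hs]; exact k2 _
  refine ⟨x₁ ∘ Ψ, m, a1.comp Ψc.continuousOn Ψball, fun z hz => ?_, mc, fun z hz => ?_,
    fun z hz => ?_, fun z hz => ?_, fun z hz z0 => ?_, fun z hz => ?_⟩
  · simp only [Function.comp, ΨJ z hz, a2 hz]
  · rw [(hm z hz 0).1 (by simp), stretchLeft_zero, a4 _ (Ψball z hz)]; rfl
  · rw [(hm z hz 1).2 (by norm_num), stretchRight_one]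
    simpa using hyy hz
  · exact mP z W hz (fun s => CW _ (Ψball z hz) (a6 _ (Ψball z hz) s))
      fun s => CW _ (hst z hz s) (yC _ (hst z hz s))
  · obtain ⟨k1, k2⟩ := Ψflat z hz z0
    refine mP z B hz (fun s => CB _ (Ψball z hz) k1 k2 (a6 _ (Ψball z hz) s))
      fun s => yB' _ (hst z hz s) ?_
    simp only [Prod.snd_add, Prod.smul_snd, z0, smul_eq_mul]
    have := s.2.2
    nlinarith
  · have := mP z {y z} (hemisphere_subset hz) (fun s => by
      rw [ΨJ z hz, a9 z hz]; rfl) (fun s => by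
      rw [ΨJ z hz, ← add_smul]
      simpa using hyy (hemisphere_subset hz))
    exact this

end Ball

/-! ### From points to pairs: lifting for `(W, V)`. -/

section Excision

variable {X Y : Type*} [TopologicalSpace X] [TopologicalSpace Y] {ι : Type} [Fintype ι]
  {f : C(X, Y)}

theorem isClosed_unitBall : IsClosed {z : (ι → ℝ) × ℝ | ‖z‖ ≤ 1} :=
  isClosed_le continuous_norm continuous_const

/-- The lower half of the cylinder over the unit sphere of `ℝ^ι`. -/
def lowerSides (ι : Type*) [Fintype ι] : Set ((ι → ℝ) × ℝ) := {z | ‖z.1‖ = 1 ∧ -1 ≤ z.2 ∧ z.2 ≤ 0}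

theorem isClosed_lowerSides : IsClosed (lowerSides ι) :=
  (isClosed_eq (by fun_prop) continuous_const).inter
    ((isClosed_le continuous_const continuous_snd).inter
      (isClosed_le continuous_snd continuous_const))

theorem mem_hemisphere_of_sides {z : (ι → ℝ) × ℝ} (h1 : ‖z.1‖ = 1) (h2 : 0 ≤ z.2) (h3 : z.2 ≤ 1) :
    z ∈ hemisphere ι :=
  (mem_hemisphere_iff (mem_halfBall_iff.2 ⟨h1.le, h2, h3⟩)).2 (Or.inl h1)

theorem lowerSides_subset : lowerSides ι ⊆ {z : (ι → ℝ) × ℝ | ‖z‖ ≤ 1} := fun _ hz =>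
  norm_prod_le_one_iff.2 ⟨hz.1.le, hz.2.1, hz.2.2.trans zero_le_one⟩

/-- Lifts of the sides are found cell by cell. -/
theorem liftExt_lowerSides {V B : Set Y} (hBV : B ⊆ V)
    (H : ∀ (κ : Type) [Fintype κ], PairLifting κ f V B) {C : (ι → ℝ) × ℝ → Set Y}
    (hC : ∀ z ∈ lowerSides ι, C z = {v | v ∈ V ∧ (z.2 = -1 → v ∈ B)}) :
    LiftExt f C (hemisphere ι) (hemisphere ι ∪ lowerSides ι) := by
  classical
  -- Translation by `1` turns the sphere of radius one into the boundary of `[0, 2]^ι`, which is a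
  -- union of integral cells. The sign makes the end `1` of the slab correspond to height `-1`.
  let φ : (ι → ℝ) × ℝ → (ι → ℝ) × ℝ := fun q => (fun i => q.1 i - 1, -q.2)
  let ψ : (ι → ℝ) × ℝ → (ι → ℝ) × ℝ := fun q => (fun i => q.1 i + 1, -q.2)
  have φc : Continuous φ := by fun_prop
  have ψc : Continuous ψ := by fun_prop
  have φψ : ∀ q, φ (ψ q) = q := fun q => by simp [φ, ψ]
  have ψφ : ∀ q, ψ (φ q) = q := fun q => by simp [φ, ψ]
  have hφ : ∀ q ∈ cellUnion (cubeBoundaryCells ι 2) ×ˢ Icc (0 : ℝ) 1, φ q ∈ lowerSides ι := by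
    rintro ⟨p, t⟩ ⟨hp, ht⟩
    obtain ⟨h1, i, h2⟩ := mem_cellUnion_cubeBoundaryCells.1 hp
    have hle : ‖(φ (p, t)).1‖ ≤ 1 := (pi_norm_le_iff_of_nonneg zero_le_one).2 fun j => by
      have := h1 j
      simp only [φ, Real.norm_eq_abs, abs_le]
      norm_num at this ⊢
      constructor <;> linarith
    refine ⟨(norm_eq_one_iff hle).2 ⟨i, ?_⟩, ?_, ?_⟩
    · simp only [φ]
      rcases h2 with h2 | h2 <;> dsimp only at h2 <;> rw [h2] <;> norm_num
    · simp only [φ]; linarith [ht.2]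
    · simp only [φ]; linarith [ht.1]
  have himg : φ '' (cellUnion (cubeBoundaryCells ι 2) ×ˢ Icc (0 : ℝ) 1) = lowerSides ι := by
    refine Subset.antisymm (by rintro _ ⟨q, hq, rfl⟩; exact hφ q hq) ?_
    intro z hz
    refine ⟨ψ z, ⟨mem_cellUnion_cubeBoundaryCells.2 ⟨fun i => ?_, ?_⟩, ?_, ?_⟩, φψ z⟩
    · have := abs_le.1 ((norm_le_pi_norm z.1 i).trans hz.1.le)
      simp only [ψ]; norm_num
      constructor <;> linarith [this.1, this.2]
    · obtain ⟨i, hi⟩ := (norm_eq_one_iff hz.1.le).1 hz.1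
      refine ⟨i, ?_⟩
      simp only [ψ]
      rcases (abs_eq zero_le_one).1 hi with h | h <;> rw [h] <;> norm_num
    · simp only [ψ]; linarith [hz.2.2]
    · simp only [ψ]; linarith [hz.2.1]
  have key := liftExt_cellUnion (f := f) (C := fun q => C (φ q)) (T₀ := ∅)
    (T := cubeBoundaryCells ι 2) (Finset.empty_subset _) (fun e he => absurd he (by simp))
    (isCellComplex_cubeBoundaryCells 2) 0 (fun e he _ => by
      have hz : ∀ z ∈ halfBall e.2,
          C (φ (cellChart e 0 z)) = {v | v ∈ V ∧ (z.2 = 0 → v ∈ B)} := fun z hz => by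
        have hm := cellChart_mem (c := 0) hz
        rw [hC _ (hφ _ ⟨mem_cellUnion.2 ⟨e, he, hm.1⟩, by simpa using hm.2⟩)]
        have : (φ (cellChart e 0 z)).2 = -1 ↔ z.2 = 0 := by
          simp only [φ, cellChart]
          constructor <;> intro h <;> linarith
        rw [this]
      refine (H e.2).liftExt (fun z hzh v hv => ?_) (fun z hzh h0 v hv => ?_)
        (fun z hzh _ h0 v hv => ?_) (fun z hzh _ h0 v hv => ?_)
      · simp only [hz z hzh] at hv; exact hv.1
      · simp only [hz z hzh] at hv; exact hv.2 h0
      · simp only [hz z hzh]; exact ⟨hv, fun h => absurd h h0⟩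
      · simp only [hz z hzh]; exact ⟨hBV hv, fun _ => hv⟩)
  rw [zero_add] at key
  have := LiftExt.of_chart (f := f) (C := C) (L := hemisphere ι) φ ψ φc.continuousOn
    ψc.continuousOn (fun z _ => ψφ z) (isClosed_hemisphere ι)
    (by rw [himg]; exact isClosed_lowerSides) (fun z hz => by
      have h1 := hφ z hz
      constructor
      · intro h
        left
        refine ⟨hz.1, ?_⟩
        have := h.2
        simp only [φ] at this
        exact le_antisymm (by linarith) hz.2.1
      · rintro (h | h)
        · have h2 : z.2 = 0 := h.2
          exact mem_hemisphere_of_sides h1.1 (by simp [φ, h2]) (by simp [φ, h2])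
        · simp [cellUnion] at h)
    (union_subset (prod_mono_right (by simp)) (prod_mono_left (by simp [cellUnion]))) key
  rwa [himg] at this

theorem image_halfBall_eq :
    (fun z : (ι → ℝ) × ℝ => (z.1, 2 * z.2 - 1)) '' halfBall ι = {z | ‖z‖ ≤ 1} := by
  refine Subset.antisymm ?_ fun z hz => ⟨(z.1, (z.2 + 1) / 2), ?_, ?_⟩
  · rintro _ ⟨z, hz, rfl⟩
    have := mem_halfBall_iff.1 hz
    exact norm_prod_le_one_iff.2 ⟨this.1, by dsimp only; linarith, by dsimp only; linarith⟩
  · have := norm_prod_le_one_iff.1 hz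
    exact mem_halfBall_iff.2 ⟨this.1, by dsimp only; linarith, by dsimp only; linarith⟩
  · exact Prod.ext rfl (by dsimp only; ring)

theorem isClosed_cylinder_slice : IsClosed {z : (ι → ℝ) × ℝ | ‖z.1‖ ≤ 1 ∧ z.2 ≤ 0} :=
  (isClosed_le continuous_fst.norm continuous_const).inter
    (isClosed_le continuous_snd continuous_const)

/-- If `f` has the lifting property for `(W, y₀)` and `(V, y₀)` for sufficiently many points `y₀`
of `V ⊆ W`, it has the lifting property for `(W, V)`. -/
theorem PairLifting.of_points {W V S : Set Y} (hVW : V ⊆ W) (hSV : S ⊆ V)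
    (hS : ∀ v ∈ V, ∃ s ∈ S, JoinedIn V v s)
    (HW : ∀ y₀ ∈ S, ∀ (κ : Type) [Fintype κ], PairLifting κ f W {y₀})
    (HV : ∀ y₀ ∈ S, ∀ (κ : Type) [Fintype κ], PairLifting κ f V {y₀}) :
    PairLifting ι f W V := by
  refine PairLifting.of_ball fun y yc yW yV => ?_
  have h0 : ((0 : ι → ℝ), (0 : ℝ)) ∈ halfBall ι := ⟨by simp, le_rfl⟩
  obtain ⟨y₀, hy₀, w, hw⟩ := hS _ (yV _ h0 rfl)
  have hwV : ∀ r : ℝ, w.extend r ∈ V := fun r => hw _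
  -- the contraction of the flat part to `y₀`
  obtain ⟨u, uc, uA, uB⟩ := exists_continuousOn_glue (P := (ι → ℝ) × ℝ)
    (A := {z | ‖z.1‖ ≤ 1 ∧ z.2 ≤ 0 ∧ -(1 / 2) ≤ z.2}) (B := {z | z.2 ≤ -(1 / 2)})
    ((isClosed_le continuous_fst.norm continuous_const).inter
      ((isClosed_le continuous_snd continuous_const).inter
        (isClosed_le continuous_const continuous_snd)))
    (isClosed_le continuous_snd continuous_const)
    (f := fun z => y ((1 + 2 * z.2) • z.1, 0)) (g := fun z => w.extend (-1 - 2 * z.2))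
    (yc.comp (by fun_prop) (fun z hz => mem_halfBall_iff.2 ⟨by
      obtain ⟨k1, k2, k3⟩ := hz
      simp only [norm_smul, Real.norm_eq_abs]
      rw [abs_of_nonneg (by linarith)]
      nlinarith [norm_nonneg z.1], le_rfl, zero_le_one⟩))
    ((w.continuous_extend.comp (by fun_prop)).continuousOn) (by
      rintro z ⟨⟨-, -, h2⟩, h3⟩
      have h3 : z.2 ≤ -(1 / 2) := h3
      have : z.2 = -(1 / 2) := le_antisymm h3 h2
      simp [this])
  have uV : ∀ z : (ι → ℝ) × ℝ, ‖z.1‖ ≤ 1 → z.2 ≤ 0 → u z ∈ V := by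
    intro z hz1 hz2
    rcases le_total z.2 (-(1 / 2)) with h | h
    · rw [uB h]; exact hwV _
    · rw [uA ⟨hz1, hz2, h⟩]
      refine yV _ (mem_halfBall_iff.2 ⟨?_, le_rfl, zero_le_one⟩) rfl
      simp only [norm_smul, Real.norm_eq_abs]
      rw [abs_of_nonneg (by linarith)]
      nlinarith [norm_nonneg z.1]
  obtain ⟨y', yc', yA, yB⟩ := exists_continuousOn_glue (isClosed_halfBall ι)
    isClosed_cylinder_slice yc
    (uc.mono (fun z hz => by
      rcases le_total z.2 (-(1 / 2)) with h | h
      exacts [Or.inr h, Or.inl ⟨hz.1, hz.2, h⟩])) (by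
      rintro z ⟨h1, h2⟩
      have h3 : z.2 = 0 := le_antisymm h2.2 h1.2
      rw [uA ⟨h2.1, h2.2, by rw [h3]; norm_num⟩]
      simp only [h3, mul_zero, add_zero, one_smul]
      rw [← h3])
  have ybot : ∀ z : (ι → ℝ) × ℝ, ‖z‖ ≤ 1 → z.2 = -1 → y' z = y₀ := by
    intro z hz h
    rw [yB ⟨(norm_prod_le_one_iff.1 hz).1, by rw [h]; norm_num⟩, uB (by simp [h]; norm_num)]
    simp only [h]
    norm_num
  have ylow : ∀ z : (ι → ℝ) × ℝ, ‖z‖ ≤ 1 → z.2 ≤ 0 → y' z ∈ V := by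
    intro z hz h
    have hz1 := (norm_prod_le_one_iff.1 hz).1
    rw [yB ⟨hz1, h⟩]; exact uV z hz1 h
  have yhigh : ∀ z : (ι → ℝ) × ℝ, ‖z‖ ≤ 1 → y' z ∈ W := by
    intro z hz
    rcases le_total z.2 0 with h | h
    · exact hVW (ylow z hz h)
    · rw [yA ⟨hz, h⟩]; exact yW z ⟨hz, h⟩
  -- The collar below the flat part carries its contraction in `V` to `y₀`. Its sides must stay in
  -- `V` and its bottom at `y₀`, so that the lower half of the sphere goes to `V`.
  let C : (ι → ℝ) × ℝ → Set Y := fun z =>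
    {v | v ∈ W ∧ (‖z.1‖ = 1 → z.2 ≤ 0 → v ∈ V) ∧ (z.2 = -1 → v ∈ ({y₀} : Set Y))}
  refine ⟨y', C, yc'.mono (fun z hz => ?_), yA, fun z hz => ⟨yhigh z hz, fun _ => ylow z hz,
    ybot z hz⟩, ylow, fun z hz v hv => hv.1, fun z hz hz2 h v hv => ?_, ?_⟩
  · rcases le_total z.2 0 with h | h
    · exact Or.inr ⟨(norm_prod_le_one_iff.1 hz).1, h⟩
    · exact Or.inl ⟨hz, h⟩
  · rcases h with h | h
    · exact hv.2.1 h hz2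
    · rw [hv.2.2 h]; exact hSV hy₀
  -- The lower sides are a problem for `(V, y₀)`. Once they are lifted, the whole ball, rescaled
  -- vertically, is a half ball whose flat part is the bottom `z.2 = -1`: a problem for `(W, y₀)`.
  · have s1 : LiftExt f C (hemisphere ι) (hemisphere ι ∪ lowerSides ι) :=
      liftExt_lowerSides (singleton_subset_iff.2 (hSV hy₀)) (HV y₀ hy₀) fun z hz => by
        ext v
        exact ⟨fun hv => ⟨hv.2.1 hz.1 hz.2.2, hv.2.2⟩,
          fun hv => ⟨hVW hv.1, fun _ _ => hv.1, hv.2⟩⟩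
    have s2 := LiftExt.of_chart (f := f) (C := C) (L := hemisphere ι ∪ lowerSides ι)
      (L₀ := hemisphere ι) (K₀ := halfBall ι) (fun z => (z.1, 2 * z.2 - 1))
      (fun z => (z.1, (z.2 + 1) / 2)) (by fun_prop) (by fun_prop)
      (fun z _ => Prod.ext rfl (by dsimp only; ring))
      ((isClosed_hemisphere ι).union isClosed_lowerSides)
      (by rw [image_halfBall_eq]; exact isClosed_unitBall) (fun z hz => by
        obtain ⟨h1, h2, h3⟩ := mem_halfBall_iff.1 hz
        rw [mem_hemisphere_iff hz]
        constructor
        · rintro (h | h)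
          · have h4 : (0 : ℝ) ≤ 2 * z.2 - 1 := h.2
            have := (mem_hemisphere_iff (hemisphere_subset h)).1 h
            simp only at this
            rcases this with h | h
            · exact Or.inl h
            · right; linarith
          · exact Or.inl h.1
        · intro h
          rcases le_total 0 (2 * z.2 - 1) with h4 | h4
          · left
            rcases h with h | h
            · exact mem_hemisphere_of_sides h h4 (by dsimp only; linarith)
            · refine (mem_hemisphere_iff (z := (z.1, 2 * z.2 - 1))
                (mem_halfBall_iff.2 ⟨h1, h4, ?_⟩)).2 (Or.inr ?_) <;>
                simp only [h] <;> norm_num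
          · right
            rcases h with h | h
            · exact ⟨h, by dsimp only; linarith, h4⟩
            · exfalso; rw [h] at h4; norm_num at h4)
      hemisphere_subset ((HW y₀ hy₀ ι).liftExt (fun z hz v hv => hv.1)
        (fun z hz h v hv => hv.2.2 (by simp [h])) (fun z hz hz' h v hv => ⟨hv, fun k1 _ => ?_,
          fun k => absurd k (by dsimp only; intro k; exact h (by linarith))⟩)
        (fun z hz hz' h v hv => ?_))
    · have hsub : hemisphere ι ∪ lowerSides ι ⊆ {z | ‖z‖ ≤ 1} :=
        union_subset (fun z hz => hz.1.le) lowerSides_subset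
      rw [image_halfBall_eq, union_eq_self_of_subset_left hsub] at s2
      exact s1.trans subset_union_left hsub s2
    · exact absurd ((mem_hemisphere_iff hz).2 (Or.inl k1)) hz'
    · rw [mem_singleton_iff.1 hv]
      exact ⟨hVW (hSV hy₀), fun _ _ => hSV hy₀, fun _ => rfl⟩

end Excision

/-! ### Composition of pairs and the local-to-global principle. -/

section Cover

variable {X Y : Type*} [TopologicalSpace X] [TopologicalSpace Y] {ι : Type} [Fintype ι]
  {f : C(X, Y)}

/-- A constant collar at `y₀` is glued below the flat part. Solving over the upper half may move the
flat part within `U`; the collar leaves room to bring it back to `y₀` by a second problem, now in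
`U`. -/
theorem PairLifting.trans {U : Set Y} {y₀ : Y} (hy₀ : y₀ ∈ U) (h₁ : PairLifting ι f univ U)
    (h₂ : PairLifting ι f U {y₀}) : PairLifting ι f univ {y₀} := by
  refine PairLifting.of_ball fun y yc yW yV => ?_
  obtain ⟨y', yc', yA, yB⟩ := exists_continuousOn_glue (isClosed_halfBall ι)
    (isClosed_cylinder_slice (ι := ι)) yc (continuousOn_const (c := y₀)) (by
      rintro z ⟨h1, h2⟩
      exact yV z h1 (le_antisymm h2.2 h1.2))
  have ylow : ∀ z : (ι → ℝ) × ℝ, ‖z‖ ≤ 1 → z.2 ≤ 0 → y' z = y₀ := fun z hz h =>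
    yB ⟨(norm_prod_le_one_iff.1 hz).1, h⟩
  let C : (ι → ℝ) × ℝ → Set Y := fun z =>
    {v | (z.2 ≤ 0 → v ∈ U) ∧ (z.2 ≤ 0 → (‖z.1‖ = 1 ∨ z.2 = -1) → v = y₀)}
  refine ⟨y', C, yc'.mono (fun z hz => ?_), yA,
    fun z hz => ⟨fun h => by rw [ylow z hz h]; exact hy₀, fun h _ => ylow z hz h⟩, ylow,
    fun z hz => subset_univ _, fun z hz hz2 h v hv => hv.2 hz2 h, ?_⟩
  · rcases le_total z.2 0 with h | h
    · exact Or.inr ⟨(norm_prod_le_one_iff.1 hz).1, h⟩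
    · exact Or.inl ⟨hz, h⟩
  -- Along the lower sides the constraint is `{y₀}`, so the data on the equator are extended
  -- vertically, by composition with `(z.1, max z.2 0)`.
  have s1 : LiftExt f C (hemisphere ι) (hemisphere ι ∪ lowerSides ι) := by
    intro x y h xc yc hc h0 h1 hC yC
    have ρm : ∀ z ∈ hemisphere ι ∪ lowerSides ι, (z.1, max z.2 0) ∈ hemisphere ι := by
      rintro z (hz | hz)
      · rw [max_eq_left hz.2]; exact hz
      · exact mem_hemisphere_of_sides hz.1 (le_max_right _ _) (max_le (hz.2.2.trans zero_le_one)
          zero_le_one)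
    have ρe : ∀ z ∈ hemisphere ι, (z.1, max z.2 0) = z := fun z hz => by rw [max_eq_left hz.2]
    refine ⟨fun z => x (z.1, max z.2 0), fun q => h ((q.1.1, max q.1.2 0), q.2),
      ContinuousMap.id I, xc.comp (by fun_prop) ρm, fun z hz => by simp only [ρe z hz],
      hc.comp (by fun_prop) (fun q hq => ⟨ρm _ hq.1, mem_univ _⟩), fun z hz => h0 _ (ρm z hz),
      ?_, ?_, rfl, rfl, fun z hz s => by simp only [ρe z hz]; rfl⟩
    · rintro z (hz | hz)
      · simp only [ρe z hz]; exact h1 z hz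
      · have h3 := ρm z (Or.inr hz)
        show h ((z.1, max z.2 0), 1) = y z
        rw [h1 _ h3, (yC _ (Or.inr hz)).2 hz.2.2 (Or.inl hz.1)]
        exact (yC _ (Or.inl h3)).2 (by simp [hz.2.2]) (Or.inl hz.1)
    · rintro z (hz | hz) s
      · simp only [ρe z hz]; exact hC z hz s
      · have h3 := ρm z (Or.inr hz)
        have h4 := (hC _ h3 s).2 (by simp [hz.2.2]) (Or.inl hz.1)
        exact ⟨fun _ => by dsimp only; rw [h4]; exact hy₀, fun _ _ => h4⟩
  -- The upper half is a problem for `(Y, U)`.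
  have s2 : LiftExt f C (hemisphere ι ∪ lowerSides ι)
      (hemisphere ι ∪ lowerSides ι ∪ halfBall ι) := by
    refine LiftExt.excision (L₀ := hemisphere ι) ((isClosed_hemisphere ι).union
      isClosed_lowerSides) (isClosed_halfBall ι) (fun z hz => ⟨?_, fun h => Or.inl h⟩)
      hemisphere_subset (h₁.liftExt (fun z _ => subset_univ _) (fun z _ h v hv => hv.1 h.le)
        (fun z hz _ h v _ => ⟨fun k => absurd (le_antisymm k hz.2) h,
          fun k => absurd (le_antisymm k hz.2) h⟩) (fun z hz hz' h v hv => ⟨fun _ => hv,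
          fun _ k => ?_⟩))
    · rintro (h | h)
      · exact h
      · exact mem_hemisphere_of_sides h.1 hz.2 (h.2.2.trans zero_le_one)
    · rcases k with k | k
      · exact absurd ((mem_hemisphere_iff hz).2 (Or.inl k)) hz'
      · rw [h] at k; norm_num at k
  have hsub : hemisphere ι ∪ lowerSides ι ∪ halfBall ι ⊆ {z | ‖z‖ ≤ 1} :=
    union_subset (union_subset (fun z hz => hz.1.le) lowerSides_subset) fun z hz => hz.1
  have himg : (fun z : (ι → ℝ) × ℝ => (z.1, z.2 - 1)) '' halfBall ι =
      {z | ‖z.1‖ ≤ 1 ∧ -1 ≤ z.2 ∧ z.2 ≤ 0} := by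
    refine Subset.antisymm ?_ fun z hz => ⟨(z.1, z.2 + 1), ?_, Prod.ext rfl (by simp)⟩
    · rintro _ ⟨z, hz, rfl⟩
      have := mem_halfBall_iff.1 hz
      exact ⟨this.1, by dsimp only; linarith, by dsimp only; linarith⟩
    · exact mem_halfBall_iff.2 ⟨hz.1, by linarith [hz.2.1], by linarith [hz.2.2]⟩
  -- The lower half is a problem for `(U, y₀)`: its top and sides are already lifted, and its flat
  -- part is the bottom of the ball.
  have s3 := LiftExt.of_chart (f := f) (C := C)
    (L := hemisphere ι ∪ lowerSides ι ∪ halfBall ι) (L₀ := hemisphere ι) (K₀ := halfBall ι)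
    (fun z => (z.1, z.2 - 1)) (fun z => (z.1, z.2 + 1)) (by fun_prop) (by fun_prop)
    (fun z _ => Prod.ext rfl (by simp))
    (((isClosed_hemisphere ι).union isClosed_lowerSides).union (isClosed_halfBall ι))
    (by
      rw [himg]
      exact (isClosed_le continuous_fst.norm continuous_const).inter
        ((isClosed_le continuous_const continuous_snd).inter
          (isClosed_le continuous_snd continuous_const))) (fun z hz => by
      obtain ⟨k1, k2, k3⟩ := mem_halfBall_iff.1 hz
      rw [mem_hemisphere_iff hz]
      constructor
      · rintro ((h | h) | h)
        · right; exact le_antisymm k3 (by linarith [show (0 : ℝ) ≤ z.2 - 1 from h.2])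
        · left; exact h.1
        · right; exact le_antisymm k3 (by linarith [show (0 : ℝ) ≤ z.2 - 1 from h.2])
      · rintro (h | h)
        · left; right; exact ⟨h, by dsimp only; linarith, by dsimp only; linarith⟩
        · right; exact mem_halfBall_iff.2 ⟨k1, by simp [h], by simp [h]⟩)
    hemisphere_subset (h₂.liftExt
      (fun z hz v hv => hv.1 (by dsimp only; linarith [(mem_halfBall_iff.1 hz).2.2]))
      (fun z hz h v hv => hv.2 (by simp [h]) (by simp [h]))
      (fun z hz hz' h v hv => ⟨fun _ => hv, fun _ k => ?_⟩)
      (fun z hz hz' h v hv => ⟨fun _ => by rw [mem_singleton_iff.1 hv]; exact hy₀, fun _ _ => hv⟩))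
  · rw [himg] at s3
    have e : hemisphere ι ∪ lowerSides ι ∪ halfBall ι ∪ {z | ‖z.1‖ ≤ 1 ∧ -1 ≤ z.2 ∧ z.2 ≤ 0} =
        {z | ‖z‖ ≤ 1} := by
      refine Subset.antisymm (union_subset hsub fun z hz => norm_prod_le_one_iff.2
        ⟨hz.1, hz.2.1, hz.2.2.trans zero_le_one⟩) fun z hz => ?_
      have := norm_prod_le_one_iff.1 hz
      rcases le_total z.2 0 with h | h
      · exact Or.inr ⟨this.1, this.2.1, h⟩
      · exact Or.inl (Or.inr ⟨hz, h⟩)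
    rw [e] at s3
    exact (s1.trans subset_union_left subset_union_left s2).trans
      (subset_union_left.trans subset_union_left) hsub s3
  · rcases k with k | k
    · exact absurd ((mem_hemisphere_iff hz).2 (Or.inl k)) hz'
    · exact absurd (by dsimp only at k; linarith) h

theorem PairLifting.of_liftExt {W B : Set Y}
    (H : ∀ y : (ι → ℝ) × ℝ → Y, ContinuousOn y (halfBall ι) → (∀ z ∈ halfBall ι, y z ∈ W) →
      (∀ z ∈ halfBall ι, z.2 = 0 → y z ∈ B) →
      ∃ C : (ι → ℝ) × ℝ → Set Y, (∀ z ∈ halfBall ι, y z ∈ C z) ∧ (∀ z ∈ halfBall ι, C z ⊆ W) ∧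
        (∀ z ∈ halfBall ι, z.2 = 0 → C z ⊆ B) ∧ LiftExt f C (hemisphere ι) (halfBall ι)) :
    PairLifting ι f W B := by
  intro x y xc yc hxy yW yB
  obtain ⟨C, yC, CW, CB, hL⟩ := H y yc yW yB
  obtain ⟨x', h', d, a1, a2, a3, a4, a5, a6, -, -, a7⟩ := hL x y (fun q => y q.1) xc yc
    ((yc.mono hemisphere_subset).comp continuousOn_fst fun q hq => hq.1)
    (fun z hz => (hxy z hz).symm) (fun z _ => rfl)
    (fun z hz _ => yC z (hemisphere_subset hz)) yC
  exact ⟨x', h', a1, a2, a3, a4, a5, fun z hz s => CW z hz (a6 z hz s),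
    fun z hz h0 s => CB z hz h0 (a6 z hz s), a7⟩

/-- The affine map from `[0, N]^ι × [0, N]` onto the half ball, which reverses the last
coordinate. -/
def latticeMap (N : ℕ) (q : (ι → ℝ) × ℝ) : (ι → ℝ) × ℝ := (fun i => 2 * q.1 i / N - 1, 1 - q.2 / N)

/-- The inverse of `latticeMap`. -/
def latticeMapInv (N : ℕ) (z : (ι → ℝ) × ℝ) : (ι → ℝ) × ℝ :=
  (fun i => N * (z.1 i + 1) / 2, N * (1 - z.2))

theorem latticeMap_latticeMapInv {N : ℕ} (hN : 0 < N) (z : (ι → ℝ) × ℝ) :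
    latticeMap N (latticeMapInv N z) = z := by
  have : (N : ℝ) ≠ 0 := by positivity
  refine Prod.ext (funext fun i => ?_) ?_ <;> simp only [latticeMap, latticeMapInv] <;> field_simp <;>
    ring

theorem latticeMapInv_latticeMap {N : ℕ} (hN : 0 < N) (z : (ι → ℝ) × ℝ) :
    latticeMapInv N (latticeMap N z) = z := by
  have : (N : ℝ) ≠ 0 := by positivity
  refine Prod.ext (funext fun i => ?_) ?_ <;> simp only [latticeMap, latticeMapInv] <;> field_simp <;>
    ring

theorem latticeMap_mem_halfBall {N : ℕ} (hN : 0 < N) {q : (ι → ℝ) × ℝ} :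
    latticeMap N q ∈ halfBall ι ↔ q ∈ cellUnion (cubeCells ι N) ×ˢ Icc (0 : ℝ) N := by
  have hN' : (0 : ℝ) < N := by positivity
  rw [mem_halfBall_iff, mem_prod, mem_cellUnion_cubeCells, pi_norm_le_iff_of_nonneg zero_le_one,
    mem_Icc]
  simp only [latticeMap, Real.norm_eq_abs, abs_le]
  refine and_congr (forall_congr' fun i => and_congr ?_ ?_) ?_
  · rw [neg_le_sub_iff_le_add, le_add_iff_nonneg_left, le_div_iff₀ hN', zero_mul]
    constructor <;> intro h <;> linarith
  · rw [sub_le_iff_le_add, div_le_iff₀ hN']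
    constructor <;> intro h <;> linarith
  · rw [sub_nonneg, sub_le_self_iff, div_le_one hN', le_div_iff₀ hN', zero_mul, and_comm]

theorem latticeMap_mem_hemisphere {N : ℕ} (hN : 0 < N) {q : (ι → ℝ) × ℝ}
    (hq : q ∈ cellUnion (cubeCells ι N) ×ˢ Icc (0 : ℝ) N) :
    latticeMap N q ∈ hemisphere ι ↔ q.1 ∈ cellUnion (cubeBoundaryCells ι N) ∨ q.2 = 0 := by
  have hN' : (0 : ℝ) < N := by positivity
  have hz := (latticeMap_mem_halfBall hN).2 hq
  rw [mem_hemisphere_iff hz, norm_eq_one_iff (mem_halfBall_iff.1 hz).1,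
    mem_cellUnion_cubeBoundaryCells]
  have h1 := mem_cellUnion_cubeCells.1 hq.1
  refine or_congr ?_ ?_
  · rw [and_iff_right h1]
    refine exists_congr fun i => ?_
    simp only [latticeMap, abs_eq zero_le_one]
    rw [or_comm]
    refine or_congr ?_ ?_
    · rw [sub_eq_neg_self, div_eq_zero_iff, or_iff_left hN'.ne', mul_eq_zero_iff_left two_ne_zero]
    · rw [sub_eq_iff_eq_add, div_eq_iff hN'.ne']
      constructor <;> intro h <;> linarith
  · simp only [latticeMap, sub_eq_self, div_eq_zero_iff, or_iff_left hN'.ne']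

/-- A sufficiently fine cubical subdivision of the half ball is subordinate to an open cover. -/
theorem exists_subordinate_subdivision {J : Type*} [Nonempty J] {U : J → Set Y}
    (hU : ∀ i, IsOpen (U i)) (hcov : ⋃ i, U i = univ) {y : (ι → ℝ) × ℝ → Y}
    (yc : ContinuousOn y (halfBall ι)) :
    ∃ N : ℕ, 0 < N ∧ ∃ α : (ι → ℤ) → ℕ → J, ∀ (a : ι → ℤ) (j : ℕ), (∀ i, 0 ≤ a i ∧ a i < N) → j < N →
      ∀ q : (ι → ℝ) × ℝ, q.1 ∈ latticeCell (a, Finset.univ) → (j : ℝ) ≤ q.2 → q.2 ≤ j + 1 →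
        y (latticeMap N q) ∈ U (α a j) := by
  choose V hVo hV using fun i => continuousOn_iff'.1 yc (U i) (hU i)
  have hcpt : IsCompact (halfBall ι) :=
    Metric.isCompact_of_isClosed_isBounded (isClosed_halfBall ι)
      ((Metric.isBounded_closedBall (x := 0) (r := 1)).subset fun z hz => by simpa using hz.1)
  obtain ⟨δ, hδ, hleb⟩ := lebesgue_number_lemma_of_metric hcpt hVo (fun z hz => by
    obtain ⟨i, hi⟩ := mem_iUnion.1 (hcov ▸ mem_univ (y z))
    exact mem_iUnion.2 ⟨i, ((hV i).subset ⟨hi, hz⟩).1⟩)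
  -- `latticeMap` contracts by `2 / N` in the first coordinates and by `1 / N` in the last. With `2
  -- / N < δ`, the image of a unit cube lies in the `δ`-ball around the image of its lower corner.
  obtain ⟨n, hn⟩ := exists_nat_gt (2 / δ)
  have hN : 0 < n + 1 := n.succ_pos
  have hN' : (0 : ℝ) < (n + 1 : ℕ) := by positivity
  have hn' : 2 / ((n + 1 : ℕ) : ℝ) < δ := by
    rw [div_lt_iff₀ hδ] at hn
    rw [div_lt_iff₀ hN']
    push_cast
    nlinarith
  refine ⟨n + 1, hN, ?_⟩
  have : ∀ (a : ι → ℤ) (j : ℕ), ∃ i, (∀ i, 0 ≤ a i ∧ a i < (n + 1 : ℕ)) → j < n + 1 →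
      ∀ q : (ι → ℝ) × ℝ, q.1 ∈ latticeCell (a, Finset.univ) → (j : ℝ) ≤ q.2 → q.2 ≤ j + 1 →
        y (latticeMap (n + 1) q) ∈ U i := by
    intro a j
    by_cases hr : (∀ i, 0 ≤ a i ∧ a i < (n + 1 : ℕ)) ∧ j < n + 1
    swap
    · exact ⟨Classical.arbitrary J, fun h1 h2 => absurd ⟨h1, h2⟩ hr⟩
    obtain ⟨ha, hj⟩ := hr
    have hmem : ∀ q : (ι → ℝ) × ℝ, q.1 ∈ latticeCell (a, Finset.univ) → (j : ℝ) ≤ q.2 →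
        q.2 ≤ j + 1 → latticeMap (n + 1) q ∈ halfBall ι := by
      intro q h1 h2 h3
      refine (latticeMap_mem_halfBall hN).2 ⟨mem_cellUnion_cubeCells.2 fun i => ?_, ?_, ?_⟩
      · obtain ⟨k1, k2, -⟩ := h1 i
        have k2 := k2 (Finset.mem_univ i)
        have l1 : (0 : ℝ) ≤ a i := by exact_mod_cast (ha i).1
        have l2 : (a i : ℝ) + 1 ≤ (n + 1 : ℕ) := by exact_mod_cast (ha i).2
        exact ⟨l1.trans k1, k2.trans l2⟩
      · exact (Nat.cast_nonneg j).trans h2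
      · exact h3.trans (by exact_mod_cast hj)
    have h0 := hmem (fun i => a i, j) (fun i => ⟨le_rfl, fun _ => by simp, fun _ => le_rfl⟩)
      le_rfl (by simp)
    obtain ⟨i, hi⟩ := hleb _ h0
    refine ⟨i, fun _ _ q h1 h2 h3 => ?_⟩
    refine ((hV i).symm.subset ⟨hi ?_, hmem q h1 h2 h3⟩).1
    have hsmall : ∀ r : ℝ, 0 ≤ r → r ≤ 1 → 2 * r / ((n + 1 : ℕ) : ℝ) < δ := fun r _ h =>
      lt_of_le_of_lt (by gcongr; linarith) hn'
    rw [Metric.mem_ball, Prod.dist_eq, max_lt_iff, dist_pi_lt_iff hδ]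
    refine ⟨fun k => ?_, ?_⟩
    · obtain ⟨k1, k2, -⟩ := h1 k
      have k2 := k2 (Finset.mem_univ k)
      simp only [latticeMap, Real.dist_eq]
      have e : 2 * q.1 k / ((n + 1 : ℕ) : ℝ) - 1 - (2 * (a k : ℝ) / ((n + 1 : ℕ) : ℝ) - 1) =
          2 * (q.1 k - a k) / ((n + 1 : ℕ) : ℝ) := by ring
      have k1 : (0 : ℝ) ≤ q.1 k - a k := sub_nonneg.2 k1
      rw [e, abs_of_nonneg (by positivity)]
      exact hsmall _ k1 (by simp only at k2; linarith)
    · simp only [latticeMap, Real.dist_eq]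
      have e : 1 - q.2 / ((n + 1 : ℕ) : ℝ) - (1 - (j : ℝ) / ((n + 1 : ℕ) : ℝ)) =
          -((q.2 - j) / ((n + 1 : ℕ) : ℝ)) := by ring
      have k1 : (0 : ℝ) ≤ q.2 - j := sub_nonneg.2 h2
      rw [e, abs_neg, abs_of_nonneg (by positivity)]
      refine lt_of_le_of_lt ?_ (hsmall _ k1 (by linarith))
      gcongr
      linarith
  choose α hα using this
  exact ⟨α, hα⟩

theorem exists_eq_biInter {J : Type*} {U : J → Set Y} (hU : ∀ α β, ∃ γ, U γ = U α ∩ U β)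
    {s : Finset J} (hs : s.Nonempty) : ∃ γ, U γ = ⋂ i ∈ s, U i := by
  induction hs using Finset.Nonempty.cons_induction with
  | singleton a => exact ⟨a, by simp⟩
  | cons a s _ _ ih =>
    obtain ⟨β, hβ⟩ := ih
    obtain ⟨γ, hγ⟩ := hU a β
    exact ⟨γ, by rw [hγ, hβ]; simp⟩

/-- The local-to-global principle for the lifting property. -/
theorem PairLifting.of_cover {J : Type*} {U : J → Set Y} (hU : ∀ i, IsOpen (U i))
    (hcov : ⋃ i, U i = univ) (hinter : ∀ α β, ∃ γ, U γ = U α ∩ U β)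
    (H : ∀ β γ, U γ ⊆ U β → ∀ (κ : Type) [Fintype κ], PairLifting κ f (U β) (U γ)) (α₀ : J) :
    PairLifting ι f univ (U α₀) := by
  classical
  refine PairLifting.of_liftExt fun y yc _ yB => ?_
  have : Nonempty J := ⟨α₀⟩
  obtain ⟨N, hN, α', hα'⟩ := exists_subordinate_subdivision hU hcov yc
  have hN' : (0 : ℝ) < N := by positivity
  -- The slab with index `N` lies beyond the half ball. Labelling it `α₀` encodes the boundary
  -- condition, as it meets the half ball only in the flat part, at height `N`.
  let α : (ι → ℤ) → ℕ → J := fun a j => if j < N then α' a j else α₀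
  -- A point is constrained to all members of the cover attached to top-dimensional cubes containing
  -- it. The constraint thus depends only on the cell, and it shrinks on passing to faces.
  let C : (ι → ℝ) × ℝ → Set Y := fun q => {v | ∀ (a : ι → ℤ) (j : ℕ), (∀ i, 0 ≤ a i ∧ a i < N) →
    j ≤ N → q.1 ∈ latticeCell (a, Finset.univ) → (j : ℝ) ≤ q.2 → q.2 ≤ j + 1 → v ∈ U (α a j)}
  have slab : ∀ j : ℕ, j < N → LiftExt f C
      (cellUnion (cubeCells ι N) ×ˢ {(j : ℝ)} ∪
        cellUnion (cubeBoundaryCells ι N) ×ˢ Icc (j : ℝ) (j + 1))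
      (cellUnion (cubeCells ι N) ×ˢ Icc (j : ℝ) (j + 1)) := by
    intro j hj
    refine liftExt_cellUnion (cubeBoundaryCells_subset N) (isCellComplex_cubeBoundaryCells N)
      (isCellComplex_cubeCells N) j fun e he he' => ?_
    -- `A` consists of the top-dimensional cubes having `e` as a face. It is nonempty because `e`,
    -- not being a boundary cell, has a lower corner with all coordinates below `N`.
    let A : Finset (ι → ℤ) := (Fintype.piFinset fun _ => Finset.Ico (0 : ℤ) N).filter fun a =>
      latticeCell e ⊆ latticeCell (a, Finset.univ)
    have memA : ∀ a, a ∈ A ↔ (∀ i, 0 ≤ a i ∧ a i < N) ∧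
        latticeCell e ⊆ latticeCell (a, Finset.univ) := fun a => by
      simp only [A, Finset.mem_filter, Fintype.mem_piFinset, Finset.mem_Ico]
    have hA : A.Nonempty := by
      refine ⟨e.1, (memA _).2 ⟨fun i => ?_, fun p hp i => ?_⟩⟩
      · obtain ⟨⟨h1, h2⟩, h3⟩ := mem_cubeCells.1 he i
        refine ⟨h1, ?_⟩
        by_cases hi : i ∈ e.2
        · exact h3 hi
        · refine lt_of_le_of_ne h2 fun h4 => he' ?_
          exact mem_cubeBoundaryCells.2 ⟨he, i, hi, Or.inr h4⟩
      · obtain ⟨h1, h2, h3⟩ := hp i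
        refine ⟨h1, fun _ => ?_, fun h => absurd (Finset.mem_univ i) h⟩
        by_cases hi : i ∈ e.2
        · exact h2 hi
        · exact (h3 hi).trans (by simp)
    -- Inside the slab the constraint over `e` is the intersection over `A` at level `j`; on its
    -- top, level `j + 1` enters as well. Both are members of the cover, so lifting over `e × [j, j
    -- + 1]` is a problem for `(U β, U γ)`.
    obtain ⟨β, hβ⟩ := exists_eq_biInter hinter (hA.image fun a => α a j)
    obtain ⟨γ, hγ⟩ := exists_eq_biInter hinter
      ((hA.image fun a => α a j).mono (Finset.subset_union_left (s₂ := A.image fun a => α a (j + 1))))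
    have memβ : ∀ v, v ∈ U β ↔ ∀ a ∈ A, v ∈ U (α a j) := fun v => by
      rw [hβ]; simp
    have memγ : ∀ v, v ∈ U γ ↔ (∀ a ∈ A, v ∈ U (α a j)) ∧ ∀ a ∈ A, v ∈ U (α a (j + 1)) := by
      intro v
      rw [hγ]
      simp only [mem_iInter, Finset.mem_union, Finset.mem_image]
      constructor
      · intro h
        exact ⟨fun a ha => h _ (Or.inl ⟨a, ha, rfl⟩), fun a ha => h _ (Or.inr ⟨a, ha, rfl⟩)⟩
      · rintro ⟨h1, h2⟩ i (⟨a, ha, rfl⟩ | ⟨a, ha, rfl⟩)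
        exacts [h1 a ha, h2 a ha]
    have hγβ : U γ ⊆ U β := fun v hv => (memβ v).2 ((memγ v).1 hv).1
    -- Off the hemisphere the chart meets only the open cell, so the carrier is `e` and any cube
    -- through the point contains all of `e`.
    have Aof : ∀ z ∈ halfBall e.2, z ∉ hemisphere e.2 → ∀ a : ι → ℤ, (∀ i, 0 ≤ a i ∧ a i < N) →
        (cellChart e (j : ℝ) z).1 ∈ latticeCell (a, Finset.univ) → a ∈ A := by
      intro z hz hz' a ha hmem
      refine (memA a).2 ⟨ha, ?_⟩
      rw [mem_hemisphere_iff hz, not_or] at hz'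
      have := latticeCell_carrierCell_subset hmem
      rwa [(carrierCell_cellChart hz).2 hz'.1] at this
    refine (H β γ hγβ e.2).liftExt (fun z hz v hv => ?_) (fun z hz h0 v hv => ?_)
      (fun z hz hz' h0 v hv => ?_) (fun z hz hz' h0 v hv => ?_)
    · have hm := cellChart_mem (c := (j : ℝ)) hz
      exact (memβ v).2 fun a ha => hv a j ((memA a).1 ha).1 hj.le (((memA a).1 ha).2 hm.1)
        hm.2.1 hm.2.2
    · have hm := cellChart_mem (c := (j : ℝ)) hz
      have h2 : (cellChart e (j : ℝ) z).2 = j + 1 := by simp [cellChart, h0]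
      refine (memγ v).2 ⟨fun a ha => hv a j ((memA a).1 ha).1 hj.le (((memA a).1 ha).2 hm.1)
        hm.2.1 hm.2.2, fun a ha => hv a (j + 1) ((memA a).1 ha).1 hj (((memA a).1 ha).2 hm.1)
        ?_ ?_⟩
      · rw [h2]; push_cast; exact le_rfl
      · rw [h2]; push_cast; linarith
    · intro a j' ha _ hmem h1 h2
      have e2 : (cellChart e (j : ℝ) z).2 = j + 1 - z.2 := rfl
      rw [e2] at h1 h2
      have hzp : 0 < z.2 := lt_of_le_of_ne hz.2 (Ne.symm h0)
      have hz1 : z.2 < 1 := lt_of_le_of_ne (mem_halfBall_iff.1 hz).2.2 fun h =>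
        hz' ((mem_hemisphere_iff hz).2 (Or.inr h))
      have k1 : (j' : ℝ) < ((j + 1 : ℕ) : ℝ) := by push_cast; linarith
      have k2 : (j : ℝ) < ((j' + 1 : ℕ) : ℝ) := by push_cast; linarith
      have k1 := Nat.cast_lt.1 k1
      have k2 := Nat.cast_lt.1 k2
      have : j' = j := by omega
      rw [this]
      exact (memβ v).1 hv a (Aof z hz hz' a ha hmem)
    · intro a j' ha _ hmem h1 h2
      have e2 : (cellChart e (j : ℝ) z).2 = j + 1 := by simp [cellChart, h0]
      rw [e2] at h1 h2
      have k1 : (j' : ℝ) ≤ ((j + 1 : ℕ) : ℝ) := by push_cast; linarith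
      have k2 : (j : ℝ) ≤ (j' : ℝ) := by linarith
      have k1 := Nat.cast_le.1 k1
      have k2 := Nat.cast_le.1 k2
      have haA := Aof z hz hz' a ha hmem
      rcases (show j' = j ∨ j' = j + 1 by omega) with rfl | rfl
      · exact ((memγ v).1 hv).1 a haA
      · exact ((memγ v).1 hv).2 a haA
  -- `L 0` is the hemisphere in lattice coordinates; each further step adds one slab.
  let L : ℕ → Set ((ι → ℝ) × ℝ) := fun j => cellUnion (cubeBoundaryCells ι N) ×ˢ Icc (0 : ℝ) N ∪
    cellUnion (cubeCells ι N) ×ˢ Icc (0 : ℝ) j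
  have Lc : ∀ j, IsClosed (L j) := fun j =>
    ((isClosed_cellUnion _).prod isClosed_Icc).union ((isClosed_cellUnion _).prod isClosed_Icc)
  have Lmono : ∀ j, L j ⊆ L (j + 1) := fun j => union_subset_union_right _
    (prod_mono_right (Icc_subset_Icc_right (by simp)))
  have bsub : cellUnion (cubeBoundaryCells ι N) ⊆ cellUnion (cubeCells ι N) :=
    biUnion_subset_biUnion_left (cubeBoundaryCells_subset N)
  have main : ∀ j : ℕ, j ≤ N → L 0 ⊆ L j ∧ LiftExt f C (L 0) (L j) := by
    intro j
    induction j with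
    | zero => exact fun _ => ⟨subset_rfl, LiftExt.refl⟩
    | succ j ih =>
      intro hj
      obtain ⟨ih1, ih2⟩ := ih (by omega)
      refine ⟨ih1.trans (Lmono j), ih2.trans ih1 (Lmono j) ?_⟩
      have hjN : (j : ℝ) + 1 ≤ N := by exact_mod_cast hj
      have := LiftExt.excision (f := f) (C := C) (L := L j) (Lc j)
        ((isClosed_cellUnion _).prod isClosed_Icc) (fun z hz => ?_) ?_ (slab j hj)
      · convert! this using 1
        rw [union_assoc, ← prod_union]
        simp only [L]
        rw [Icc_union_Icc_eq_Icc (by positivity) (by linarith)]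
        push_cast
        rfl
      · obtain ⟨h1, h2⟩ := hz
        constructor
        · rintro (h | h)
          · exact Or.inr ⟨h.1, h2⟩
          · exact Or.inl ⟨h1, le_antisymm h.2.2 h2.1⟩
        · rintro (h | h)
          · exact Or.inr ⟨h1, (Nat.cast_nonneg j).trans h2.1, (mem_singleton_iff.1 h.2).le⟩
          · exact Or.inl ⟨h.1, (Nat.cast_nonneg j).trans h2.1, h2.2.trans hjN⟩
      · exact union_subset (prod_mono_right (by simp)) (prod_mono_left bsub)
  have himg : latticeMap N '' (cellUnion (cubeCells ι N) ×ˢ Icc (0 : ℝ) N) = halfBall ι := by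
    refine Subset.antisymm ?_ fun z hz => ⟨latticeMapInv N z, ?_, latticeMap_latticeMapInv hN z⟩
    · rintro _ ⟨q, hq, rfl⟩; exact (latticeMap_mem_halfBall hN).2 hq
    · rw [← latticeMap_mem_halfBall hN, latticeMap_latticeMapInv hN]; exact hz
  have LN : L N = cellUnion (cubeCells ι N) ×ˢ Icc (0 : ℝ) N :=
    union_eq_self_of_subset_left (prod_mono_left bsub)
  have hfin := (main N le_rfl).2
  rw [LN] at hfin
  have hmemK : ∀ z ∈ halfBall ι, latticeMapInv N z ∈ cellUnion (cubeCells ι N) ×ˢ Icc (0 : ℝ) N := by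
    intro z hz
    rw [← latticeMap_mem_halfBall hN, latticeMap_latticeMapInv hN]; exact hz
  refine ⟨fun z => C (latticeMapInv N z), fun z hz a j ha hj h1 h2 h3 => ?_,
    fun _ _ => subset_univ _, fun z hz h0 v hv => ?_, ?_⟩
  · by_cases hjN : j < N
    · simp only [α, hjN, if_true]
      have := hα' a j ha hjN _ h1 h2 h3
      rwa [latticeMap_latticeMapInv hN] at this
    · simp only [α, hjN, if_false]
      refine yB z hz (le_antisymm ?_ hz.2)
      have : j = N := by omega
      rw [this] at h2
      simp only [latticeMapInv] at h2
      nlinarith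
  · have hp := mem_cellUnion_cubeCells.1 (hmemK z hz).1
    -- The minimum with `N - 1` assigns a coordinate equal to `N` to the last cube.
    have := hv (fun i => min ⌊(latticeMapInv N z).1 i⌋ (N - 1)) N (fun i => ⟨?_, ?_⟩) le_rfl
      (fun i => ⟨?_, fun _ => ?_, fun h => absurd (Finset.mem_univ i) h⟩) ?_ ?_
    · simpa [α] using this
    · exact le_min (Int.floor_nonneg.2 (hp i).1) (by omega)
    · exact (min_le_right _ _).trans_lt (by omega)
    · exact (Int.cast_le.2 (min_le_left _ _)).trans (Int.floor_le _)
    · rcases min_choice ⌊(latticeMapInv N z).1 i⌋ ((N : ℤ) - 1) with h | h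
      · simp only [h]; exact (Int.lt_floor_add_one _).le
      · simp only [h]; push_cast; linarith [(hp i).2]
    · simp [latticeMapInv, h0]
    · simp [latticeMapInv, h0]
  · have := LiftExt.of_chart (f := f) (C := fun z => C (latticeMapInv N z)) (L := hemisphere ι)
      (L₀ := L 0) (K₀ := cellUnion (cubeCells ι N) ×ˢ Icc (0 : ℝ) N) (latticeMap N)
      (latticeMapInv N) (by unfold latticeMap; fun_prop) (by unfold latticeMapInv; fun_prop)
      (fun z _ => latticeMapInv_latticeMap hN z) (isClosed_hemisphere ι)
      (by rw [himg]; exact isClosed_halfBall ι) (fun z hz => ?_)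
      (LN ▸ (main N le_rfl).1) (by simpa only [latticeMapInv_latticeMap hN] using hfin)
    · rwa [himg, union_eq_self_of_subset_left hemisphere_subset] at this
    · rw [latticeMap_mem_hemisphere hN hz]
      constructor
      · rintro (h | h)
        · exact Or.inl ⟨h, hz.2⟩
        · exact Or.inr ⟨hz.1, by simp [h]⟩
      · rintro (h | h)
        · exact Or.inl h.1
        · exact Or.inr (by simpa using h.2)

end Cover

/-! ### Relative loops and the exact sequence of a pair. -/

section Pair

variable {X : Type u} [TopologicalSpace X]

theorem continuous_fin_tail {n : ℕ} : Continuous fun t : Fin (n + 1) → I => Fin.tail t :=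
  continuous_pi fun i => continuous_apply i.succ

theorem continuous_fin_cons {n : ℕ} :
    Continuous fun q : (Fin n → I) × I => (Fin.cons q.2 q.1 : Fin (n + 1) → I) := by
  refine continuous_pi fun i => ?_
  refine Fin.cases ?_ (fun j => ?_) i
  · simpa using continuous_snd
  · simp only [Fin.cons_succ]; fun_prop

theorem tail_mem_boundary {n : ℕ} {t : Fin (n + 1) → I} :
    Fin.tail t ∈ Cube.boundary (Fin n) ↔ ∃ i : Fin n, t i.succ = 0 ∨ t i.succ = 1 := Iff.rfl

theorem mem_boundary_succ {n : ℕ} {t : Fin (n + 1) → I} :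
    t ∈ Cube.boundary (Fin (n + 1)) ↔
      (t 0 = 0 ∨ t 0 = 1) ∨ Fin.tail t ∈ Cube.boundary (Fin n) := by
  rw [tail_mem_boundary]
  exact Fin.exists_fin_succ

/-- A map on `I^n × I` as a relative loop; the last coordinate becomes the first one. -/
def RelLoop.ofProd {n : ℕ} {A : Set X} {x : X} (hx : x ∈ A) (p : C((Fin n → I) × I, X))
    (h0 : ∀ c, p (c, 0) = x) (hside : ∀ c ∈ Cube.boundary (Fin n), ∀ t, p (c, t) = x)
    (h1 : ∀ c, p (c, 1) ∈ A) : RelLoop n A x :=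
  ⟨p.comp ⟨fun t => (Fin.tail t, t 0), continuous_fin_tail.prodMk (continuous_apply 0)⟩, by
    constructor
    · intro t ht
      simp only [ContinuousMap.comp_apply, ContinuousMap.coe_mk]
      rcases mem_boundary_succ.1 ht with (h | h) | h
      · rw [h, h0]; exact hx
      · rw [h]; exact h1 _
      · rw [hside _ h]; exact hx
    · rintro t (h | h)
      · simp only [ContinuousMap.comp_apply, ContinuousMap.coe_mk, h, h0]
      · exact hside _ h _⟩

/-- An absolute loop as a relative loop. -/
def RelLoop.ofGenLoop {n : ℕ} {A : Set X} {x : X} (hx : x ∈ A) (p : GenLoop (Fin (n + 1)) X x) :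
    RelLoop n A x :=
  ⟨p.1, fun t ht => by rw [p.2 t ht]; exact hx, by
    rintro t (h | h)
    · exact p.2 t ⟨0, Or.inl h⟩
    · obtain ⟨i, hi⟩ := h
      exact p.2 t ⟨i.succ, hi⟩⟩

theorem RelPi.sound_of_homotopic {n : ℕ} {A : Set X} {x : X} {p q : RelLoop n A x}
    (h : p.1.HomotopicRel q.1 (Cube.boundary (Fin (n + 1)))) :
    (Quotient.mk _ p : RelPi n A x) = Quotient.mk _ q := by
  obtain ⟨H⟩ := h
  refine Quotient.sound ⟨⟨H.toHomotopy, fun s => ⟨fun t ht => ?_, fun t ht => ?_⟩⟩⟩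
  · have : H (s, t) = p.1 t := H.eq_fst s ht
    exact this ▸ p.2.1 t ht
  · have hb : t ∈ Cube.boundary (Fin (n + 1)) := by
      rcases ht with h | ⟨i, hi⟩
      exacts [⟨0, Or.inl h⟩, ⟨i.succ, hi⟩]
    have : H (s, t) = p.1 t := H.eq_fst s hb
    exact this.trans (p.2.2 t ht)

/-- Concatenation of maps of cubes in the direction `i`. -/
def concatAt {m : ℕ} (i : Fin m) (p q : C(Fin m → I, X))
    (h : ∀ t, p (Function.update t i 1) = q (Function.update t i 0)) : C(Fin m → I, X) where
  toFun t := if (t i : ℝ) ≤ 1 / 2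
    then p (Function.update t i (projIcc 0 1 zero_le_one (2 * t i)))
    else q (Function.update t i (projIcc 0 1 zero_le_one (2 * t i - 1)))
  continuous_toFun := by
    refine Continuous.if_le ?_ ?_ (by fun_prop) continuous_const ?_
    · exact p.continuous.comp (continuous_id.update i (by fun_prop))
    · exact q.continuous.comp (continuous_id.update i (by fun_prop))
    · intro t ht
      rw [ht]
      have e1 : projIcc (0 : ℝ) 1 zero_le_one (2 * (1 / 2)) = 1 := by
        apply Subtype.ext; norm_num [coe_projIcc]
      have e2 : projIcc (0 : ℝ) 1 zero_le_one (2 * (1 / 2) - 1) = 0 := by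
        apply Subtype.ext; norm_num [coe_projIcc]
      rw [e1, e2]
      exact h t

theorem projIcc_two_mul_zero : projIcc (0 : ℝ) 1 zero_le_one (2 * ((0 : I) : ℝ)) = 0 := by
  simp

theorem projIcc_two_mul_one : projIcc (0 : ℝ) 1 zero_le_one (2 * ((1 : I) : ℝ) - 1) = 1 := by
  apply Subtype.ext; norm_num [coe_projIcc]

theorem concatAt_eq_of_forall {m : ℕ} {i : Fin m} {p q : C(Fin m → I, X)}
    {h : ∀ t, p (Function.update t i 1) = q (Function.update t i 0)} {t : Fin m → I} {S : Set X}
    (hp : ∀ s, p (Function.update t i s) ∈ S) (hq : ∀ s, q (Function.update t i s) ∈ S) :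
    concatAt i p q h t ∈ S := by
  simp only [concatAt, ContinuousMap.coe_mk]
  split_ifs
  exacts [hp _, hq _]

theorem concatAt_of_eq_zero {m : ℕ} {i : Fin m} {p q : C(Fin m → I, X)}
    {h : ∀ t, p (Function.update t i 1) = q (Function.update t i 0)} {t : Fin m → I}
    (ht : t i = 0) : concatAt i p q h t = p t := by
  simp only [concatAt, ContinuousMap.coe_mk, ht, projIcc_two_mul_zero]
  rw [if_pos (by simp), ← ht, Function.update_eq_self]

theorem concatAt_of_eq_one {m : ℕ} {i : Fin m} {p q : C(Fin m → I, X)}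
    {h : ∀ t, p (Function.update t i 1) = q (Function.update t i 0)} {t : Fin m → I}
    (ht : t i = 1) : concatAt i p q h t = q t := by
  simp only [concatAt, ContinuousMap.coe_mk, ht, projIcc_two_mul_one]
  rw [if_neg (by norm_num), ← ht, Function.update_eq_self]

theorem prepend_compat {n : ℕ} {A : Set X} {x : X} (a : GenLoop (Fin (n + 1)) X x)
    (p : RelLoop n A x) (t : Fin (n + 1) → I) :
    a.1 (Function.update t 0 1) = p.1 (Function.update t 0 0) := by
  rw [a.2 _ ⟨0, Or.inr (by simp)⟩, p.2.2 _ (Or.inl (by simp))]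

/-- An absolute loop followed by a relative loop. -/
def RelLoop.prepend {n : ℕ} {A : Set X} {x : X} (a : GenLoop (Fin (n + 1)) X x)
    (p : RelLoop n A x) : RelLoop n A x :=
  ⟨concatAt 0 a.1 p.1 (prepend_compat a p), by
    have side : ∀ t : Fin (n + 1) → I, (∃ i : Fin n, t i.succ = 0 ∨ t i.succ = 1) →
        concatAt 0 a.1 p.1 (prepend_compat a p) t ∈ ({x} : Set X) := by
      rintro t ⟨i, hi⟩
      refine concatAt_eq_of_forall (fun s => ?_) (fun s => ?_)
      · exact a.2 _ ⟨i.succ, by simpa using hi⟩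
      · exact p.2.2 _ (Or.inr ⟨i, by simpa using hi⟩)
    have hx : x ∈ A := by
      have := p.2.1 (fun _ => 0) ⟨0, Or.inl rfl⟩
      rwa [p.2.2 _ (Or.inl rfl)] at this
    constructor
    · intro t ht
      rcases mem_boundary_succ.1 ht with (h | h) | h
      · rw [concatAt_of_eq_zero h, a.2 _ ⟨0, Or.inl h⟩]; exact hx
      · rw [concatAt_of_eq_one h]; exact p.2.1 _ ⟨0, Or.inr h⟩
      · rw [side t h]; exact hx
    · rintro t (h | h)
      · rw [concatAt_of_eq_zero h, a.2 _ ⟨0, Or.inl h⟩]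
      · exact side t h⟩

/-- The end face only sees the second factor. Together with `relMap_prepend`, this action of
absolute loops substitutes for a multiplication on one-dimensional relative classes. -/
theorem relBoundary_prepend {n : ℕ} {A : Set X} {x : A} (a : GenLoop (Fin (n + 1)) X x)
    (p : RelLoop n A (x : X)) :
    relBoundary n A x (Quotient.mk _ (RelLoop.prepend a p)) =
      relBoundary n A x (Quotient.mk _ p) := by
  refine congrArg (Quotient.mk _) (Subtype.ext (ContinuousMap.ext fun t => Subtype.ext ?_))
  exact concatAt_of_eq_one (h := prepend_compat a p) (t := faceMap n t) rfl

/-- Exactness of the sequence of a pair at `π_{n+1}(X, A)`. -/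
theorem exists_genLoop_of_relBoundary_eq {n : ℕ} {A : Set X} {x : A} (p : RelLoop n A (x : X))
    (h : relBoundary n A x (Quotient.mk _ p) = piBase n x) :
    ∃ a : GenLoop (Fin (n + 1)) X x,
      (Quotient.mk _ p : RelPi n A (x : X)) = Quotient.mk _ (RelLoop.ofGenLoop x.2 a) := by
  obtain ⟨G⟩ : (relBoundaryLoop n A x p).1.HomotopicRel GenLoop.const.1 (Cube.boundary (Fin n)) :=
    Quotient.exact h
  have G0 : ∀ c, (G (0, c) : X) = p.1 (faceMap n c) := fun c => by
    rw [G.apply_zero]; rfl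
  have G1 : ∀ c, G (1, c) = x := fun c => G.apply_one c
  have Gs : ∀ s, ∀ c ∈ Cube.boundary (Fin n), G (s, c) = x := fun s c hc => by
    rw [G.eq_snd s hc]; rfl
  -- At time `r` the first coordinate is stretched to `[0, 1 + r]`: `p` is run over `[0, 1]` and the
  -- null-homotopy `G` of its end face, which takes place in `A`, over `[1, 1 + r]`. At `r = 1` the
  -- end face has become constant.
  let K : C(I × (Fin (n + 1) → I), X) :=
    { toFun := fun q => if (q.2 0 : ℝ) * (1 + q.1) ≤ 1
        then p.1 (Function.update q.2 0 (projIcc 0 1 zero_le_one ((q.2 0 : ℝ) * (1 + q.1))))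
        else (G (projIcc 0 1 zero_le_one ((q.2 0 : ℝ) * (1 + q.1) - 1), Fin.tail q.2) : X)
      continuous_toFun := by
        refine Continuous.if_le ?_ ?_ (by fun_prop) continuous_const ?_
        · exact p.1.continuous.comp (continuous_snd.update 0 (by fun_prop))
        · exact continuous_subtype_val.comp (G.continuous.comp
            ((by fun_prop : Continuous _).prodMk (continuous_fin_tail.comp continuous_snd)))
        · intro q hq
          rw [hq]
          simp only [projIcc_right, sub_self, projIcc_left]
          rw [show (⟨0, left_mem_Icc.2 zero_le_one⟩ : I) = 0 from rfl, G0]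
          congr 1
          ext i
          refine Fin.cases ?_ (fun j => ?_) i
          · simp [faceMap]
          · simp [faceMap, Fin.tail] }
  have Kzero : ∀ r, ∀ t : Fin (n + 1) → I, t 0 = 0 → K (r, t) = x := by
    intro r t ht
    simp only [K, ContinuousMap.coe_mk, ht]
    rw [if_pos (by simp)]
    exact p.2.2 _ (Or.inl (by simp))
  have Kside : ∀ r, ∀ t : Fin (n + 1) → I, (∃ i : Fin n, t i.succ = 0 ∨ t i.succ = 1) →
      K (r, t) = x := by
    rintro r t ⟨i, hi⟩
    simp only [K, ContinuousMap.coe_mk]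
    split_ifs
    · exact p.2.2 _ (Or.inr ⟨i, by simpa using hi⟩)
    · exact congrArg Subtype.val (Gs _ _ ⟨i, hi⟩)
  have Ktop : ∀ r, ∀ t : Fin (n + 1) → I, t 0 = 1 → K (r, t) ∈ A := by
    intro r t ht
    simp only [K, ContinuousMap.coe_mk, ht]
    split_ifs with hr
    · refine p.2.1 _ ⟨0, Or.inr ?_⟩
      have : (r : ℝ) = 0 := le_antisymm (by simp at hr; linarith [hr]) r.2.1
      simp [this]
    · exact Subtype.coe_prop _
  have K1 : ∀ t ∈ Cube.boundary (Fin (n + 1)), K (1, t) = x := by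
    intro t ht
    rcases mem_boundary_succ.1 ht with (h | h) | h
    · exact Kzero 1 t h
    · simp only [K, ContinuousMap.coe_mk, h]
      rw [if_neg (by norm_num)]
      have : projIcc (0 : ℝ) 1 zero_le_one (((1 : I) : ℝ) * (1 + ((1 : I) : ℝ)) - 1) = 1 := by
        apply Subtype.ext; norm_num [coe_projIcc]
      rw [this, G1]
    · exact Kside 1 t h
  refine ⟨⟨K.comp ⟨fun t => (1, t), by fun_prop⟩, K1⟩, Quotient.sound ⟨⟨⟨K, fun t => ?_, fun t => rfl⟩,
    fun r => ⟨fun t ht => ?_, fun t ht => ?_⟩⟩⟩⟩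
  · simp only [K, Icc.coe_zero, add_zero, mul_one]
    rw [if_pos (t 0).2.2, projIcc_val, Function.update_eq_self]
  · rcases mem_boundary_succ.1 ht with (h | h) | h
    · exact (Kzero r t h).symm ▸ x.2
    · exact Ktop r t h
    · exact (Kside r t h).symm ▸ x.2
  · rcases ht with h | h
    exacts [Kzero r t h, Kside r t h]

/-- Exactness of the sequence of a pair at `π_n(A)`. -/
theorem exists_relBoundary_eq {n : ℕ} {A : Set X} {x : A} (b : π_ n A x)
    (h : piMap n ⟨Subtype.val, continuous_subtype_val⟩ x b = piBase n (x : X)) :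
    ∃ p, relBoundary n A x p = b := by
  induction b using Quotient.inductionOn with
  | _ b =>
  obtain ⟨G⟩ : (loopMap n ⟨Subtype.val, continuous_subtype_val⟩ x b).1.HomotopicRel
    GenLoop.const.1 (Cube.boundary (Fin n)) := Quotient.exact h
  have G0 : ∀ c, G (0, c) = b.1 c := fun c => G.apply_zero c
  refine ⟨Quotient.mk _ (RelLoop.ofProd x.2 ⟨fun q => G (unitInterval.symm q.2, q.1), by fun_prop⟩
    (fun c => ?_) (fun c hc t => ?_) (fun c => ?_)), ?_⟩
  · simp only [ContinuousMap.coe_mk, unitInterval.symm_zero]; exact G.apply_one c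
  · exact G.eq_snd _ hc
  · simp only [ContinuousMap.coe_mk, unitInterval.symm_one, G0]; exact (b.1 c).2
  · refine congrArg (Quotient.mk _) (Subtype.ext (ContinuousMap.ext fun c => Subtype.ext ?_))
    refine Eq.trans ?_ (G0 c)
    show G (unitInterval.symm (faceMap n c 0), Fin.tail (faceMap n c)) = G (0, c)
    have : faceMap n c 0 = 1 := rfl
    rw [this, unitInterval.symm_one]
    rfl

/-- A relative loop is itself a null-homotopy in `X` of its end face. -/
theorem piMap_relBoundary {n : ℕ} {A : Set X} {x : A} (p : RelPi n A (x : X)) :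
    piMap n ⟨Subtype.val, continuous_subtype_val⟩ x (relBoundary n A x p) = piBase n (x : X) := by
  induction p using Quotient.inductionOn with
  | _ p =>
  refine Quotient.sound (GenLoop.Homotopic.symm ?_)
  refine ⟨⟨⟨⟨fun q => p.1 (Fin.cons q.1 q.2), p.1.continuous.comp
    (continuous_fin_cons.comp (continuous_snd.prodMk continuous_fst))⟩, fun c => ?_, fun c => ?_⟩,
    fun s c hc => ?_⟩⟩
  · exact p.2.2 _ (Or.inl (by simp))
  · rfl
  · obtain ⟨i, hi⟩ := hc
    exact p.2.2 _ (Or.inr ⟨i, by simpa using hi⟩)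

end Pair

/-! ### Relative loops of the pair `(X, F)` and their images in the base. -/

section FibreSequence

variable {X : Type u} {Y : Type v} [TopologicalSpace X] [TopologicalSpace Y]
  (f : C(X, Y)) (x : X)

theorem mem_fibre_self : x ∈ Fibre f x := rfl

/-- The product of homotopy classes runs its right factor first, hence the order. -/
theorem relMap_prepend {n : ℕ} (a : GenLoop (Fin (n + 1)) X x) (p : RelLoop n (Fibre f x) x) :
    relMap f x n (Quotient.mk _ (RelLoop.prepend a p)) =
      relMap f x n (Quotient.mk _ p) * piMap (n + 1) f x (Quotient.mk _ a) := by
  refine Eq.trans ?_ (HomotopyGroup.mul_spec (i := (0 : Fin (n + 1)))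
    (p := relMapLoop f x n p) (q := loopMap (n + 1) f x a)).symm
  refine congrArg (Quotient.mk _) (Subtype.ext (ContinuousMap.ext fun t => ?_))
  change f (ite _ _ _) = ite _ _ _
  rw [apply_ite f]
  rfl

theorem relMap_ofGenLoop {n : ℕ} (a : GenLoop (Fin (n + 1)) X x) :
    relMap f x n (Quotient.mk _ (RelLoop.ofGenLoop (mem_fibre_self f x) a)) =
      piMap (n + 1) f x (Quotient.mk _ a) := rfl

theorem relBdry_ofGenLoop {n : ℕ} (a : GenLoop (Fin (n + 1)) X x) :
    relBdry f x n (Quotient.mk _ (RelLoop.ofGenLoop (mem_fibre_self f x) a)) =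
      piBase n (fibrePt f x) := by
  refine congrArg (Quotient.mk _) (Subtype.ext (ContinuousMap.ext fun t => Subtype.ext ?_))
  exact a.2 _ (faceMap_mem_boundary n t)

theorem exists_piMap_eq_of_relBdry_eq {n : ℕ} (p : RelPi n (Fibre f x) x)
    (h : relBdry f x n p = piBase n (fibrePt f x)) :
    ∃ a : GenLoop (Fin (n + 1)) X x,
      p = Quotient.mk _ (RelLoop.ofGenLoop (mem_fibre_self f x) a) := by
  induction p using Quotient.inductionOn with
  | _ p => exact exists_genLoop_of_relBoundary_eq (x := fibrePt f x) p h

theorem mul_compat {n : ℕ} {A : Set X} (p q : RelLoop (n + 1) A x) (t : Fin (n + 2) → I) :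
    p.1 (Function.update t 1 1) = q.1 (Function.update t 1 0) := by
  rw [p.2.2 _ (Or.inr ⟨0, Or.inr (by simp)⟩), q.2.2 _ (Or.inr ⟨0, Or.inl (by simp)⟩)]

/-- Relative loops of dimension at least two can be multiplied. -/
theorem exists_relPi_mul {n : ℕ} (p q : RelPi (n + 1) (Fibre f x) x) :
    ∃ r, relMap f x (n + 1) r = relMap f x (n + 1) p * relMap f x (n + 1) q ∧
      relBdry f x (n + 1) r = relBdry f x (n + 1) p * relBdry f x (n + 1) q := by
  induction p using Quotient.inductionOn with
  | _ p =>
  induction q using Quotient.inductionOn with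
  | _ q =>
  have zero_ne : (0 : Fin (n + 2)) ≠ 1 := by simp
  have up0 : ∀ (t : Fin (n + 2) → I) s, Function.update t 1 s 0 = t 0 := fun t s => by
    rw [Function.update_of_ne zero_ne]
  have side : ∀ t : Fin (n + 2) → I, (t 0 = 0 ∨ ∃ i : Fin (n + 1), t i.succ = 0 ∨ t i.succ = 1) →
      concatAt 1 q.1 p.1 (mul_compat x q p) t = x := by
    rintro t (h | ⟨i, hi⟩)
    · exact concatAt_eq_of_forall (S := {x}) (fun s => q.2.2 _ (Or.inl (by rw [up0, h])))
        (fun s => p.2.2 _ (Or.inl (by rw [up0, h])))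
    · by_cases h0 : i = 0
      · subst h0
        rcases hi with hi | hi
        · have hi' : t 1 = 0 := hi
          rw [concatAt_of_eq_zero hi']; exact q.2.2 _ (Or.inr ⟨0, Or.inl hi⟩)
        · have hi' : t 1 = 1 := hi
          rw [concatAt_of_eq_one hi']; exact p.2.2 _ (Or.inr ⟨0, Or.inr hi⟩)
      · have hne : i.succ ≠ 1 := fun h => h0 (Fin.succ_injective _ h)
        refine concatAt_eq_of_forall (S := {x}) (fun s => ?_) (fun s => ?_)
        · exact q.2.2 _ (Or.inr ⟨i, by rwa [Function.update_of_ne hne]⟩)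
        · exact p.2.2 _ (Or.inr ⟨i, by rwa [Function.update_of_ne hne]⟩)
  -- The homotopy group product can be computed by concatenation in any direction. Direction `1`
  -- exists from dimension two on and survives on the face `t 0 = 1`, where it becomes direction
  -- `0`; so one concatenation computes both products.
  let r : RelLoop (n + 1) (Fibre f x) x := ⟨concatAt 1 q.1 p.1 (mul_compat x q p), by
    refine ⟨fun t ht => ?_, side⟩
    rcases mem_boundary_succ.1 ht with (h | h) | h
    · rw [side t (Or.inl h)]; exact mem_fibre_self f x
    · exact concatAt_eq_of_forall (fun s => q.2.1 _ ⟨0, Or.inr (by rw [up0, h])⟩)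
        (fun s => p.2.1 _ ⟨0, Or.inr (by rw [up0, h])⟩)
    · rw [side t (Or.inr h)]; exact mem_fibre_self f x⟩
  refine ⟨Quotient.mk _ r, ?_, ?_⟩
  · refine Eq.trans ?_ (HomotopyGroup.mul_spec (i := (1 : Fin (n + 2)))
      (p := relMapLoop f x (n + 1) p) (q := relMapLoop f x (n + 1) q)).symm
    refine congrArg (Quotient.mk _) (Subtype.ext (ContinuousMap.ext fun t => ?_))
    change f (ite _ _ _) = ite _ _ _
    rw [apply_ite f]
    rfl
  · refine Eq.trans ?_ (HomotopyGroup.mul_spec (i := (0 : Fin (n + 1)))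
      (p := relBoundaryLoop (n + 1) (Fibre f x) (fibrePt f x) p)
      (q := relBoundaryLoop (n + 1) (Fibre f x) (fibrePt f x) q)).symm
    refine congrArg (Quotient.mk _) (Subtype.ext (ContinuousMap.ext fun t => Subtype.ext ?_))
    have key : ∀ s, Function.update (faceMap (n + 1) t) 1 s =
        faceMap (n + 1) (Function.update t 0 s) := fun s => by
      simp only [faceMap, ContinuousMap.coe_mk, Fin.cons_update]
      rfl
    change ite _ _ _ = Subtype.val (ite _ _ _)
    rw [apply_ite Subtype.val, key, key]
    rfl

/-- A path from `x` into the fibre, as a relative loop. -/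
def RelLoop.ofPath {z : X} (w : Path x z) (hz : f z = f x) : RelLoop 0 (Fibre f x) x :=
  ⟨⟨fun t => w (t 0), by fun_prop⟩, by
    constructor
    · intro t ht
      rcases mem_boundary_succ.1 ht with (h | h) | ⟨i, -⟩
      · simp [h]
      · simp [h, hz]
      · exact i.elim0
    · rintro t (h | ⟨i, -⟩)
      · simp [h]
      · exact i.elim0⟩

theorem relMap_ofPath_congr {z : X} {w w' : Path x z} (hz : f z = f x) (h : w.Homotopic w') :
    relMap f x 0 (Quotient.mk _ (RelLoop.ofPath f x w hz)) =
      relMap f x 0 (Quotient.mk _ (RelLoop.ofPath f x w' hz)) := by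
  obtain ⟨H⟩ := h
  refine Quotient.sound ⟨⟨⟨⟨fun q => f (H (q.1, q.2 0)), by fun_prop⟩, fun t => ?_, fun t => ?_⟩,
    fun s t ht => ?_⟩⟩
  · exact congrArg f (H.apply_zero _)
  · exact congrArg f (H.apply_one _)
  · change f (H (s, t 0)) = f (w (t 0))
    rcases mem_boundary_succ.1 ht with (h | h) | ⟨i, -⟩
    · simp [h]
    · simp [h]
    · exact i.elim0

/-- The added path is constant after applying `f`, so it can be cut off gradually, by running
`w.trans r` only up to `(1 + s) / 2`. -/
theorem relMap_ofPath_trans {z z' : X} (w : Path x z) (r : Path z z') (hz : f z = f x)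
    (hr : ∀ t, f (r t) = f x) :
    relMap f x 0 (Quotient.mk _ (RelLoop.ofPath f x (w.trans r) (by simpa using hr 1))) =
      relMap f x 0 (Quotient.mk _ (RelLoop.ofPath f x w hz)) := by
  refine Quotient.sound (GenLoop.Homotopic.symm ⟨⟨⟨⟨fun q => f ((w.trans r).extend
    ((q.2 0 : ℝ) * (1 + q.1) / 2)), ?_⟩, fun t => ?_, fun t => ?_⟩, fun s t ht => ?_⟩⟩)
  · exact f.continuous.comp ((w.trans r).continuous_extend.comp (by fun_prop))
  · change f ((w.trans r).extend ((t 0 : ℝ) * (1 + ((0 : I) : ℝ)) / 2)) = f (w (t 0))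
    have h0 := (t 0).2.1
    have h1 := (t 0).2.2
    rw [Icc.coe_zero, add_zero, mul_one, Path.extend_apply _ ⟨by linarith, by linarith⟩,
      Path.trans_apply]
    have h2 : ((⟨(t 0 : ℝ) / 2, ⟨by linarith, by linarith⟩⟩ : I) : ℝ) ≤ 1 / 2 := by
      simp only; linarith
    rw [dif_pos h2]
    congr 2
    apply Subtype.ext
    simp only; ring
  · change f ((w.trans r).extend ((t 0 : ℝ) * (1 + ((1 : I) : ℝ)) / 2)) = f ((w.trans r) (t 0))
    rw [← Path.extend_apply (w.trans r) (t 0).2]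
    congr 2
    rw [Icc.coe_one]; ring
  · change f ((w.trans r).extend ((t 0 : ℝ) * (1 + (s : ℝ)) / 2)) = f (w (t 0))
    rcases mem_boundary_succ.1 ht with (h | h) | ⟨i, -⟩
    · simp [h]
    · have h0 := s.2.1
      have h1 := s.2.2
      rw [h, w.target, hz, Icc.coe_one, one_mul, Path.extend_apply _ ⟨by linarith, by linarith⟩,
        Path.trans_apply]
      split_ifs with h2
      · simp only at h2
        have h3 : (s : ℝ) = 0 := by linarith
        have : (⟨2 * ((1 + (s : ℝ)) / 2), ⟨by linarith, by linarith⟩⟩ : I) = 1 := by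
          apply Subtype.ext; simp only [h3]; norm_num
        rw [← hz, this, w.target]
      · exact hr _
    · exact i.elim0

/-- Two relative loops of dimension one whose end points lie in the same path component of the
fibre differ by an absolute loop. -/
theorem exists_mul_eq_of_relBdry_eq (p q : RelPi 0 (Fibre f x) x)
    (h : relBdry f x 0 p = relBdry f x 0 q) :
    ∃ a : π_ 1 X x, relMap f x 0 q = relMap f x 0 p * piMap 1 f x a := by
  induction p using Quotient.inductionOn with
  | _ p =>
  induction q using Quotient.inductionOn with
  | _ q =>
  obtain ⟨G⟩ : (relBoundaryLoop 0 (Fibre f x) (fibrePt f x) q).1.HomotopicRel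
    (relBoundaryLoop 0 (Fibre f x) (fibrePt f x) p).1 (Cube.boundary (Fin 0)) := Quotient.exact h.symm
  have hc : ∀ s : Fin 1 → I, (fun _ => s 0) = s := fun s => funext fun i => by
    rw [Subsingleton.elim i 0]
  have topath : ∀ p : RelLoop 0 (Fibre f x) x, ∃ w : Path x (p.1 fun _ => 1),
      ∀ t, w t = p.1 fun _ => t := fun p =>
    ⟨⟨⟨fun t => p.1 fun _ => t, by fun_prop⟩, p.2.2 _ (Or.inl rfl), rfl⟩, fun t => rfl⟩
  obtain ⟨P, hP⟩ := topath p
  obtain ⟨Q, hQ⟩ := topath q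
  have hzp : f (p.1 fun _ => 1) = f x := p.2.1 _ ⟨0, Or.inr rfl⟩
  have hzq : f (q.1 fun _ => 1) = f x := q.2.1 _ ⟨0, Or.inr rfl⟩
  have face1 : faceMap 0 Fin.elim0 = fun _ => (1 : I) := funext fun i =>
    Fin.cases rfl (fun j => j.elim0) i
  have hG0 : ((G (0, Fin.elim0) : Fibre f x) : X) = q.1 fun _ => 1 := by
    rw [G.apply_zero, ← face1]; rfl
  have hG1 : ((G (1, Fin.elim0) : Fibre f x) : X) = p.1 fun _ => 1 := by
    rw [G.apply_one, ← face1]; rfl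
  let W : Path (q.1 fun _ => 1) (p.1 fun _ => 1) :=
    { toFun := fun t => (G (t, Fin.elim0) : Fibre f x)
      continuous_toFun := by fun_prop
      source' := hG0
      target' := hG1 }
  have hW : ∀ t, f (W t) = f x := fun t => (G (t, Fin.elim0)).2
  have eP : RelLoop.ofPath f x P hzp = p := Subtype.ext (ContinuousMap.ext fun t => by
    change P (t 0) = p.1 t
    rw [hP, hc])
  have eQ : RelLoop.ofPath f x Q hzq = q := Subtype.ext (ContinuousMap.ext fun t => by
    change Q (t 0) = q.1 t
    rw [hQ, hc])
  -- With `W` in the fibre from the end of `Q` to the end of `P`, the loop `a` satisfies `a · P ≃ Q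
  -- · W`. In the base `W` is constant, so this has the same class as `Q`.
  let a : Path x x := (Q.trans W).trans P.symm
  let a' : GenLoop (Fin 1) X x := ⟨⟨fun t => a (t 0), by fun_prop⟩, by
    rintro t ⟨i, hi⟩
    rw [Subsingleton.elim i 0] at hi
    rcases hi with hi | hi <;> simp [hi]⟩
  refine ⟨Quotient.mk _ a', ?_⟩
  have e : RelLoop.prepend a' (RelLoop.ofPath f x P hzp) = RelLoop.ofPath f x (a.trans P) hzp := by
    refine Subtype.ext (ContinuousMap.ext fun t => ?_)
    change ite _ _ _ = a.trans P (t 0)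
    rw [Path.trans_apply]
    split_ifs with h1
    · change a (Function.update t 0 _ 0) = a _
      rw [Function.update_self, projIcc_of_mem]
    · change P (Function.update t 0 _ 0) = P _
      rw [Function.update_self, projIcc_of_mem]
  rw [← eP, ← relMap_prepend, e, ← eQ, ← relMap_ofPath_trans f x Q W hzq hW]
  refine relMap_ofPath_congr f x hzp ?_
  have h1 : (((Q.trans W).trans P.symm).trans P).Homotopic
      ((Q.trans W).trans (P.symm.trans P)) := ⟨Path.Homotopy.transAssoc _ _ _⟩
  have h2 : ((Q.trans W).trans (P.symm.trans P)).Homotopic ((Q.trans W).trans (Path.refl _)) :=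
    Path.Homotopic.hcomp (Path.Homotopic.refl _) ⟨(Path.Homotopy.reflSymmTrans P).symm⟩
  have h3 : ((Q.trans W).trans (Path.refl _)).Homotopic (Q.trans W) :=
    ⟨Path.Homotopy.transRefl _⟩
  exact ((h1.trans h2).trans h3).symm

end FibreSequence

/-! ### Connecting maps and relative homotopy groups. -/

section Connecting

variable {X : Type u} {Y : Type v} [TopologicalSpace X] [TopologicalSpace Y]
  {f : C(X, Y)} {x : X}

theorem relBdry_one (n : ℕ) :
    relBdry f x n (Quotient.mk _ (RelLoop.ofGenLoop (mem_fibre_self f x) GenLoop.const)) =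
      piBase n (fibrePt f x) := relBdry_ofGenLoop f x _

/-- The connecting maps exist if `f` induces suitable maps on relative homotopy groups. -/
theorem exists_isConnecting (hf : Function.Surjective f)
    (hsurj : ∀ n, Function.Surjective (relMap f x n))
    (hinj : ∀ n p q, relMap f x n p = relMap f x n q → relBdry f x n p = relBdry f x n q)
    (htot : ∀ n (b : π_ n X x), piMap n f x b = piBase n (f x) → b ∈ range (inclStar f x n)) :
    ∃ d : ∀ n : ℕ, π_ (n + 1) Y (f x) → π_ n (Fibre f x) (fibrePt f x),
      IsConnecting f x d ∧ ∀ n p, d n (relMap f x n p) = relBdry f x n p := by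
  choose s hs using hsurj
  -- This is `∂ = ∂_* ∘ f_*⁻¹`; by `hinj` the value does not depend on the chosen preimage.
  let d : ∀ n : ℕ, π_ (n + 1) Y (f x) → π_ n (Fibre f x) (fibrePt f x) := fun n c =>
    relBdry f x n (s n c)
  have hd : ∀ n p, d n (relMap f x n p) = relBdry f x n p := fun n p => hinj n _ _ (hs n _)
  refine ⟨d, ⟨?_, ?_, ?_, ?_, ?_, ?_, ?_⟩, hd⟩
  · exact (hd 0 _).trans (relBdry_one 0)
  · intro n a b
    obtain ⟨p, rfl⟩ : ∃ p, relMap f x (n + 1) p = a := ⟨_, hs _ a⟩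
    obtain ⟨q, rfl⟩ : ∃ q, relMap f x (n + 1) q = b := ⟨_, hs _ b⟩
    obtain ⟨r, h1, h2⟩ := exists_relPi_mul f x p q
    rw [hd, hd, ← h2, ← hd, h1]
  · intro n b
    refine ⟨htot n b, ?_⟩
    rintro ⟨c, rfl⟩
    induction c using Quotient.inductionOn with
    | _ c =>
    refine congrArg (Quotient.mk _) (Subtype.ext (ContinuousMap.ext fun t => ?_))
    exact (c.1 t).2
  · intro n c
    obtain ⟨p, rfl⟩ : ∃ p, relMap f x n p = c := ⟨_, hs _ c⟩
    rw [hd]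
    constructor
    · intro h
      obtain ⟨a, rfl⟩ := exists_piMap_eq_of_relBdry_eq f x p h
      exact ⟨Quotient.mk _ a, (relMap_ofGenLoop f x a).symm⟩
    · rintro ⟨a, ha⟩
      induction a using Quotient.inductionOn with
      | _ a => 
        rw [← relMap_ofGenLoop] at ha
        exact (hinj n _ _ ha).symm.trans (relBdry_ofGenLoop f x a)
  · intro n b
    constructor
    · intro h
      obtain ⟨p, hp⟩ := exists_relBoundary_eq (A := Fibre f x) (x := fibrePt f x) b h
      exact ⟨relMap f x n p, (hd n p).trans hp⟩
    · rintro ⟨c, rfl⟩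
      exact piMap_relBoundary (A := Fibre f x) (x := fibrePt f x) (s n c)
  · intro c
    induction c using Quotient.inductionOn with
    | _ c =>
    obtain ⟨z, hz⟩ := hf (c.1 Fin.elim0)
    refine ⟨Quotient.mk _ ⟨ContinuousMap.const _ z, fun t ⟨i, _⟩ => i.elim0⟩, ?_⟩
    refine congrArg (Quotient.mk _) (Subtype.ext (ContinuousMap.ext fun t => ?_))
    rw [Subsingleton.elim t Fin.elim0]
    exact hz
  · intro c c'
    obtain ⟨p, rfl⟩ : ∃ p, relMap f x 0 p = c := ⟨_, hs _ c⟩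
    obtain ⟨q, rfl⟩ : ∃ q, relMap f x 0 q = c' := ⟨_, hs _ c'⟩
    rw [hd, hd]
    constructor
    · exact exists_mul_eq_of_relBdry_eq f x p q
    · rintro ⟨a, ha⟩
      induction a using Quotient.inductionOn with
      | _ a =>
      induction p using Quotient.inductionOn with
      | _ p =>
      rw [← relMap_prepend] at ha
      rw [hinj 0 _ _ ha]
      exact (relBoundary_prepend (A := Fibre f x) (x := fibrePt f x) a p).symm

variable {d : ∀ n : ℕ, π_ (n + 1) Y (f x) → π_ n (Fibre f x) (fibrePt f x)}

theorem IsConnecting.map_one (h : IsConnecting f x d) (n : ℕ) :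
    d n 1 = piBase n (fibrePt f x) :=
  (h.exact_base n 1).2 ⟨piBase (n + 1) x, rfl⟩

/-- The class `∂ c` dies in `X`, so it is the boundary of some `p`. Then `f_* p` and `c` have the
same image under `∂` and differ by `f_* a` for an absolute `a`: in degree one by the coset
condition, above it because `∂` is a homomorphism. Prepending `a` to `p` corrects the difference. -/
theorem IsConnecting.relMap_surjective (h : IsConnecting f x d)
    (hd : ∀ n p, d n (relMap f x n p) = relBdry f x n p) (n : ℕ) :
    Function.Surjective (relMap f x n) := by
  intro c
  obtain ⟨p, hp⟩ := exists_relBoundary_eq (A := Fibre f x) (x := fibrePt f x) (d n c)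
    ((h.exact_fibre n _).2 ⟨c, rfl⟩)
  have hdp : d n (relMap f x n p) = d n c := (hd n p).trans hp
  obtain ⟨a, ha⟩ : ∃ a : π_ (n + 1) X x, c = relMap f x n p * piMap (n + 1) f x a := by
    cases n with
    | zero => exact (h.coset_one _ _).1 hdp
    | succ n =>
      have h1 : d (n + 1) ((relMap f x (n + 1) p)⁻¹ * c) = piBase (n + 1) (fibrePt f x) := by
        have h2 := h.map_mul n (relMap f x (n + 1) p) ((relMap f x (n + 1) p)⁻¹ * c)
        have h3 : relMap f x (n + 1) p * ((relMap f x (n + 1) p)⁻¹ * c) = c :=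
          mul_inv_cancel_left _ _
        rw [h3, hdp] at h2
        exact left_eq_mul.1 h2
      obtain ⟨a, ha⟩ := (h.exact_base _ _).1 h1
      refine ⟨a, ?_⟩
      rw [ha]
      exact (mul_inv_cancel_left _ _).symm
  induction p using Quotient.inductionOn with
  | _ p =>
  induction a using Quotient.inductionOn with
  | _ a => exact ⟨_, (relMap_prepend f x a p).trans ha.symm⟩

/-- Relative loops which become trivial in the base can be deformed into the fibre. -/
theorem IsConnecting.eq_of_relMap_eq_one (h : IsConnecting f x d)
    (hd : ∀ n p, d n (relMap f x n p) = relBdry f x n p) {n : ℕ} (p : RelPi n (Fibre f x) x)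
    (hp : relMap f x n p = 1) :
    ∃ b : GenLoop (Fin (n + 1)) (Fibre f x) (fibrePt f x),
      p = Quotient.mk _ (RelLoop.ofGenLoop (mem_fibre_self f x)
        (loopMap (n + 1) (fibreIncl f x) (fibrePt f x) b)) := by
  -- Since `∂_* p = ∂ (f_* p)` is trivial, `p` comes from an absolute class. Its image in the base
  -- is trivial, so exactness at `π_{n+1}(X)` moves it into the fibre.
  obtain ⟨a, rfl⟩ := exists_piMap_eq_of_relBdry_eq f x p (by rw [← hd, hp, h.map_one])
  rw [relMap_ofGenLoop] at hp
  obtain ⟨b, hb⟩ := (h.exact_total (n + 1) _).1 hp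
  induction b using Quotient.inductionOn with
  | _ b => exact ⟨b, RelPi.sound_of_homotopic (Quotient.exact hb.symm)⟩

end Connecting

/-! ### The lifting property over cubes. -/

section CubeForm

variable {X : Type u} {Y : Type v} [TopologicalSpace X] [TopologicalSpace Y] {ι : Type*} [Fintype ι]

/-- The cube `I^ι × I` as a half ball; the face `{t = 1}` becomes the flat part of the boundary. -/
def cubeToBall (q : (ι → I) × I) : (ι → ℝ) × ℝ := (fun i => 2 * (q.1 i : ℝ) - 1, 1 - (q.2 : ℝ))

/-- The half ball as a cube. -/
def ballToCube (z : (ι → ℝ) × ℝ) : (ι → I) × I :=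
  (fun i => projIcc 0 1 zero_le_one ((z.1 i + 1) / 2), projIcc 0 1 zero_le_one (1 - z.2))

theorem continuous_cubeToBall : Continuous (cubeToBall (ι := ι)) := by
  unfold cubeToBall; fun_prop

theorem continuous_ballToCube : Continuous (ballToCube (ι := ι)) := by
  unfold ballToCube; fun_prop

theorem ballToCube_cubeToBall (q : (ι → I) × I) : ballToCube (cubeToBall q) = q := by
  refine Prod.ext (funext fun i => ?_) ?_
  · simp only [ballToCube, cubeToBall]
    rw [show (2 * (q.1 i : ℝ) - 1 + 1) / 2 = q.1 i by ring, projIcc_val]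
  · simp only [ballToCube, cubeToBall]
    rw [show 1 - (1 - (q.2 : ℝ)) = q.2 by ring, projIcc_val]

theorem abs_two_mul_sub_one_le (s : I) : |2 * (s : ℝ) - 1| ≤ 1 := by
  have := s.2.1; have := s.2.2
  rw [abs_le]; constructor <;> linarith

theorem abs_two_mul_sub_one_eq {s : I} : |2 * (s : ℝ) - 1| = 1 ↔ s = 0 ∨ s = 1 := by
  rw [abs_eq zero_le_one, or_comm]
  refine or_congr ⟨fun h => Subtype.ext ?_, fun h => ?_⟩ ⟨fun h => Subtype.ext ?_, fun h => ?_⟩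
  · rw [Icc.coe_zero]; linarith
  · rw [h, Icc.coe_zero]; norm_num
  · rw [Icc.coe_one]; linarith
  · rw [h, Icc.coe_one]; norm_num

theorem cubeToBall_mem (q : (ι → I) × I) : cubeToBall q ∈ halfBall ι := by
  have := q.2.2.1; have := q.2.2.2
  refine mem_halfBall_iff.2 ⟨?_, ?_, ?_⟩
  · exact (pi_norm_le_iff_of_nonneg zero_le_one).2 fun i => abs_two_mul_sub_one_le _
  all_goals simp only [cubeToBall]; linarith

theorem cubeToBall_mem_hemisphere {q : (ι → I) × I} :
    cubeToBall q ∈ hemisphere ι ↔ q.2 = 0 ∨ q.1 ∈ Cube.boundary ι := by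
  rw [mem_hemisphere_iff (cubeToBall_mem q),
    norm_eq_one_iff (mem_halfBall_iff.1 (cubeToBall_mem q)).1, or_comm]
  refine or_congr ?_ (exists_congr fun i => abs_two_mul_sub_one_eq)
  simp only [cubeToBall, sub_eq_self]
  exact ⟨fun h => Subtype.ext h, fun h => by rw [h]; rfl⟩

theorem cubeToBall_ballToCube {z : (ι → ℝ) × ℝ} (hz : z ∈ halfBall ι) :
    cubeToBall (ballToCube z) = z := by
  obtain ⟨h1, h2, h3⟩ := mem_halfBall_iff.1 hz
  refine Prod.ext (funext fun i => ?_) ?_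
  · have h := abs_le.1 ((norm_le_pi_norm z.1 i).trans h1)
    simp only [ballToCube, cubeToBall]
    rw [projIcc_of_mem (zero_le_one) (⟨by linarith, by linarith⟩ : (z.1 i + 1) / 2 ∈ Icc (0 : ℝ) 1)]
    ring
  · simp only [ballToCube, cubeToBall]
    rw [projIcc_of_mem (zero_le_one) (⟨by linarith, by linarith⟩ : 1 - z.2 ∈ Icc (0 : ℝ) 1)]
    ring

/-- The lifting property for pairs, over a cube. -/
theorem PairLifting.exists_cube {f : C(X, Y)} {y₀ : Y} (H : PairLifting ι f univ {y₀})
    (x : (ι → I) × I → X) (y : C((ι → I) × I, Y))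
    (xc : ContinuousOn x {q | q.2 = 0 ∨ q.1 ∈ Cube.boundary ι})
    (hxy : ∀ q : (ι → I) × I, (q.2 = 0 ∨ q.1 ∈ Cube.boundary ι) → f (x q) = y q)
    (hy : ∀ c, y (c, 1) = y₀) :
    ∃ (x' : C((ι → I) × I, X)) (h : C(((ι → I) × I) × I, Y)),
      (∀ q : (ι → I) × I, (q.2 = 0 ∨ q.1 ∈ Cube.boundary ι) → x' q = x q) ∧
      (∀ q, h (q, 0) = f (x' q)) ∧ (∀ q, h (q, 1) = y q) ∧ (∀ c s, h ((c, 1), s) = y₀) ∧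
      ∀ q : (ι → I) × I, (q.2 = 0 ∨ q.1 ∈ Cube.boundary ι) → ∀ s, h (q, s) = y q := by
  have key : ∀ z ∈ hemisphere ι, ballToCube z ∈ {q : (ι → I) × I | q.2 = 0 ∨ q.1 ∈ Cube.boundary ι} :=
    fun z hz => cubeToBall_mem_hemisphere.1 (by
      rwa [cubeToBall_ballToCube (hemisphere_subset hz)])
  obtain ⟨x', h, x'c, hx', hc, h0, h1, -, hB, hr⟩ := H (x ∘ ballToCube) (y ∘ ballToCube)
    (xc.comp continuous_ballToCube.continuousOn key)
    (y.continuous.comp continuous_ballToCube).continuousOn (fun z hz => hxy _ (key z hz))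
    (fun _ _ => mem_univ _) (fun z hz h0 => by
      have : ballToCube z = ((ballToCube z).1, 1) := by
        refine Prod.ext rfl ?_
        simp only [ballToCube, h0, sub_zero, projIcc_right]
        rfl
      rw [Function.comp_apply, this, hy]
      rfl)
  refine ⟨⟨x' ∘ cubeToBall, x'c.comp_continuous continuous_cubeToBall cubeToBall_mem⟩,
    ⟨fun q => h (cubeToBall q.1, q.2), hc.comp_continuous
      ((continuous_cubeToBall.comp continuous_fst).prodMk continuous_snd)
      fun q => ⟨cubeToBall_mem q.1, mem_univ _⟩⟩, fun q hq => ?_, fun q => ?_, fun q => ?_,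
    fun c s => ?_, fun q hq s => ?_⟩
  · exact (hx' (cubeToBall_mem_hemisphere.2 hq)).trans (congrArg x (ballToCube_cubeToBall q))
  · exact h0 _ (cubeToBall_mem q)
  · exact (h1 _ (cubeToBall_mem q)).trans (congrArg y (ballToCube_cubeToBall q))
  · exact hB _ (cubeToBall_mem _) (by simp [cubeToBall]) s
  · exact (hr _ (cubeToBall_mem_hemisphere.2 hq) s).trans (congrArg y (ballToCube_cubeToBall q))

end CubeForm

/-! ### From the lifting property to connecting maps. -/

section Connecting

variable {X : Type u} {Y : Type v} [TopologicalSpace X] [TopologicalSpace Y] {f : C(X, Y)} {x : X}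

theorem boundary_isClosed {n : ℕ} : IsClosed (Cube.boundary (Fin n)) := by
  have : Cube.boundary (Fin n) = ⋃ i : Fin n, {t | t i = 0 ∨ t i = 1} := by
    ext t; simp [Cube.boundary]
  rw [this]
  refine isClosed_iUnion_of_finite fun i => ?_
  exact (isClosed_eq (continuous_apply i) continuous_const).union
    (isClosed_eq (continuous_apply i) continuous_const)

theorem cons_mem_boundary {n : ℕ} {c : Fin n → I} {t : I} :
    (Fin.cons t c : Fin (n + 1) → I) ∈ Cube.boundary (Fin (n + 1)) ↔
      (t = 0 ∨ t = 1) ∨ c ∈ Cube.boundary (Fin n) := by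
  rw [mem_boundary_succ]; simp

/-- A loop in the base is a lifting problem with constant lift on the hemisphere. On the flat face
the solution lies over `f x`, so it is a relative loop. -/
theorem PairLifting.relMap_surjective {n : ℕ} (H : PairLifting (Fin n) f univ {f x}) :
    Function.Surjective (relMap f x n) := by
  intro c
  induction c using Quotient.inductionOn with
  | _ c =>
  obtain ⟨x', h, hx', h0, h1, hB, hr⟩ := H.exists_cube (fun _ => x)
    ⟨fun q => c.1 (Fin.cons q.2 q.1), c.1.continuous.comp continuous_fin_cons⟩ continuousOn_const
    (fun q hq => (c.2 _ (cons_mem_boundary.2 (hq.imp Or.inl id))).symm)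
    (fun q => c.2 _ (cons_mem_boundary.2 (Or.inl (Or.inr rfl))))
  have hA : ∀ q, x' (q, 1) ∈ Fibre f x := fun q => by
    have := hB q 0
    rw [h0] at this
    exact this
  refine ⟨Quotient.mk _ (RelLoop.ofProd (mem_fibre_self f x) x' (fun q => hx' _ (Or.inl rfl))
    (fun q hq t => hx' _ (Or.inr hq)) hA), Quotient.sound ?_⟩
  refine ⟨⟨⟨⟨fun q => h ((Fin.tail q.2, q.2 0), q.1), h.continuous.comp
    (((continuous_fin_tail.comp continuous_snd).prodMk (by fun_prop)).prodMk continuous_fst)⟩,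
    fun t => h0 _, fun t => ?_⟩, fun s t ht => ?_⟩⟩
  · refine (h1 _).trans (congrArg c.1 ?_)
    exact Fin.cons_self_tail t
  · change h ((Fin.tail t, t 0), s) = f (x' (Fin.tail t, t 0))
    rcases mem_boundary_succ.1 ht with (k | k) | k
    · rw [← h0, hr _ (Or.inl k), hr _ (Or.inl k)]
    · rw [k, hB, hA]
    · rw [← h0, hr _ (Or.inr k), hr _ (Or.inr k)]

/-- A null-homotopy of the image is a lifting problem starting at `b`. Its solution deforms `b` into
the fibre, keeping the boundary fixed. -/
theorem PairLifting.mem_range_inclStar {n : ℕ} (H : PairLifting (Fin n) f univ {f x})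
    (b : π_ n X x) (hb : piMap n f x b = piBase n (f x)) : b ∈ range (inclStar f x n) := by
  induction b using Quotient.inductionOn with
  | _ b =>
  obtain ⟨G⟩ : (loopMap n f x b).1.HomotopicRel GenLoop.const.1 (Cube.boundary (Fin n)) :=
    Quotient.exact hb
  obtain ⟨x', h, hx', h0, h1, hB, hr⟩ := H.exists_cube (fun q => b.1 q.1)
    ⟨fun q => G (q.2, q.1), by fun_prop⟩ (by fun_prop)
    (fun q hq => by
      rcases hq with hq | hq
      · change _ = G (q.2, q.1)
        rw [hq, G.apply_zero]; rfl
      · exact (G.eq_fst q.2 hq).symm)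
    (fun c => G.apply_one c)
  have hA : ∀ q, x' (q, 1) ∈ Fibre f x := fun q => by
    have := hB q 0
    rw [h0] at this
    exact this
  refine ⟨Quotient.mk _ ⟨⟨fun c => ⟨x' (c, 1), hA c⟩, by fun_prop⟩, fun c hc => Subtype.ext ?_⟩,
    Quotient.sound (GenLoop.Homotopic.symm ⟨⟨⟨⟨fun q => x' (q.2, q.1), by fun_prop⟩, fun c => ?_,
      fun c => rfl⟩, fun s c hc => ?_⟩⟩)⟩
  · exact (hx' _ (Or.inr hc)).trans (b.2 c hc)
  · exact hx' _ (Or.inl rfl)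
  · exact hx' _ (Or.inr hc)

/-- The homotopy `G` between the images, of one dimension more, is lifted with `p` and `q`
prescribed at its two ends. The flat face of the lift is a homotopy in the fibre between the end
faces. -/
theorem PairLifting.relBdry_eq {n : ℕ} (H : PairLifting (Fin (n + 1)) f univ {f x})
    (p q : RelPi n (Fibre f x) x) (hpq : relMap f x n p = relMap f x n q) :
    relBdry f x n p = relBdry f x n q := by
  induction p using Quotient.inductionOn with
  | _ p =>
  induction q using Quotient.inductionOn with
  | _ q =>
  obtain ⟨G⟩ : (relMapLoop f x n p).1.HomotopicRel (relMapLoop f x n q).1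
    (Cube.boundary (Fin (n + 1))) := Quotient.exact hpq
  have cc : Continuous fun w : (Fin (n + 1) → I) × I => (Fin.cons w.2 (Fin.tail w.1) : Fin (n + 1) → I) :=
    continuous_fin_cons.comp ((continuous_fin_tail.comp continuous_fst).prodMk continuous_snd)
  -- The coordinate `w.1 0` is the time of the homotopy, and `w.2` is the first coordinate of the
  -- relative loops. This makes the face `w.2 = 1` the free one, where the values must land in the
  -- fibre.
  let A : Set ((Fin (n + 1) → I) × I) := {w | w.1 0 = 0}
  let B : Set ((Fin (n + 1) → I) × I) :=
    {w | w.1 0 = 1 ∨ w.2 = 0 ∨ Fin.tail w.1 ∈ Cube.boundary (Fin n)}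
  have Aclosed : IsClosed A := isClosed_eq (by fun_prop) continuous_const
  have Bclosed : IsClosed B := (isClosed_eq (by fun_prop) continuous_const).union
    ((isClosed_eq continuous_snd continuous_const).union
      (boundary_isClosed.preimage (continuous_fin_tail.comp continuous_fst)))
  have base : ∀ (p : RelLoop n (Fibre f x) x) (w : (Fin (n + 1) → I) × I),
      (w.2 = 0 ∨ Fin.tail w.1 ∈ Cube.boundary (Fin n)) → p.1 (Fin.cons w.2 (Fin.tail w.1)) = x :=
    fun p w hw => p.2.2 _ (hw.imp id fun k => k)
  obtain ⟨x₁, x₁c, xA, xB⟩ := exists_continuousOn_glue Aclosed Bclosed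
    (f := fun w => p.1 (Fin.cons w.2 (Fin.tail w.1)))
    (g := fun w => q.1 (Fin.cons w.2 (Fin.tail w.1)))
    (p.1.continuous.comp cc).continuousOn (q.1.continuous.comp cc).continuousOn (by
      rintro w ⟨h0, h1⟩
      rcases h1 with h1 | h1
      · exact absurd (h0.symm.trans h1) zero_ne_one
      · exact (base p w h1).trans (base q w h1).symm)
  have xbase : ∀ w : (Fin (n + 1) → I) × I,
      (w.2 = 0 ∨ Fin.tail w.1 ∈ Cube.boundary (Fin n)) → x₁ w = x := fun w hw =>
    (xB (Or.inr hw)).trans (base q w hw)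
  have split : ∀ w : (Fin (n + 1) → I) × I, (w.2 = 0 ∨ w.1 ∈ Cube.boundary (Fin (n + 1))) →
      w.1 0 = 0 ∨ w.1 0 = 1 ∨ (w.2 = 0 ∨ Fin.tail w.1 ∈ Cube.boundary (Fin n)) := by
    rintro w (h | h)
    · exact Or.inr (Or.inr (Or.inl h))
    · rcases mem_boundary_succ.1 h with (h | h) | h
      exacts [Or.inl h, Or.inr (Or.inl h), Or.inr (Or.inr (Or.inr h))]
  obtain ⟨x', h, hx', h0, h1, hB, hr⟩ := H.exists_cube x₁
    ⟨fun w => G (w.1 0, Fin.cons w.2 (Fin.tail w.1)),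
      G.continuous.comp ((by fun_prop : Continuous _).prodMk cc)⟩
    (x₁c.mono fun w hw => (split w hw).imp id id)
    (fun w hw => by
      change _ = G _
      rcases split w hw with k | k | k
      · rw [xA k, k, G.apply_zero]; rfl
      · rw [xB (Or.inl k), k, G.apply_one]; rfl
      · rw [xbase w k, G.eq_fst _ (cons_mem_boundary.2 (k.imp Or.inl id))]
        exact (congrArg f (base p w k)).symm)
    (fun c => by
      change G _ = _
      rw [G.eq_fst _ (cons_mem_boundary.2 (Or.inl (Or.inr rfl)))]
      exact (relMapLoop f x n p).2 _ (cons_mem_boundary.2 (Or.inl (Or.inr rfl))))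
  have hA : ∀ c, x' (c, 1) ∈ Fibre f x := fun c => by
    have := hB c 0
    rw [h0] at this
    exact this
  refine Quotient.sound ⟨⟨⟨⟨fun w => ⟨x' (Fin.cons w.1 w.2, 1), hA _⟩, ?_⟩, fun c => ?_, fun c => ?_⟩,
    fun s c hc => ?_⟩⟩
  · exact (x'.continuous.comp ((continuous_fin_cons.comp (continuous_snd.prodMk
      continuous_fst)).prodMk continuous_const)).subtype_mk _
  · refine Subtype.ext ((hx' (Fin.cons 0 c, 1) (Or.inr ?_)).trans ?_)
    · exact cons_mem_boundary.2 (Or.inl (Or.inl rfl))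
    · exact xA (x := (Fin.cons 0 c, 1)) rfl
  · refine Subtype.ext ((hx' (Fin.cons 1 c, 1) (Or.inr ?_)).trans ?_)
    · exact cons_mem_boundary.2 (Or.inl (Or.inr rfl))
    · exact xB (x := (Fin.cons 1 c, 1)) (Or.inl rfl)
  · refine Subtype.ext ((hx' (Fin.cons s c, 1) (Or.inr ?_)).trans ?_)
    · exact cons_mem_boundary.2 (Or.inr hc)
    · refine (xbase (Fin.cons s c, 1) (Or.inr hc)).trans ?_
      exact (base p (Fin.cons s c, 1) (Or.inr hc)).symm

/-- A map with the lifting property for the pair consisting of the base and a point has connecting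
maps at the points of the fibre. -/
theorem PairLifting.exists_isConnecting (hf : Function.Surjective f)
    (H : ∀ n : ℕ, PairLifting (Fin n) f univ {f x}) :
    ∃ d : ∀ n : ℕ, π_ (n + 1) Y (f x) → π_ n (Fibre f x) (fibrePt f x),
      IsConnecting f x d ∧ ∀ n p, d n (relMap f x n p) = relBdry f x n p :=
  CQuasi.exists_isConnecting hf (fun n => (H n).relMap_surjective)
    (fun n => (H (n + 1)).relBdry_eq) (fun n => (H n).mem_range_inclStar)

end Connecting

/-! ### Collapsing all faces of a cube but one. -/

section Collapse

/-- A deformation of the half ball through maps preserving its boundary, at the end of which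
the hemisphere is collapsed to a point. -/
def collapseMap {ι : Type*} [Fintype ι] (q : I × ((ι → ℝ) × ℝ)) : (ι → ℝ) × ℝ :=
  -- The half ball is expanded by the factor `1 + r`. What would leave it is placed on the
  -- hemisphere and slides towards the pole `(0, 1)`: its dome parameter is multiplied by `2 - (1 +
  -- r) * ‖z‖`, which runs from one to zero. The maximum with `1 / 2` only keeps the inverse
  -- continuous; in this branch `‖z‖ ≥ 1 / 2` anyway.
  if (1 + (q.1 : ℝ)) * ‖q.2‖ ≤ 1 then (1 + (q.1 : ℝ)) • q.2
  else domeMap (((2 - (1 + (q.1 : ℝ)) * ‖q.2‖) *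
    (1 - ((max (1 / 2) ‖q.2‖)⁻¹ * q.2.2) / 2)) • (max (1 / 2) ‖q.2‖)⁻¹ • q.2.1)

variable {ι : Type*} [Fintype ι]

/-- The factor `1 - z.2 / 2` inverts the dome: it is `1 / 2` on the top face, and on the sides it is
the norm at which the dome has height `z.2`. -/
theorem domeMap_of_mem_hemisphere {z : (ι → ℝ) × ℝ} (hz : z ∈ hemisphere ι) :
    domeMap ((1 - z.2 / 2) • z.1) = z := by
  obtain ⟨h1, h2, h3⟩ := mem_halfBall_iff.1 (hemisphere_subset hz)
  have hp : 0 ≤ 1 - z.2 / 2 := by linarith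
  have hn : ‖(1 - z.2 / 2) • z.1‖ = (1 - z.2 / 2) * ‖z.1‖ := by
    rw [norm_smul, Real.norm_of_nonneg hp]
  rcases (mem_hemisphere_iff (hemisphere_subset hz)).1 hz with h | h
  · rw [h, mul_one] at hn
    simp only [domeMap, hn]
    refine Prod.ext ?_ ?_
    · simp only
      rw [max_eq_right (by linarith), smul_smul, inv_mul_cancel₀ (by linarith), one_smul]
    · simp only
      rw [min_eq_right (by linarith)]; ring
  · rw [h] at hn
    simp only [domeMap, hn, h]
    refine Prod.ext ?_ ?_
    · simp only
      rw [max_eq_left (by linarith), smul_smul]; norm_num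
    · simp only
      rw [min_eq_left (by linarith), h]

theorem unit_mem_hemisphere {z : (ι → ℝ) × ℝ} (hz : z ∈ halfBall ι) (h : 1 / 2 ≤ ‖z‖) :
    (max (1 / 2) ‖z‖)⁻¹ • z ∈ hemisphere ι := by
  have h0 : 0 < ‖z‖ := by linarith
  rw [max_eq_right h]
  refine ⟨?_, ?_⟩
  · rw [norm_smul, norm_inv, norm_norm, inv_mul_cancel₀ h0.ne']
  · exact mul_nonneg (inv_nonneg.2 h0.le) hz.2

theorem half_le_norm {r : I} {z : (ι → ℝ) × ℝ} (h : 1 ≤ (1 + (r : ℝ)) * ‖z‖) : 1 / 2 ≤ ‖z‖ := by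
  have := r.2.2
  nlinarith [norm_nonneg z]

theorem continuousOn_collapseMap :
    ContinuousOn (collapseMap (ι := ι)) (univ ×ˢ halfBall ι) := by
  have hm : Continuous fun q : I × ((ι → ℝ) × ℝ) => (max (1 / 2) ‖q.2‖)⁻¹ :=
    Continuous.inv₀ (by fun_prop) fun p => (lt_max_of_lt_left (by norm_num)).ne'
  have c2 : Continuous fun q : I × ((ι → ℝ) × ℝ) =>
      domeMap (((2 - (1 + (q.1 : ℝ)) * ‖q.2‖) *
        (1 - ((max (1 / 2) ‖q.2‖)⁻¹ * q.2.2) / 2)) • (max (1 / 2) ‖q.2‖)⁻¹ • q.2.1) :=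
    continuous_domeMap.comp (by fun_prop)
  have hA : IsClosed {q : I × ((ι → ℝ) × ℝ) | q.2 ∈ halfBall ι ∧ (1 + (q.1 : ℝ)) * ‖q.2‖ ≤ 1} :=
    ((isClosed_halfBall ι).preimage continuous_snd).inter
      (isClosed_le (f := fun q : I × ((ι → ℝ) × ℝ) => (1 + (q.1 : ℝ)) * ‖q.2‖)
        (by fun_prop) continuous_const)
  have hB : IsClosed {q : I × ((ι → ℝ) × ℝ) | q.2 ∈ halfBall ι ∧ 1 ≤ (1 + (q.1 : ℝ)) * ‖q.2‖} :=
    ((isClosed_halfBall ι).preimage continuous_snd).inter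
      (isClosed_le (g := fun q : I × ((ι → ℝ) × ℝ) => (1 + (q.1 : ℝ)) * ‖q.2‖)
        continuous_const (by fun_prop))
  have c1 : Continuous fun q : I × ((ι → ℝ) × ℝ) => (1 + (q.1 : ℝ)) • q.2 := by fun_prop
  refine ((c1.continuousOn.congr ?_).union_of_isClosed (c2.continuousOn.congr ?_) hA hB).mono ?_
  · exact fun q hq => if_pos hq.2
  · intro q hq
    rcases hq.2.eq_or_lt with h | h
    · have hmem := unit_mem_hemisphere hq.1 (half_le_norm hq.2)
      have hd := domeMap_of_mem_hemisphere hmem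
      have h0 : 0 < ‖q.2‖ := by have := half_le_norm hq.2; linarith
      simp only [collapseMap, ← h, le_refl, if_true]
      norm_num
      norm_num at hd
      rw [hd, max_eq_right (by have := half_le_norm hq.2; norm_num at this; linarith)]
      congr 1
      exact eq_inv_of_mul_eq_one_left h.symm
    · exact if_neg (not_le.2 h)
  · intro q hq
    rcases le_total ((1 + (q.1 : ℝ)) * ‖q.2‖) 1 with h | h
    exacts [Or.inl ⟨hq.2, h⟩, Or.inr ⟨hq.2, h⟩]

theorem norm_smul_smul_le {q : I × ((ι → ℝ) × ℝ)} (hq : q.2 ∈ halfBall ι)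
    (h : 1 ≤ (1 + (q.1 : ℝ)) * ‖q.2‖) :
    ‖((2 - (1 + (q.1 : ℝ)) * ‖q.2‖) *
      (1 - ((max (1 / 2) ‖q.2‖)⁻¹ * q.2.2) / 2)) • (max (1 / 2) ‖q.2‖)⁻¹ • q.2.1‖ ≤ 1 := by
  obtain ⟨h1, h2, h3⟩ := mem_halfBall_iff.1
    (hemisphere_subset (unit_mem_hemisphere hq (half_le_norm h)))
  simp only [Prod.smul_fst, Prod.smul_snd, smul_eq_mul] at h1 h2 h3
  have := q.1.2.2
  have := hq.1
  have k : (1 + (q.1 : ℝ)) * ‖q.2‖ ≤ 2 := by nlinarith [norm_nonneg q.2, q.1.2.1]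
  rw [norm_smul, Real.norm_of_nonneg (mul_nonneg (by linarith) (by linarith))]
  exact mul_le_one₀ (mul_le_one₀ (by linarith) (by linarith) (by linarith)) (norm_nonneg _) h1

theorem collapseMap_mem {q : I × ((ι → ℝ) × ℝ)} (hq : q.2 ∈ halfBall ι) :
    collapseMap q ∈ halfBall ι := by
  unfold collapseMap
  have h0 := q.1.2.1
  split_ifs with h
  · refine ⟨?_, ?_⟩
    · rwa [norm_smul, Real.norm_of_nonneg (by linarith)]
    · exact mul_nonneg (by linarith) hq.2
  · exact hemisphere_subset (domeMap_mem_hemisphere (norm_smul_smul_le hq (not_le.1 h).le))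

theorem collapseMap_zero {z : (ι → ℝ) × ℝ} (hz : z ∈ halfBall ι) : collapseMap (0, z) = z := by
  have : ‖z‖ ≤ 1 := hz.1
  simp [collapseMap, this]

theorem collapseMap_one {z : (ι → ℝ) × ℝ} (hz : z ∈ hemisphere ι) :
    collapseMap (1, z) = (0, 1) := by
  have : ‖z‖ = 1 := hz.1
  simp only [collapseMap, this, Icc.coe_one]
  norm_num [domeMap]

theorem collapseMap_boundary {q : I × ((ι → ℝ) × ℝ)} (hq : q.2 ∈ halfBall ι)
    (h : q.2 ∈ hemisphere ι ∨ q.2.2 = 0) :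
    collapseMap q ∈ hemisphere ι ∨ (collapseMap q).2 = 0 := by
  unfold collapseMap
  have h0 := q.1.2.1
  split_ifs with h1
  · rcases h with h | h
    · left
      have hn : ‖q.2‖ = 1 := h.1
      rw [hn] at h1
      have : (q.1 : ℝ) = 0 := by linarith
      rwa [this, add_zero, one_smul]
    · right; simp [h]
  · exact Or.inl (domeMap_mem_hemisphere (norm_smul_smul_le hq (not_le.1 h1).le))

/-- A deformation of the cube through maps preserving the boundary, at the end of which
all faces but `{t 0 = 1}` are collapsed to a point. -/
theorem exists_cube_collapse (k : ℕ) :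
    ∃ (θ : C(I × (Fin (k + 1) → I), Fin (k + 1) → I)) (c₀ : Fin (k + 1) → I),
      (∀ c, θ (0, c) = c) ∧
      (∀ r, ∀ c ∈ Cube.boundary (Fin (k + 1)), θ (r, c) ∈ Cube.boundary (Fin (k + 1))) ∧
      (∀ c, (c 0 = 0 ∨ ∃ i : Fin k, c i.succ = 0 ∨ c i.succ = 1) → θ (1, c) = c₀) ∧
      c₀ ∈ Cube.boundary (Fin (k + 1)) := by
  let A : (Fin (k + 1) → I) → (Fin k → ℝ) × ℝ := fun c => cubeToBall (Fin.tail c, c 0)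
  let B : (Fin k → ℝ) × ℝ → Fin (k + 1) → I := fun z =>
    Fin.cons (ballToCube z).2 (ballToCube z).1
  have Ac : Continuous A :=
    continuous_cubeToBall.comp (continuous_fin_tail.prodMk (continuous_apply 0))
  have Bc : Continuous B := continuous_fin_cons.comp continuous_ballToCube
  have Amem : ∀ c, A c ∈ halfBall (Fin k) := fun c => cubeToBall_mem _
  have BA : ∀ c, B (A c) = c := fun c => by
    simp only [A, B, ballToCube_cubeToBall]; exact Fin.cons_self_tail c
  have AB : ∀ z ∈ halfBall (Fin k), A (B z) = z := fun z hz => cubeToBall_ballToCube hz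
  have bd : ∀ c, c ∈ Cube.boundary (Fin (k + 1)) ↔ A c ∈ hemisphere (Fin k) ∨ (A c).2 = 0 := by
    intro c
    have : (A c).2 = 0 ↔ c 0 = 1 := by
      simp only [A, cubeToBall, sub_eq_zero]
      exact ⟨fun h => Subtype.ext h.symm, fun h => by rw [h]; rfl⟩
    rw [this, mem_boundary_succ]
    simp only [A]
    rw [cubeToBall_mem_hemisphere]
    tauto
  refine ⟨⟨fun q => B (collapseMap (q.1, A q.2)), Bc.comp (continuousOn_collapseMap.comp_continuous
    (continuous_fst.prodMk (Ac.comp continuous_snd)) fun q => ⟨mem_univ _, Amem _⟩)⟩, B (0, 1),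
    fun c => ?_, fun r c hc => ?_, fun c hc => ?_, ?_⟩
  · simp only [ContinuousMap.coe_mk, collapseMap_zero (Amem c), BA]
  · simp only [ContinuousMap.coe_mk]
    rw [bd, AB _ (collapseMap_mem (Amem c))]
    exact collapseMap_boundary (Amem c) ((bd c).1 hc)
  · simp only [ContinuousMap.coe_mk]
    rw [collapseMap_one (cubeToBall_mem_hemisphere.2 hc)]
  · have h01 : ((0, 1) : (Fin k → ℝ) × ℝ) ∈ halfBall (Fin k) :=
      mem_halfBall_iff.2 (by norm_num)
    rw [bd, AB _ h01]
    exact Or.inl ((mem_hemisphere_iff h01).2 (Or.inr rfl))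

end Collapse

/-! ### Lifting paths up to homotopy. -/

section PathLifting

variable {E : Type*} {V : Type*} [TopologicalSpace E] [TopologicalSpace V]

/-- Paths from the image of `x` to `v` can be lifted, up to homotopy, to paths starting at `x`. -/
def LiftsPathsTo (G : C(E, V)) (v : V) (x : E) : Prop :=
  ∀ γ : Path (G x) v, ∃ (x' : E) (w : Path x x') (h : G x' = v),
    (w.map G.continuous).Homotopic (γ.cast rfl h)

/-- Go to `x₁` along `w`, then lift the image of `w` reversed followed by `γ`. -/
theorem LiftsPathsTo.of_joined {G : C(E, V)} {v : V} {x x₁ : E} (h : Joined x x₁)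
    (h₁ : LiftsPathsTo G v x₁) : LiftsPathsTo G v x := by
  obtain ⟨w⟩ := h
  intro γ
  obtain ⟨x', w', rfl, hw'⟩ := h₁ ((w.map G.continuous).symm.trans γ)
  refine ⟨x', w.trans w', rfl, ?_⟩
  rw [Path.map_trans]
  have h1 : ((w.map G.continuous).trans (w'.map G.continuous)).Homotopic
      ((w.map G.continuous).trans ((w.map G.continuous).symm.trans γ)) :=
    Path.Homotopic.hcomp (Path.Homotopic.refl _) hw'
  have h2 : (((w.map G.continuous).trans (w.map G.continuous).symm).trans γ).Homotopic
      ((w.map G.continuous).trans ((w.map G.continuous).symm.trans γ)) :=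
    ⟨Path.Homotopy.transAssoc _ _ _⟩
  have h3 : (((w.map G.continuous).trans (w.map G.continuous).symm).trans γ).Homotopic
      ((Path.refl _).trans γ) :=
    Path.Homotopic.hcomp ⟨(Path.Homotopy.reflTransSymm _).symm⟩ (Path.Homotopic.refl _)
  have h4 : ((Path.refl _).trans γ).Homotopic γ := ⟨Path.Homotopy.reflTrans _⟩
  exact ((h1.trans h2.symm).trans h3).trans h4

end PathLifting

/-! ### Lifting homotopies of cubes by means of connecting maps. -/

section CubeSpaces

variable {X : Type u} {Y : Type v} [TopologicalSpace X] [TopologicalSpace Y]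

/-- Maps of a cube whose boundary is mapped into `A`. -/
abbrev CubeMaps (n : ℕ) {X : Type u} [TopologicalSpace X] (A : Set X) : Type u :=
  {p : C(Fin n → I, X) // ∀ c ∈ Cube.boundary (Fin n), p c ∈ A}

/-- The constant map of a cube. -/
def CubeMaps.const (n : ℕ) {A : Set X} {a : X} (ha : a ∈ A) : CubeMaps n A :=
  ⟨ContinuousMap.const _ a, fun _ _ => ha⟩

/-- Postcomposition of cubes with boundary in `g ⁻¹' B` with the map `g`. -/
def CubeMaps.map (n : ℕ) (g : C(X, Y)) (B : Set Y) : C(CubeMaps n (g ⁻¹' B), CubeMaps n B) :=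
  ⟨fun p => ⟨g.comp p.1, p.2⟩,
    ((g.continuous_postcomp).comp continuous_subtype_val).subtype_mk _⟩

variable {n : ℕ} {A : Set X}

/-- A family of cube maps, parametrized by a locally compact space, is a map into the space of cube
maps. -/
def CubeMaps.curry {T : Type*} [TopologicalSpace T] (K : C(T × (Fin n → I), X))
    (hK : ∀ s, ∀ c ∈ Cube.boundary (Fin n), K (s, c) ∈ A) : C(T, CubeMaps n A) :=
  ⟨fun s => ⟨K.curry s, hK s⟩, K.curry.continuous.subtype_mk _⟩

theorem CubeMaps.continuous_uncurry {T : Type*} [TopologicalSpace T] {w : T → CubeMaps n A}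
    (hw : Continuous w) : Continuous fun q : T × (Fin n → I) => (w q.1).1 q.2 :=
  ContinuousMap.continuous_uncurry_of_continuous
    (⟨fun s => (w s).1, continuous_subtype_val.comp hw⟩ : C(T, C(Fin n → I, X)))

theorem CubeMaps.joined_of_homotopy (K : C(I × (Fin n → I), X))
    (hK : ∀ s, ∀ c ∈ Cube.boundary (Fin n), K (s, c) ∈ A) {p q : CubeMaps n A}
    (h0 : ∀ c, K (0, c) = p.1 c) (h1 : ∀ c, K (1, c) = q.1 c) : Joined p q :=
  ⟨⟨CubeMaps.curry K hK, Subtype.ext (ContinuousMap.ext h0),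
    Subtype.ext (ContinuousMap.ext h1)⟩⟩

theorem homotopicRel_of_joined {a : X} {p q : CubeMaps n {a}} (h : Joined p q) :
    p.1.HomotopicRel q.1 (Cube.boundary (Fin n)) := by
  obtain ⟨w⟩ := h
  refine ⟨⟨⟨⟨fun s => (w s.1).1 s.2, CubeMaps.continuous_uncurry w.continuous⟩, fun c => ?_,
    fun c => ?_⟩, fun s c hc => ?_⟩⟩
  · simp
  · simp
  · exact ((w s).2 c hc).trans (p.2 c hc).symm

/-- A path of cubes between constant ones, with boundary at `g x`, is an `(n + 1)`-loop. A relative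
loop over it, read as a path of cubes, starts at the constant cube and ends in the fibre. -/
theorem liftsPathsTo_const {g : C(X, Y)} {x : X} (h : Function.Surjective (relMap g x n)) :
    LiftsPathsTo (CubeMaps.map n g {g x}) (CubeMaps.const n (mem_singleton (g x)))
      (CubeMaps.const n (mem_fibre_self g x)) := by
  intro γ
  have γc := CubeMaps.continuous_uncurry γ.continuous
  let c : GenLoop (Fin (n + 1)) Y (g x) := ⟨⟨fun t => (γ (t 0)).1 (Fin.tail t),
    γc.comp ((continuous_apply 0).prodMk continuous_fin_tail)⟩, by
      intro t ht
      change (γ (t 0)).1 (Fin.tail t) = _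
      rcases mem_boundary_succ.1 ht with (k | k) | k
      · rw [k, γ.source]; rfl
      · rw [k, γ.target]; rfl
      · exact (γ (t 0)).2 _ k⟩
  obtain ⟨p, hp⟩ := h (Quotient.mk _ c)
  induction p using Quotient.inductionOn with
  | _ p =>
  obtain ⟨H⟩ : (relMapLoop g x n p).1.HomotopicRel c.1 (Cube.boundary (Fin (n + 1))) :=
    Quotient.exact hp
  have cc : Continuous fun q : I × (Fin n → I) => (Fin.cons q.1 q.2 : Fin (n + 1) → I) :=
    continuous_fin_cons.comp (continuous_snd.prodMk continuous_fst)
  have hbd : ∀ s t, ∀ b ∈ Cube.boundary (Fin n), H (s, Fin.cons t b) = g x := fun s t b hb => by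
    rw [H.eq_fst s (cons_mem_boundary.2 (Or.inr hb))]
    exact (relMapLoop g x n p).2 _ (cons_mem_boundary.2 (Or.inr hb))
  have hend : ∀ s b, H (s, Fin.cons 1 b) = g x := fun s b => by
    rw [H.eq_fst s (cons_mem_boundary.2 (Or.inl (Or.inr rfl)))]
    exact (relMapLoop g x n p).2 _ (cons_mem_boundary.2 (Or.inl (Or.inr rfl)))
  have hbeg : ∀ s b, H (s, Fin.cons 0 b) = g x := fun s b => by
    rw [H.eq_fst s (cons_mem_boundary.2 (Or.inl (Or.inl rfl)))]
    exact (relMapLoop g x n p).2 _ (cons_mem_boundary.2 (Or.inl (Or.inl rfl)))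
  let w : C(I, CubeMaps n (Fibre g x)) :=
    CubeMaps.curry (p.1.comp ⟨fun q => Fin.cons q.1 q.2, cc⟩) fun s b hb =>
      p.2.1 _ (cons_mem_boundary.2 (Or.inr hb))
  let K : C(I × I, CubeMaps n ({g x} : Set Y)) :=
    CubeMaps.curry (H.toContinuousMap.comp ⟨fun q => (q.1.1, Fin.cons q.1.2 q.2),
      (by fun_prop : Continuous _).prodMk (cc.comp ((by fun_prop : Continuous _).prodMk
        continuous_snd))⟩) fun s b hb => hbd _ _ b hb
  refine ⟨w 1, ⟨w, Subtype.ext (ContinuousMap.ext fun b => p.2.2 _ (Or.inl rfl)), rfl⟩,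
    Subtype.ext (ContinuousMap.ext fun b => p.2.1 _ (cons_mem_boundary.2 (Or.inl (Or.inr rfl)))),
    ⟨⟨⟨K, fun t => ?_, fun t => ?_⟩, fun s t ht => ?_⟩⟩⟩
  · exact Subtype.ext (ContinuousMap.ext fun b => H.apply_zero _)
  · refine Subtype.ext (ContinuousMap.ext fun b => (H.apply_one _).trans ?_)
    rfl
  · refine Subtype.ext (ContinuousMap.ext fun b => ?_)
    exact H.eq_fst s (cons_mem_boundary.2 (Or.inl ht))

/-- A cube lying entirely in `A` contracts to its corner through cubes in `A`; the boundary need not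
stay fixed. -/
theorem CubeMaps.joined_const {b : C(Fin n → I, X)} (hb : ∀ c, b c ∈ A) :
    Joined (⟨b, fun c _ => hb c⟩ : CubeMaps n A) (CubeMaps.const n (hb 0)) := by
  refine CubeMaps.joined_of_homotopy
    ⟨fun q => b fun i => unitInterval.symm q.1 * q.2 i, by fun_prop⟩ (fun s c _ => hb _)
    (fun c => ?_) (fun c => ?_)
  · simp
  · simp only [ContinuousMap.coe_mk, unitInterval.symm_one, zero_mul]; rfl

/-- Connecting maps exist at all points of the fibre over `y₀`. -/
def HasConnecting (g : C(X, Y)) (y₀ : Y) : Prop :=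
  ∀ x, g x = y₀ → ∃ d : ∀ n : ℕ, π_ (n + 1) Y (g x) → π_ n (Fibre g x) (fibrePt g x),
    IsConnecting g x d ∧ ∀ n p, d n (relMap g x n p) = relBdry g x n p

/-- A cube of dimension zero is a point, and the claim is exactness at `π_0(X)`. The sequence needs
a base point in the fibre, which `x₁` supplies. -/
theorem HasConnecting.exists_joined_zero {g : C(X, Y)} {y₀ : Y} (H : HasConnecting g y₀)
    {x₁ : X} (hx₁ : g x₁ = y₀) (p : CubeMaps 0 (g ⁻¹' {y₀}))
    (hp : Joined (CubeMaps.map 0 g {y₀} p) (CubeMaps.const 0 (mem_singleton y₀))) :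
    ∃ (x : X) (hx : x ∈ g ⁻¹' {y₀}), Joined p (CubeMaps.const 0 hx) := by
  subst hx₁
  obtain ⟨d, hd, -⟩ := H x₁ rfl
  let P : GenLoop (Fin 0) X x₁ := ⟨p.1, fun c ⟨i, _⟩ => i.elim0⟩
  obtain ⟨c, hc⟩ := (hd.exact_total 0 (Quotient.mk _ P)).1
    (Quotient.sound (homotopicRel_of_joined hp))
  induction c using Quotient.inductionOn with
  | _ c =>
  obtain ⟨G⟩ : P.1.HomotopicRel (loopMap 0 (fibreIncl g x₁) (fibrePt g x₁) c).1
    (Cube.boundary (Fin 0)) := Quotient.exact hc.symm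
  have hA : ∀ t, (c.1 t : X) ∈ Fibre g x₁ := fun t => (c.1 t).2
  refine ⟨_, hA 0, Joined.trans ?_ (CubeMaps.joined_const
    (b := (fibreIncl g x₁).comp c.1) hA)⟩
  exact CubeMaps.joined_of_homotopy G.toContinuousMap (fun s b ⟨i, _⟩ => i.elim0)
    (fun b => G.apply_zero b) (fun b => G.apply_one b)

/-- Collapsing all faces but one turns `p` into a relative loop based at a point of the fibre. Its
image is trivial by assumption, so it deforms into the fibre, where cubes contract. -/
theorem HasConnecting.exists_joined_succ {g : C(X, Y)} {y₀ : Y} (H : HasConnecting g y₀)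
    {k : ℕ} (p : CubeMaps (k + 1) (g ⁻¹' {y₀}))
    (hp : Joined (CubeMaps.map (k + 1) g {y₀} p) (CubeMaps.const (k + 1) (mem_singleton y₀))) :
    ∃ (x : X) (hx : x ∈ g ⁻¹' {y₀}), Joined p (CubeMaps.const (k + 1) hx) := by
  obtain ⟨θ, c₀, θ0, θb, θ1, hc₀⟩ := exists_cube_collapse k
  obtain ⟨x, hx⟩ : ∃ x, p.1 c₀ = x := ⟨_, rfl⟩
  have hgx : g x = y₀ := hx ▸ p.2 c₀ hc₀
  subst hgx
  obtain ⟨d, hd, hd'⟩ := H x rfl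
  let q : CubeMaps (k + 1) (Fibre g x) :=
    ⟨p.1.comp (θ.comp ⟨fun c => (1, c), by fun_prop⟩), fun c hc => p.2 _ (θb 1 c hc)⟩
  have hpq : Joined p q := CubeMaps.joined_of_homotopy (p.1.comp θ)
    (fun s c hc => p.2 _ (θb s c hc)) (fun c => congrArg p.1 (θ0 c)) (fun c => rfl)
  let Q : RelLoop k (Fibre g x) x := ⟨q.1, q.2, fun c hc => (congrArg p.1 (θ1 c hc)).trans hx⟩
  have hQ : relMap g x k (Quotient.mk _ Q) = 1 :=
    Quotient.sound (homotopicRel_of_joined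
      (((hpq.map (CubeMaps.map (k + 1) g {g x}).continuous).symm).trans hp))
  obtain ⟨b, hb⟩ := hd.eq_of_relMap_eq_one hd' (Quotient.mk _ Q) hQ
  obtain ⟨G⟩ : ContinuousMap.HomotopicWith Q.1 (RelLoop.ofGenLoop (mem_fibre_self g x)
    (loopMap (k + 1) (fibreIncl g x) (fibrePt g x) b)).1
    (IsRelLoop k (Fibre g x) x) := Quotient.exact hb
  have hA : ∀ t, (b.1 t : X) ∈ Fibre g x := fun t => (b.1 t).2
  refine ⟨_, hA 0, hpq.trans (Joined.trans ?_ (CubeMaps.joined_const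
    (b := (fibreIncl g x).comp b.1) hA))⟩
  exact CubeMaps.joined_of_homotopy G.toContinuousMap (fun s c hc => (G.prop s).1 c hc)
    (fun c => G.apply_zero c) (fun c => G.apply_one c)

/-- The path `γ` itself shows that the image of `p` is null-homotopic. Hence `p` is joined to a
constant cube, for which paths lift by surjectivity of `relMap`. -/
theorem HasConnecting.liftsPathsTo {g : C(X, Y)} {y₀ : Y} (H : HasConnecting g y₀)
    {x₁ : X} (hx₁ : g x₁ = y₀) (p : CubeMaps n (g ⁻¹' {y₀})) :
    LiftsPathsTo (CubeMaps.map n g {y₀}) (CubeMaps.const n (mem_singleton y₀)) p := by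
  intro γ
  obtain ⟨x, hx, hpx⟩ : ∃ (x : X) (hx : x ∈ g ⁻¹' {y₀}), Joined p (CubeMaps.const n hx) := by
    cases n with
    | zero => exact H.exists_joined_zero hx₁ p ⟨γ⟩
    | succ k => exact H.exists_joined_succ p ⟨γ⟩
  have hx' : g x = y₀ := hx
  subst hx'
  obtain ⟨d, hd, hd'⟩ := H x rfl
  exact LiftsPathsTo.of_joined hpx (liftsPathsTo_const (hd.relMap_surjective hd' n)) γ

/-- The lifting property for homotopies of cubes which end at a point. -/
theorem HasConnecting.exists_lift {g : C(X, Y)} {y₀ : Y} (H : HasConnecting g y₀)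
    {x₁ : X} (hx₁ : g x₁ = y₀) (x : C(Fin n → I, X)) (y : C((Fin n → I) × I, Y))
    (hxy : ∀ c, y (c, 0) = g (x c)) (hside : ∀ c ∈ Cube.boundary (Fin n), ∀ t, y (c, t) = y₀)
    (hend : ∀ c, y (c, 1) = y₀) :
    ∃ (x' : C((Fin n → I) × I, X)) (h : C(((Fin n → I) × I) × I, Y)),
      (∀ c, x' (c, 0) = x c) ∧ (∀ q, h (q, 0) = g (x' q)) ∧ (∀ q, h (q, 1) = y q) ∧
      (∀ c s, h ((c, 0), s) = y (c, 0)) ∧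
      ∀ c t s, (c ∈ Cube.boundary (Fin n) ∨ t = 1) → h ((c, t), s) = y₀ := by
  let p : CubeMaps n (g ⁻¹' {y₀}) := ⟨x, fun c hc => (hxy c).symm.trans (hside c hc 0)⟩
  let γ : Path (CubeMaps.map n g {y₀} p) (CubeMaps.const n (mem_singleton y₀)) :=
    ⟨CubeMaps.curry ⟨fun q => y (q.2, q.1), by fun_prop⟩ fun s c hc => hside c hc s,
      Subtype.ext (ContinuousMap.ext hxy), Subtype.ext (ContinuousMap.ext hend)⟩
  obtain ⟨p', w, hp', ⟨K⟩⟩ := H.liftsPathsTo hx₁ p γ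
  have wc := CubeMaps.continuous_uncurry w.continuous
  have Kc := CubeMaps.continuous_uncurry K.continuous
  refine ⟨⟨fun q => (w q.2).1 q.1, wc.comp (by fun_prop : Continuous fun q : (Fin n → I) × I => (q.2, q.1))⟩,
    ⟨fun q => (K (q.2, q.1.2)).1 q.1.1, Kc.comp
      (by fun_prop : Continuous fun q : ((Fin n → I) × I) × I => ((q.2, q.1.2), q.1.1))⟩,
    fun c => ?_, fun q => ?_, fun q => ?_, fun c s => ?_, fun c t s hc => ?_⟩
  · simp [p]
  · simp only [ContinuousMap.coe_mk, K.apply_zero]; rfl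
  · simp only [ContinuousMap.coe_mk, K.apply_one]; rfl
  · simp only [ContinuousMap.coe_mk]
    rw [K.source, hxy]; rfl
  · rcases hc with hc | rfl
    · exact (K (s, t)).2 c hc
    · simp only [ContinuousMap.coe_mk]
      rw [K.target, hp']; rfl

end CubeSpaces

/-! ### From lifting over cylinders to lifting over half balls. -/

section BallForm

variable {X : Type u} {Y : Type v} [TopologicalSpace X] [TopologicalSpace Y]
  {ι : Type*} [Fintype ι]

/-- The half ball as a quotient of the cylinder over the unit ball: the bottom becomes the
hemisphere, the rest of the boundary the flat part. -/
def cylinderToBall (q : (ι → ℝ) × ℝ) : (ι → ℝ) × ℝ :=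
  ((domeMap q.1).1, (1 - q.2) * (domeMap q.1).2)

/-- A homotopy inverse of `cylinderToBall`. -/
def ballToCylinder (z : (ι → ℝ) × ℝ) : (ι → ℝ) × ℝ :=
  z.2 • ((1 / 2 : ℝ) • z.1, (0 : ℝ)) + (1 - z.2) • domeMap z.1

theorem continuous_cylinderToBall : Continuous (cylinderToBall (ι := ι)) := by
  have h := (continuous_domeMap (ι := ι)).comp (continuous_fst (Y := ℝ))
  exact h.fst.prodMk ((continuous_const.sub continuous_snd).mul h.snd)

theorem continuous_ballToCylinder : Continuous (ballToCylinder (ι := ι)) := by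
  have h := (continuous_domeMap (ι := ι)).comp (continuous_fst (Y := ℝ))
  exact Continuous.add (by fun_prop) ((continuous_const.sub continuous_snd).smul h)

theorem cylinderToBall_mem {q : (ι → ℝ) × ℝ} (h1 : ‖q.1‖ ≤ 1) (h2 : 0 ≤ q.2) (h3 : q.2 ≤ 1) :
    cylinderToBall q ∈ halfBall ι := by
  have h := domeMap_snd_mem h1
  exact mem_halfBall_iff.2 ⟨norm_domeMap_fst_le _, mul_nonneg (by linarith) h.1,
    mul_le_one₀ (by linarith) h.1 h.2⟩

theorem ballToCylinder_mem {z : (ι → ℝ) × ℝ} (hz : z ∈ halfBall ι) :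
    ‖(ballToCylinder z).1‖ ≤ 1 ∧ 0 ≤ (ballToCylinder z).2 ∧ (ballToCylinder z).2 ≤ 1 := by
  obtain ⟨h1, h2, h3⟩ := mem_halfBall_iff.1 hz
  have k := domeMap_snd_mem h1
  refine ⟨?_, ?_, ?_⟩
  · simp only [ballToCylinder, Prod.fst_add, Prod.smul_fst]
    refine (norm_add_le _ _).trans ?_
    have k1 := norm_domeMap_fst_le z.1
    rw [norm_smul, norm_smul, norm_smul, Real.norm_of_nonneg h2,
      Real.norm_of_nonneg (by linarith : 0 ≤ 1 - z.2), Real.norm_of_nonneg (by norm_num)]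
    nlinarith [norm_nonneg z.1]
  · simp only [ballToCylinder, Prod.snd_add, Prod.smul_snd, smul_eq_mul, mul_zero, zero_add]
    exact mul_nonneg (by linarith) k.1
  · simp only [ballToCylinder, Prod.snd_add, Prod.smul_snd, smul_eq_mul, mul_zero, zero_add]
    exact mul_le_one₀ (by linarith) k.1 k.2

theorem ballToCylinder_of_mem_hemisphere {z : (ι → ℝ) × ℝ} (hz : z ∈ hemisphere ι) :
    ballToCylinder z = ((1 - z.2 / 2) • z.1, 0) := by
  rcases (mem_hemisphere_iff (hemisphere_subset hz)).1 hz with h | h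
  · rw [ballToCylinder, domeMap_of_norm_eq_one h]
    refine Prod.ext ?_ ?_
    · simp only [Prod.fst_add, Prod.smul_fst, smul_smul, ← add_smul]
      congr 1; ring
    · simp
  · rw [ballToCylinder, h]
    refine Prod.ext ?_ ?_
    · simp only [Prod.smul_fst, smul_smul, sub_self, zero_smul, add_zero]
      congr 1; ring
    · simp

theorem cylinderToBall_ballToCylinder {z : (ι → ℝ) × ℝ} (hz : z ∈ hemisphere ι) :
    cylinderToBall (ballToCylinder z) = z := by
  rw [ballToCylinder_of_mem_hemisphere hz, cylinderToBall, domeMap_of_mem_hemisphere hz]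
  simp

theorem ballToCylinder_of_snd_eq_zero {z : (ι → ℝ) × ℝ} (hz : z.2 = 0) :
    ballToCylinder z = domeMap z.1 := by
  simp [ballToCylinder, hz]

theorem cylinderToBall_snd {q : (ι → ℝ) × ℝ} (h : ‖q.1‖ = 1 ∨ q.2 = 1) :
    (cylinderToBall q).2 = 0 := by
  rcases h with h | h
  · simp [cylinderToBall, domeMap_of_norm_eq_one h]
  · simp [cylinderToBall, h]

theorem convex_halfBall : Convex ℝ (halfBall ι) := by
  have h1 : Convex ℝ {z : (ι → ℝ) × ℝ | ‖z‖ ≤ 1} := by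
    simpa [Metric.closedBall, dist_zero_right] using
      convex_closedBall (0 : (ι → ℝ) × ℝ) 1
  exact h1.inter (convex_halfSpace_ge (LinearMap.snd ℝ (ι → ℝ) ℝ).isLinear 0)

/-- The problem is pulled back to the cylinder by `cylinderToBall`, solved there, and carried back
by `ballToCylinder`. The round trip is not the identity, but the straight line in the convex half
ball joins it to the identity, fixing the hemisphere and preserving the flat part. -/
theorem PairLifting.of_exists_lift {g : C(X, Y)} {y₀ : Y} {m : ℕ} (e : ι ≃ Fin m)
    (H : ∀ (x : C(Fin m → I, X)) (y : C((Fin m → I) × I, Y)),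
      (∀ c, y (c, 0) = g (x c)) → (∀ c ∈ Cube.boundary (Fin m), ∀ t, y (c, t) = y₀) →
      (∀ c, y (c, 1) = y₀) →
      ∃ (x' : C((Fin m → I) × I, X)) (h : C(((Fin m → I) × I) × I, Y)),
        (∀ c, x' (c, 0) = x c) ∧ (∀ q, h (q, 0) = g (x' q)) ∧ (∀ q, h (q, 1) = y q) ∧
        (∀ c s, h ((c, 0), s) = y (c, 0)) ∧
        ∀ c t s, (c ∈ Cube.boundary (Fin m) ∨ t = 1) → h ((c, t), s) = y₀) :
    PairLifting ι g univ {y₀} := by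
  intro x y xc yc hxy _ hy₀
  let A : (Fin m → I) → ι → ℝ := fun c i => 2 * (c (e i) : ℝ) - 1
  let B : (ι → ℝ) → Fin m → I := fun p j => projIcc 0 1 zero_le_one ((p (e.symm j) + 1) / 2)
  have Ac : Continuous A := by fun_prop
  have Bc : Continuous B := by fun_prop
  have An : ∀ c, ‖A c‖ ≤ 1 := fun c =>
    (pi_norm_le_iff_of_nonneg zero_le_one).2 fun i => abs_two_mul_sub_one_le _
  have AB : ∀ p, ‖p‖ ≤ 1 → A (B p) = p := fun p hp => funext fun i => by
    have h := abs_le.1 ((norm_le_pi_norm p i).trans hp)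
    simp only [A, B, e.symm_apply_apply]
    rw [projIcc_of_mem (zero_le_one) (⟨by linarith, by linarith⟩ : (p i + 1) / 2 ∈ Icc (0 : ℝ) 1)]
    ring
  have bd : ∀ c, c ∈ Cube.boundary (Fin m) ↔ ‖A c‖ = 1 := fun c => by
    rw [norm_eq_one_iff (An c)]
    constructor
    · rintro ⟨j, hj⟩
      exact ⟨e.symm j, abs_two_mul_sub_one_eq.2 (by rwa [e.apply_symm_apply])⟩
    · rintro ⟨i, hi⟩
      exact ⟨e i, abs_two_mul_sub_one_eq.1 hi⟩
  have cmem : ∀ q : (Fin m → I) × I, cylinderToBall (A q.1, (q.2 : ℝ)) ∈ halfBall ι := fun q =>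
    cylinderToBall_mem (An _) q.2.2.1 q.2.2.2
  have flat : ∀ (c : Fin m → I) (t : I), (c ∈ Cube.boundary (Fin m) ∨ t = 1) →
      (cylinderToBall (A c, (t : ℝ))).2 = 0 := fun c t h =>
    cylinderToBall_snd (h.imp (bd c).1 fun h => by rw [h]; rfl)
  obtain ⟨x', h, hx', h0, h1, hbot, hflat⟩ := H
    ⟨fun c => x (domeMap (A c)), xc.comp_continuous (continuous_domeMap.comp Ac)
      fun c => domeMap_mem_hemisphere (An c)⟩
    ⟨fun q => y (cylinderToBall (A q.1, (q.2 : ℝ))),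
      yc.comp_continuous (continuous_cylinderToBall.comp (by fun_prop)) cmem⟩
    (fun c => by
      have : cylinderToBall (A c, ((0 : I) : ℝ)) = domeMap (A c) := by simp [cylinderToBall]
      simp only [ContinuousMap.coe_mk, this]
      exact (hxy _ (domeMap_mem_hemisphere (An c))).symm)
    (fun c hc t => hy₀ _ (cmem (c, t)) (flat c t (Or.inl hc)))
    (fun c => hy₀ _ (cmem (c, 1)) (flat c 1 (Or.inr rfl)))
  let C : (ι → ℝ) × ℝ → (Fin m → I) × I := fun z =>
    (B (ballToCylinder z).1, projIcc 0 1 zero_le_one (ballToCylinder z).2)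
  have Cc : Continuous C :=
    (Bc.comp continuous_ballToCylinder.fst).prodMk
      (continuous_projIcc.comp continuous_ballToCylinder.snd)
  have AC : ∀ z ∈ halfBall ι, (A (C z).1, ((C z).2 : ℝ)) = ballToCylinder z := fun z hz => by
    have hm := ballToCylinder_mem hz
    refine Prod.ext (AB _ hm.1) ?_
    simp only [C]
    rw [projIcc_of_mem (zero_le_one) ⟨hm.2.1, hm.2.2⟩]
  have Chemi : ∀ z ∈ hemisphere ι, (C z).2 = 0 := fun z hz => by
    simp [C, ballToCylinder_of_mem_hemisphere hz]
  have Cflat : ∀ z ∈ halfBall ι, z.2 = 0 → (C z).1 ∈ Cube.boundary (Fin m) ∨ (C z).2 = 1 := by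
    intro z hz h0
    have hac := AC z hz
    rw [ballToCylinder_of_snd_eq_zero h0] at hac
    rcases domeMap_cases z.1 with k | k
    · exact Or.inl ((bd _).2 (by rw [← k, ← hac]))
    · exact Or.inr (Subtype.ext (by rw [Icc.coe_one, ← k, ← hac]))
  have Lmem : ∀ z ∈ halfBall ι, ∀ s : I,
      (1 - (s : ℝ)) • cylinderToBall (ballToCylinder z) + (s : ℝ) • z ∈ halfBall ι := fun z hz s => by
    have hm := ballToCylinder_mem hz
    exact convex_halfBall (cylinderToBall_mem hm.1 hm.2.1 hm.2.2) hz (by linarith [s.2.2]) s.2.1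
      (by ring)
  have yC : ∀ z ∈ halfBall ι, h (C z, 1) = y (cylinderToBall (ballToCylinder z)) := fun z hz => by
    rw [h1]
    simp only [ContinuousMap.coe_mk, AC z hz]
  have yhemi : ∀ z ∈ hemisphere ι, ∀ s : I,
      (1 - (s : ℝ)) • cylinderToBall (ballToCylinder z) + (s : ℝ) • z = z := fun z hz s => by
    rw [cylinderToBall_ballToCylinder hz, ← add_smul, sub_add_cancel, one_smul]
  have hhemi : ∀ z ∈ hemisphere ι, ∀ s, h (C z, s) = y z := fun z hz s => by
    have hz' := hemisphere_subset hz
    have e1 : C z = ((C z).1, 0) := Prod.ext rfl (Chemi z hz)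
    have e2 := hbot (C z).1 1
    rw [e1, hbot, ← e2, ← e1, yC z hz', cylinderToBall_ballToCylinder hz]
  obtain ⟨k, kc, hk⟩ := exists_concat (isClosed_halfBall ι)
    (h₁ := fun q => h (C q.1, q.2))
    (h₂ := fun q => y ((1 - (q.2 : ℝ)) • cylinderToBall (ballToCylinder q.1) + (q.2 : ℝ) • q.1))
    (by fun_prop)
    (yc.comp (by
      have := (continuous_cylinderToBall (ι := ι)).comp continuous_ballToCylinder
      have h3 : Continuous fun q : ((ι → ℝ) × ℝ) × I => cylinderToBall (ballToCylinder q.1) :=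
        this.comp continuous_fst
      fun_prop) fun q hq => Lmem _ hq.1 _)
    (fun z hz => by simp [yC z hz])
  have dec : ∀ z ∈ halfBall ι, ∀ s, (∃ r, k (z, s) = h (C z, r)) ∨
      ∃ r : I, k (z, s) = y ((1 - (r : ℝ)) • cylinderToBall (ballToCylinder z) + (r : ℝ) • z) := by
    intro z hz s
    rcases le_total (s : ℝ) (1 / 2) with hs | hs
    exacts [Or.inl ⟨_, (hk z hz s).1 hs⟩, Or.inr ⟨_, (hk z hz s).2 hs⟩]
  refine ⟨fun z => x' (C z), k, (x'.continuous.comp Cc).continuousOn, fun z hz => ?_, kc,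
    fun z hz => ?_, fun z hz => ?_, fun _ _ _ => mem_univ _, fun z hz hz0 s => ?_,
    fun z hz s => ?_⟩
  · have hz' := hemisphere_subset hz
    have e1 : C z = ((C z).1, 0) := Prod.ext rfl (Chemi z hz)
    have e3 := congrArg Prod.fst (AC z hz')
    simp only [ballToCylinder_of_mem_hemisphere hz] at e3
    dsimp only
    rw [e1, hx']
    simp only [ContinuousMap.coe_mk, e3, domeMap_of_mem_hemisphere hz]
  · rw [(hk z hz 0).1 (by norm_num), stretchLeft_zero, h0]
  · rw [(hk z hz 1).2 (by norm_num), stretchRight_one]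
    simp
  · rcases dec z hz s with ⟨r, hr⟩ | ⟨r, hr⟩
    · rw [hr]
      exact hflat _ _ _ (Cflat z hz hz0)
    · rw [hr]
      refine hy₀ _ (Lmem z hz r) ?_
      have : (cylinderToBall (ballToCylinder z)).2 = 0 := by
        rw [← AC z hz]; exact flat _ _ (Cflat z hz hz0)
      simp [this, hz0]
  · rcases dec z (hemisphere_subset hz) s with ⟨r, hr⟩ | ⟨r, hr⟩
    · rw [hr, hhemi z hz]
    · rw [hr, yhemi z hz]

theorem HasConnecting.pairLifting {g : C(X, Y)} {y₀ : Y} (H : HasConnecting g y₀)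
    {x₁ : X} (hx₁ : g x₁ = y₀) : PairLifting ι g univ {y₀} :=
  PairLifting.of_exists_lift (Fintype.equivFin ι) fun x y h1 h2 h3 => H.exists_lift hx₁ x y h1 h2 h3

open Classical in
theorem PairLifting.of_restrictPreimage {f : C(X, Y)} {U : Set Y} {y₀ : U}
    (H : PairLifting ι (f.restrictPreimage U) univ {y₀}) (x₁ : f ⁻¹' U) :
    PairLifting ι f U {(y₀ : Y)} := by
  intro x y xc yc hxy hyU hy₀
  -- The default values `x₁` and `y₀` are taken only outside the domains on which the data matter.
  let xU : (ι → ℝ) × ℝ → f ⁻¹' U := fun z => if h : x z ∈ f ⁻¹' U then ⟨x z, h⟩ else x₁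
  let yU : (ι → ℝ) × ℝ → U := fun z => if h : y z ∈ U then ⟨y z, h⟩ else y₀
  have ex : ∀ z ∈ hemisphere ι, (xU z : X) = x z := fun z hz => by
    have : x z ∈ f ⁻¹' U := by
      rw [mem_preimage, hxy z hz]
      exact hyU z (hemisphere_subset hz)
    simp only [xU, dif_pos this]
  have ey : ∀ z ∈ halfBall ι, (yU z : Y) = y z := fun z hz => by
    simp only [yU, dif_pos (hyU z hz)]
  obtain ⟨x', h, x'c, hx', hc, h0, h1, -, hB, hr⟩ := H xU yU
    (Topology.IsInducing.subtypeVal.continuousOn_iff.2 (xc.congr ex))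
    (Topology.IsInducing.subtypeVal.continuousOn_iff.2 (yc.congr ey))
    (fun z hz => Subtype.ext (by
      rw [ey z (hemisphere_subset hz), ← hxy z hz, ← ex z hz]; rfl))
    (fun _ _ => mem_univ _)
    (fun z hz hz0 => Subtype.ext ((ey z hz).trans (hy₀ z hz hz0)))
  refine ⟨fun z => x' z, fun q => h q, continuous_subtype_val.comp_continuousOn x'c,
    fun z hz => ?_, continuous_subtype_val.comp_continuousOn hc, fun z hz => ?_, fun z hz => ?_,
    fun z hz s => (h (z, s)).2, fun z hz hz0 s => ?_, fun z hz s => ?_⟩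
  · exact (congrArg Subtype.val (hx' hz)).trans (ex z hz)
  · exact congrArg Subtype.val (h0 z hz)
  · exact (congrArg Subtype.val (h1 z hz)).trans (ey z hz)
  · exact congrArg Subtype.val (hB z hz hz0 s)
  · exact (congrArg Subtype.val (hr z hz s)).trans (ey z (hemisphere_subset hz))

theorem IsCDistinguished.pairLifting {f : C(X, Y)} (hf : Function.Surjective f) {U S : Set Y}
    (h : IsCDistinguished f U S) {y₀ : Y} (hy₀ : y₀ ∈ S) : PairLifting ι f U {y₀} := by
  obtain ⟨x₁, rfl⟩ := hf y₀
  have hU : f x₁ ∈ U := h.1 hy₀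
  have H : HasConnecting (f.restrictPreimage U) ⟨f x₁, hU⟩ := fun x hx =>
    h.2.2 x (by rw [hx]; exact hy₀)
  exact PairLifting.of_restrictPreimage (H.pairLifting (x₁ := ⟨x₁, hU⟩) rfl) ⟨x₁, hU⟩

theorem IsExhaustive.exists_joinedIn {U S : Set Y}
    (h : IsExhaustive ((Subtype.val : U → Y) ⁻¹' S)) {v : Y} (hv : v ∈ U) :
    ∃ s ∈ S, JoinedIn U v s := by
  obtain ⟨s, hs, ⟨w⟩⟩ := h ⟨v, hv⟩
  exact ⟨s, hs, w.map continuous_subtype_val, fun t => (w t).2⟩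

end BallForm

end CQuasi

end

/-! ### The theorem on coverings by distinguished sets. -/

theorem mainTheorem2 {X : Type*} {Y : Type*} [TopologicalSpace X] [TopologicalSpace Y]
    (f : C(X, Y)) (hf : Function.Surjective f)
    {J : Type*} (U : J → Set Y) (hU_open : ∀ α, IsOpen (U α)) (hU_cover : ⋃ α, U α = Set.univ)
    (hU_inter : ∀ α β, ∃ γ, U γ = U α ∩ U β)
    (U' : J → Set Y) (hU'_sub : ∀ α, U' α ⊆ U α)
    (hU'_exh : ∀ α, CQuasi.IsExhaustive ((Subtype.val : U α → Y) ⁻¹' U' α))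
    (hU'_mono : ∀ β γ, U β ⊆ U γ → U' β ⊆ U' γ)
    (hU_dist : ∀ α, CQuasi.IsCDistinguished f (U α) (U' α)) :
    ∃ S : Set Y, CQuasi.IsExhaustive S ∧ CQuasi.IsCQuasifibration f S := by
  -- The exhaustive set is the union of the given ones: each point is joined inside a member of the
  -- cover to one of them.
  have hS : CQuasi.IsExhaustive (⋃ α, U' α) := fun y => by
    obtain ⟨α, hα⟩ := Set.mem_iUnion.1 (hU_cover.symm ▸ Set.mem_univ y : y ∈ ⋃ α, U α)
    obtain ⟨s, hs, hj⟩ := (hU'_exh α).exists_joinedIn hα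
    exact ⟨s, Set.mem_iUnion.2 ⟨α, hs⟩, hj.joined⟩
  -- A point of `U' γ` also lies in `U' β`, so it supplies the lifting property for both members.
  have hcov : ∀ β γ, U γ ⊆ U β → ∀ (κ : Type) [Fintype κ], CQuasi.PairLifting κ f (U β) (U γ) :=
    fun β γ hγβ κ _ => CQuasi.PairLifting.of_points hγβ (hU'_sub γ)
      (fun v hv => (hU'_exh γ).exists_joinedIn hv)
      (fun y₀ hy₀ κ _ => (hU_dist β).pairLifting hf (hU'_mono γ β hγβ hy₀))
      (fun y₀ hy₀ κ _ => (hU_dist γ).pairLifting hf hy₀)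
  refine ⟨_, hS, hS, fun x hx => ?_⟩
  obtain ⟨α, hα⟩ := Set.mem_iUnion.1 hx
  exact CQuasi.PairLifting.exists_isConnecting hf fun n => CQuasi.PairLifting.trans (hU'_sub α hα)
    (CQuasi.PairLifting.of_cover hU_open hU_cover hU_inter hcov α) ((hU_dist α).pairLifting hf hα)
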